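/- **Theorem (Soundness for homotopy semantics).** Let $(\mathcal L,h)$ be an essentially finite $h$-signature (for instance one underlying a $\mathrm{FOL}_{\cong}$-signature, i.e. one that contains all the logical sorts allowed by $h$), let $\mathbb T$ be a set of $\mathcal L$-sequents and $\sigma$ an $\mathcal L$-sequent. If $\sigma$ is derivable from $\mathbb T$ in the deductive system $\mathcal D_{\cong}$ (resp. $\mathcal D_{\cong}$ with the law of excluded middle), then every homotopy $\mathcal L$-structure in HoTT (resp. HoTT + LEM) that satisfies all sequents of $\mathbb T$ satisfies $\sigma$. Here the notions are as follows. *Signatures.* An inverse category is a skeletal category without non-identity endomorphisms in which every object is the domain of finitely many arrows; $K/\!/\mathcal L$ is the set of non-identity arrows with domain $K$, and an arrow in it is top-level if it is not a composite of two non-identity arrows. An $h$-signature is an inverse category $\mathcal L$ with a proper order (a strict order on objects with $K_f<K$ for each non-identity $f\colon K\to K_f$, and compatible enumerations of each $K/\!/\mathcal L$ and of the non-logical objects) and a function $h\colon\mathrm{ob}\,\mathcal L\to\mathbb N\cup\{\infty\}$. Each object ("sort") is either non-logical, in which case $h\neq 0$, or is one of the following logical sorts, each occurring at most once (with $\infty-m=\infty$):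 - $\cong_K$, where $h(K)\ge 2$, with exactly two top-level arrows $s,t\colon{\cong_K}\to K$, $gs=gt$ for all $g\in K/\!/\mathcal L$, and $h(\cong_K)=h(K)-1$; - $\rho_K$, where $h(K)\ge 2$, with exactly one top-level arrow $r\colon\rho_K\to{\cong_K}$, $sr=tr$, and $h(\rho_K)=h(K)-2$; - $\tau_f$, where $f\colon A\to K$ is top-level and $\cong_K\in\mathcal L$, with exactly three top-level arrows $e\colon\tau_f\to{\cong_K}$ and $f_1,f_2\colon\tau_f\to A$, $se=ff_1$, $te=ff_2$, $gf_1=gf_2$ for all $g\in A/\!/\mathcal L\setminus\{f\}$, and $h(\tau_f)=h(A)-1$. It is essentially finite if it has finitely many non-logical sorts. *Syntax.* Sort expressions are $A(x_f)_{f\in A/\!/\mathcal L}$ with variables $x_f$; contexts are lists of variable declarations; $A(x_f)_f$ is well-formed in $\Gamma$ if each $x_f\colon K_f(x_{pf})_{p\in K_f/\!/\mathcal L}$ is declared in $\Gamma$. Formulas are built from $\top,\bot,\wedge,\vee,\to$ and $\forall x{:}K,\exists x{:}K$; a sort expression $K$ is also used as the formula $\exists x{:}K.\top$. A sequent $\Gamma\mid\phi\Rightarrow\psi$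 consists of a well-formed context and two formulas well-formed in it. *Deductive system.* All sequents are well-formed. The rules of $\mathcal D_{\cong}$ are: identity, cut, substitution along context morphisms, weakening and exchange of contexts; $\phi\Rightarrow\top$; $\bot\Rightarrow\phi$; $\exists x{:}K.\phi\Rightarrow\exists x{:}K.\top$; the two-way rules: $\theta\Rightarrow\phi\wedge\psi$ iff $\theta\Rightarrow\phi$ and $\theta\Rightarrow\psi$; $\phi\vee\psi\Rightarrow\theta$ iff $\phi\Rightarrow\theta$ and $\psi\Rightarrow\theta$; $\theta\Rightarrow(\phi\to\psi)$ iff $\theta\wedge\phi\Rightarrow\psi$; $\Gamma\mid\theta\Rightarrow\forall x{:}K.\phi$ iff $\Gamma,x{:}K\mid\theta\Rightarrow\phi$; $\Gamma\mid\exists x{:}K.\phi\Rightarrow\theta$ iff $\Gamma,x{:}K\mid\phi\Rightarrow\theta$; the Frobenius and distributivity axioms; and - $(\rho)$: $\Gamma,x{:}K\mid\theta\Rightarrow\exists q{:}x\cong x.\,\rho(q)$; - $(\tau\rho)$: $\Gamma,x{:}K,\alpha{:}A,q{:}x\cong x\mid\rho(q)\wedge\theta\Rightarrow\tau_f(q,\alpha,\alpha)$;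 - (J): from $\Gamma,x{:}K,q{:}x\cong x\mid\rho(q)\wedge\theta[x,x,q]\Rightarrow\phi[x,x,q]$ infer $\Gamma,x{:}K,y{:}K,p{:}x\cong y\mid\theta\Rightarrow\phi$. LEM is the axiom $\Gamma\mid\top\Rightarrow\phi\vee(\phi\to\bot)$. *Semantics.* HoTT is the formal system of intensional Martin-Löf type theory with $\Pi,\Sigma,\mathrm{Id},\mathbf 1,\mathbf 0,+$, propositional truncation $\|\cdot\|$, function extensionality and a univalent universe $\mathcal U$ (with decoding $\mathrm{El}$) closed under these; HoTT + LEM adds an inhabitant of $\prod_{X:\mathcal U}\mathrm{isProp}(\mathrm{El}\,X)\to \mathrm{El}\,X+(\mathrm{El}\,X\to\mathbf 0)$. With $\mathcal U_m$ the type of types in $\mathcal U$ of $h$-level $m$ (and $\mathcal U_\infty=\mathcal U$), a homotopy $\mathcal L$-structure $\mathcal M$ is a derivable term (in some context, possibly empty) of the iterated $\Sigma$-type of the types $T_K=\prod_{f\in K/\!/\mathcal L}(x_f:[\![K_f(x_{pf})_p]\!])\,.\,\mathcal U_{h(K)}$, $K$ running over the non-logical sorts in order; if $K/\!/\mathcal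 L=\varnothing$ then $T_K=\mathbf 1\to\mathcal U_{h(K)}$. Sorts are interpreted by - $[\![K(\mathbf x)]\!]=\mathrm{El}(K^{\mathcal M}(\mathbf x))$ for $K$ non-logical, - $[\![{\cong_K}(\mathbf x)]\!]=\mathrm{Id}_{[\![K(x_{ps})_p]\!]}(x_s,x_t)$, - $[\![\rho_K(\mathbf x)]\!]=\mathrm{Id}(x_r,\mathrm{refl}_{x_{sr}})$, - $[\![\tau_f(\mathbf x)]\!]=\mathrm{Id}_{[\![A(x_{pf_2})_p]\!]}\big(x_{f_2},\mathrm{trans}^{P}_{x_e}(x_{f_1})\big)$, where $P(w)$ is $[\![A(x_{pf_1})_p]\!]$ with $w$ put in position $f$; and formulas by $\top\mapsto\mathbf 1$, $\bot\mapsto\mathbf 0$, $\wedge\mapsto\times$, $\to\;\mapsto\;\to$, $\forall\mapsto\Pi$, $\phi\vee\psi\mapsto\|[\![\phi]\!]+[\![\psi]\!]\|$, $\exists x{:}K.\phi\mapsto\|\Sigma_{x:[\![K]\!]}[\![\phi]\!]\|$. The structure $\mathcal M$ satisfies $\Gamma\mid\phi\Rightarrow\psi$ if a term of $\prod_{[\![\Gamma]\!]}[\![\phi]\!]\to[\![\psi]\!]$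 is derivable (in the context of $\mathcal M$). -/

import Mathlib

open CategoryTheory

/-! ## Homotopy type theory as a formal system

Raw expressions use de Bruijn indices: `var 0` is the variable bound last. -/

namespace HoTT

/-- Raw types and terms. The number of variables bound in an argument is given in the comments;
arguments without a comment bind none. -/
inductive Expr : Type
  | var (i : ℕ)
  -- types; `B` binds one variable
  | U
  | El (a : Expr)
  | Pi (A B : Expr)
  | Sg (A B : Expr)
  | Id (A a b : Expr)
  | One
  | Zero
  | Sum (A B : Expr)
  | Tr (A : Expr)
  -- codes in the universe; in `cPi` and `cSg` the argument `b` binds one variable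
  | cPi (a b : Expr)
  | cSg (a b : Expr)
  | cId (a x y : Expr)
  | cOne
  | cZero
  | cSum (a b : Expr)
  | cTr (a : Expr)
  -- functions; `b` binds one variable
  | lam (A b : Expr)
  | app (f a : Expr)
  -- pairs; `C` binds one variable, `d` two
  | pair (a b : Expr)
  | indSg (C d p : Expr)
  -- unit, empty and sum types; `C`, `l` and `r` bind one variable
  | star
  | indOne (C c t : Expr)
  | indZero (C t : Expr)
  | inl (a : Expr)
  | inr (b : Expr)
  | indSum (C l r t : Expr)
  -- identity types, with based path induction; `C` binds two variables
  | refl (a : Expr)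
  | indId (a C d b p : Expr)
  -- propositional truncation: the point `|a|`, the path between two points, the recursor
  | tr (a : Expr)
  | squash (x y : Expr)
  | trRec (B h f t : Expr)
  -- axioms; in `funext` the argument `B` binds one variable
  | funext (A B f g : Expr)
  | ua (X Y : Expr)
  | lem

namespace Expr

def liftR (r : ℕ → ℕ) : ℕ → ℕ
  | 0 => 0
  | n + 1 => r n + 1

def rename (r : ℕ → ℕ) : Expr → Expr
  | var i => var (r i)
  | U => U
  | El a => El (a.rename r)
  | Pi A B => Pi (A.rename r) (B.rename (liftR r))
  | Sg A B => Sg (A.rename r) (B.rename (liftR r))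
  | Id A a b => Id (A.rename r) (a.rename r) (b.rename r)
  | One => One
  | Zero => Zero
  | Sum A B => Sum (A.rename r) (B.rename r)
  | Tr A => Tr (A.rename r)
  | cPi a b => cPi (a.rename r) (b.rename (liftR r))
  | cSg a b => cSg (a.rename r) (b.rename (liftR r))
  | cId a x y => cId (a.rename r) (x.rename r) (y.rename r)
  | cOne => cOne
  | cZero => cZero
  | cSum a b => cSum (a.rename r) (b.rename r)
  | cTr a => cTr (a.rename r)
  | lam A b => lam (A.rename r) (b.rename (liftR r))
  | app f a => app (f.rename r) (a.rename r)
  | pair a b => pair (a.rename r) (b.rename r)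
  | indSg C d p => indSg (C.rename (liftR r)) (d.rename (liftR (liftR r))) (p.rename r)
  | star => star
  | indOne C c t => indOne (C.rename (liftR r)) (c.rename r) (t.rename r)
  | indZero C t => indZero (C.rename (liftR r)) (t.rename r)
  | inl a => inl (a.rename r)
  | inr b => inr (b.rename r)
  | indSum C l s t =>
      indSum (C.rename (liftR r)) (l.rename (liftR r)) (s.rename (liftR r)) (t.rename r)
  | refl a => refl (a.rename r)
  | indId a C d b p =>
      indId (a.rename r) (C.rename (liftR (liftR r))) (d.rename r) (b.rename r) (p.rename r)
  | tr a => tr (a.rename r)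
  | squash x y => squash (x.rename r) (y.rename r)
  | trRec B h f t => trRec (B.rename r) (h.rename r) (f.rename r) (t.rename r)
  | funext A B f g => funext (A.rename r) (B.rename (liftR r)) (f.rename r) (g.rename r)
  | ua X Y => ua (X.rename r) (Y.rename r)
  | lem => lem

/-- Weakening by `n` variables. -/
def wkN (n : ℕ) (e : Expr) : Expr := e.rename (· + n)

/-- Weakening by one variable. -/
def wk (e : Expr) : Expr := e.rename Nat.succ

def liftS (s : ℕ → Expr) : ℕ → Expr
  | 0 => var 0
  | n + 1 => (s n).wk

/-- Simultaneous substitution. -/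
def subst (s : ℕ → Expr) : Expr → Expr
  | var i => s i
  | U => U
  | El a => El (a.subst s)
  | Pi A B => Pi (A.subst s) (B.subst (liftS s))
  | Sg A B => Sg (A.subst s) (B.subst (liftS s))
  | Id A a b => Id (A.subst s) (a.subst s) (b.subst s)
  | One => One
  | Zero => Zero
  | Sum A B => Sum (A.subst s) (B.subst s)
  | Tr A => Tr (A.subst s)
  | cPi a b => cPi (a.subst s) (b.subst (liftS s))
  | cSg a b => cSg (a.subst s) (b.subst (liftS s))
  | cId a x y => cId (a.subst s) (x.subst s) (y.subst s)
  | cOne => cOne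
  | cZero => cZero
  | cSum a b => cSum (a.subst s) (b.subst s)
  | cTr a => cTr (a.subst s)
  | lam A b => lam (A.subst s) (b.subst (liftS s))
  | app f a => app (f.subst s) (a.subst s)
  | pair a b => pair (a.subst s) (b.subst s)
  | indSg C d p => indSg (C.subst (liftS s)) (d.subst (liftS (liftS s))) (p.subst s)
  | star => star
  | indOne C c t => indOne (C.subst (liftS s)) (c.subst s) (t.subst s)
  | indZero C t => indZero (C.subst (liftS s)) (t.subst s)
  | inl a => inl (a.subst s)
  | inr b => inr (b.subst s)
  | indSum C l r t =>
      indSum (C.subst (liftS s)) (l.subst (liftS s)) (r.subst (liftS s)) (t.subst s)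
  | refl a => refl (a.subst s)
  | indId a C d b p =>
      indId (a.subst s) (C.subst (liftS (liftS s))) (d.subst s) (b.subst s) (p.subst s)
  | tr a => tr (a.subst s)
  | squash x y => squash (x.subst s) (y.subst s)
  | trRec B h f t => trRec (B.subst s) (h.subst s) (f.subst s) (t.subst s)
  | funext A B f g => funext (A.subst s) (B.subst (liftS s)) (f.subst s) (g.subst s)
  | ua X Y => ua (X.subst s) (Y.subst s)
  | lem => lem

/-- For `B` over `Γ, x` and `t` over `Γ` extended by `k` variables: `B[t/x]` over the latter. -/
def plug (k : ℕ) (B t : Expr) : Expr :=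
  B.subst fun
    | 0 => t
    | n + 1 => var (n + k)

/-- `B[a/x]` for `B` over `Γ, x`. -/
def inst (B a : Expr) : Expr := B.plug 0 a

/-- `C[a/x, b/y]` for `C` over `Γ, x, y`. -/
def inst2 (C a b : Expr) : Expr :=
  C.subst fun
    | 0 => b
    | 1 => a
    | n + 2 => var n

def arrow (A B : Expr) : Expr := Pi A B.wk

def prod (A B : Expr) : Expr := Sg A B.wk

/-- First projection from `Sg A B`. -/
def fst (A p : Expr) : Expr := indSg A.wk (var 1) p

/-- Second projection from `Sg A B`. -/
def snd (A B p : Expr) : Expr := indSg (B.plug 1 (fst A.wk (var 0))) (var 0) p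

/-- `trans_p^{x.P}(t)` for `p : Id A a b` and `t : P[a/x]`. -/
def trans (P a b p t : Expr) : Expr := indId a P.wk t b p

/-- `Σ (x : A), Π (y : A), x = y`. -/
def isContr (A : Expr) : Expr := Sg A (Pi A.wk (Id A.wk.wk (var 1) (var 0)))

/-- `Π (x y : A), x = y`. -/
def isProp (A : Expr) : Expr := Pi A (Pi A.wk (Id A.wk.wk (var 1) (var 0)))

def isOfHLevel : ℕ → Expr → Expr
  | 0, A => isContr A
  | n + 1, A => Pi A (Pi A.wk (isOfHLevel n (Id A.wk.wk (var 1) (var 0))))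

/-- `(Σ (g : B → A), Π (y : B), f (g y) = y) × (Σ (g : B → A), Π (x : A), g (f x) = x)`. -/
def isEquiv (A B f : Expr) : Expr :=
  prod
    (Sg (arrow B A) (Pi B.wk (Id B.wk.wk (app f.wk.wk (app (var 1) (var 0))) (var 0))))
    (Sg (arrow B A) (Pi A.wk (Id A.wk.wk (app (var 1) (app f.wk.wk (var 0))) (var 0))))

def equiv (A B : Expr) : Expr := Sg (arrow A B) (isEquiv A.wk B.wk (var 0))

/-- The identity equivalence, of type `equiv A A`. -/
def idEquiv (A : Expr) : Expr :=
  pair (lam A (var 0))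
    (pair (pair (lam A (var 0)) (lam A (refl (var 0))))
      (pair (lam A (var 0)) (lam A (refl (var 0)))))

/-- The canonical map `Id U X Y → (El X ≃ El Y)`. -/
def idToEquiv (X Y : Expr) : Expr :=
  lam (Id U X Y)
    (indId X.wk (equiv (El X.wk.wk.wk) (El (var 1))) (idEquiv (El X.wk)) Y.wk (var 0))

/-- Univalence for `X Y : U`: the canonical map is an equivalence. -/
def uaTy (X Y : Expr) : Expr :=
  isEquiv (Id U X Y) (equiv (El X) (El Y)) (idToEquiv X Y)

/-- The canonical map `f = g → Π (x : A), f x = g x` for `f g : Pi A B`. -/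
def happly (A B f g : Expr) : Expr :=
  lam (Id (Pi A B) f g)
    (indId f.wk
      (Pi A.wk.wk.wk
        (Id (B.rename (liftR (· + 3))) (app f.wk.wk.wk.wk (var 0)) (app (var 2) (var 0))))
      (lam A.wk (refl (app f.wk.wk (var 0)))) g.wk (var 0))

/-- Function extensionality for `f g : Pi A B`: the canonical map is an equivalence. -/
def funextTy (A B f g : Expr) : Expr :=
  isEquiv (Id (Pi A B) f g) (Pi A (Id B (app f.wk (var 0)) (app g.wk (var 0))))
    (happly A B f g)

/-- The law of excluded middle: `Π (X : U), isProp X → X + (X → 0)`. -/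
def lemTy : Expr :=
  Pi U (Pi (isProp (El (var 0))) (Sum (El (var 1)) (arrow (El (var 1)) Zero)))

end Expr

open HoTT.Expr

/-- The right-hand sides of judgments: well-formed context, type, term, equal types,
equal terms. -/
inductive Jdg : Type
  | ok
  | ty (A : Expr)
  | tm (a A : Expr)
  | tyEq (A B : Expr)
  | tmEq (a b A : Expr)

def Jdg.subst (s : ℕ → Expr) : Jdg → Jdg
  | ok => ok
  | ty A => ty (A.subst s)
  | tm a A => tm (a.subst s) (A.subst s)
  | tyEq A B => tyEq (A.subst s) (B.subst s)
  | tmEq a b A => tmEq (a.subst s) (b.subst s) (A.subst s)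

open HoTT.Jdg

/-- `Der cl Γ J`: the judgment `Γ ⊢ J` is derivable in HoTT (`cl = false`) or in HoTT with the
law of excluded middle (`cl = true`). The head of the list `Γ` is the type of `var 0`.
The type theory is intensional Martin-Löf type theory with `Π` (with `η`), `Σ`, `Id`, `1`, `0`,
`+`, propositional truncation, function extensionality and a univalent universe à la Tarski that
is closed under these type formers. -/
inductive Der (cl : Bool) : List Expr → Jdg → Prop
  -- contexts, variables, substitution along context morphisms (which includes weakening)
  | ctxNil : Der cl [] ok
  | ctxCons {Γ A} : Der cl Γ (ty A) → Der cl (A :: Γ) ok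
  | var {Γ i A} : Der cl Γ ok → Γ[i]? = some A → Der cl Γ (tm (.var i) (A.wkN (i + 1)))
  | subst {Γ Δ J s} : Der cl Δ ok →
      (∀ i A, Γ[i]? = some A → Der cl Δ (tm (s i) ((A.wkN (i + 1)).subst s))) →
      Der cl Γ J → Der cl Δ (J.subst s)
  | substTyEq {Γ Δ A s s'} : Der cl Δ ok →
      (∀ i A, Γ[i]? = some A → Der cl Δ (tm (s i) ((A.wkN (i + 1)).subst s))) →
      (∀ i A, Γ[i]? = some A → Der cl Δ (tm (s' i) ((A.wkN (i + 1)).subst s'))) →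
      (∀ i A, Γ[i]? = some A → Der cl Δ (tmEq (s i) (s' i) ((A.wkN (i + 1)).subst s))) →
      Der cl Γ (ty A) → Der cl Δ (tyEq (A.subst s) (A.subst s'))
  | substTmEq {Γ Δ a A s s'} : Der cl Δ ok →
      (∀ i A, Γ[i]? = some A → Der cl Δ (tm (s i) ((A.wkN (i + 1)).subst s))) →
      (∀ i A, Γ[i]? = some A → Der cl Δ (tm (s' i) ((A.wkN (i + 1)).subst s'))) →
      (∀ i A, Γ[i]? = some A → Der cl Δ (tmEq (s i) (s' i) ((A.wkN (i + 1)).subst s))) →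
      Der cl Γ (tm a A) → Der cl Δ (tmEq (a.subst s) (a.subst s') (A.subst s))
  -- judgmental equality
  | tyRefl {Γ A} : Der cl Γ (ty A) → Der cl Γ (tyEq A A)
  | tySymm {Γ A B} : Der cl Γ (tyEq A B) → Der cl Γ (tyEq B A)
  | tyTrans {Γ A B C} : Der cl Γ (tyEq A B) → Der cl Γ (tyEq B C) → Der cl Γ (tyEq A C)
  | tmRefl {Γ a A} : Der cl Γ (tm a A) → Der cl Γ (tmEq a a A)
  | tmSymm {Γ a b A} : Der cl Γ (tmEq a b A) → Der cl Γ (tmEq b a A)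
  | tmTrans {Γ a b c A} :
      Der cl Γ (tmEq a b A) → Der cl Γ (tmEq b c A) → Der cl Γ (tmEq a c A)
  | conv {Γ a A B} : Der cl Γ (tm a A) → Der cl Γ (tyEq A B) → Der cl Γ (tm a B)
  | convEq {Γ a b A B} :
      Der cl Γ (tmEq a b A) → Der cl Γ (tyEq A B) → Der cl Γ (tmEq a b B)
  -- type formation, with congruence
  | uForm {Γ} : Der cl Γ ok → Der cl Γ (ty U)
  | elForm {Γ a} : Der cl Γ (tm a U) → Der cl Γ (ty (El a))
  | elCong {Γ a a'} : Der cl Γ (tmEq a a' U) → Der cl Γ (tyEq (El a) (El a'))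
  | piForm {Γ A B} : Der cl Γ (ty A) → Der cl (A :: Γ) (ty B) → Der cl Γ (ty (Pi A B))
  | piCong {Γ A A' B B'} : Der cl Γ (tyEq A A') → Der cl (A :: Γ) (tyEq B B') →
      Der cl Γ (tyEq (Pi A B) (Pi A' B'))
  | sgForm {Γ A B} : Der cl Γ (ty A) → Der cl (A :: Γ) (ty B) → Der cl Γ (ty (Sg A B))
  | sgCong {Γ A A' B B'} : Der cl Γ (tyEq A A') → Der cl (A :: Γ) (tyEq B B') →
      Der cl Γ (tyEq (Sg A B) (Sg A' B'))
  | idForm {Γ A a b} : Der cl Γ (ty A) → Der cl Γ (tm a A) → Der cl Γ (tm b A) →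
      Der cl Γ (ty (Id A a b))
  | idCong {Γ A A' a a' b b'} : Der cl Γ (tyEq A A') → Der cl Γ (tmEq a a' A) →
      Der cl Γ (tmEq b b' A) → Der cl Γ (tyEq (Id A a b) (Id A' a' b'))
  | oneForm {Γ} : Der cl Γ ok → Der cl Γ (ty One)
  | zeroForm {Γ} : Der cl Γ ok → Der cl Γ (ty Zero)
  | sumForm {Γ A B} : Der cl Γ (ty A) → Der cl Γ (ty B) → Der cl Γ (ty (Sum A B))
  | sumCong {Γ A A' B B'} : Der cl Γ (tyEq A A') → Der cl Γ (tyEq B B') →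
      Der cl Γ (tyEq (Sum A B) (Sum A' B'))
  | trForm {Γ A} : Der cl Γ (ty A) → Der cl Γ (ty (Tr A))
  | trCong {Γ A A'} : Der cl Γ (tyEq A A') → Der cl Γ (tyEq (Tr A) (Tr A'))
  -- codes in the universe, with congruence and decoding
  | cPi {Γ a b} : Der cl Γ (tm a U) → Der cl (El a :: Γ) (tm b U) → Der cl Γ (tm (cPi a b) U)
  | cPiCong {Γ a a' b b'} : Der cl Γ (tmEq a a' U) → Der cl (El a :: Γ) (tmEq b b' U) →
      Der cl Γ (tmEq (.cPi a b) (.cPi a' b') U)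
  | elPi {Γ a b} : Der cl Γ (tm a U) → Der cl (El a :: Γ) (tm b U) →
      Der cl Γ (tyEq (El (.cPi a b)) (Pi (El a) (El b)))
  | cSg {Γ a b} : Der cl Γ (tm a U) → Der cl (El a :: Γ) (tm b U) → Der cl Γ (tm (cSg a b) U)
  | cSgCong {Γ a a' b b'} : Der cl Γ (tmEq a a' U) → Der cl (El a :: Γ) (tmEq b b' U) →
      Der cl Γ (tmEq (.cSg a b) (.cSg a' b') U)
  | elSg {Γ a b} : Der cl Γ (tm a U) → Der cl (El a :: Γ) (tm b U) →
      Der cl Γ (tyEq (El (.cSg a b)) (Sg (El a) (El b)))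
  | cId {Γ a x y} : Der cl Γ (tm a U) → Der cl Γ (tm x (El a)) → Der cl Γ (tm y (El a)) →
      Der cl Γ (tm (cId a x y) U)
  | cIdCong {Γ a a' x x' y y'} : Der cl Γ (tmEq a a' U) → Der cl Γ (tmEq x x' (El a)) →
      Der cl Γ (tmEq y y' (El a)) → Der cl Γ (tmEq (.cId a x y) (.cId a' x' y') U)
  | elId {Γ a x y} : Der cl Γ (tm a U) → Der cl Γ (tm x (El a)) → Der cl Γ (tm y (El a)) →
      Der cl Γ (tyEq (El (.cId a x y)) (Id (El a) x y))
  | cOne {Γ} : Der cl Γ ok → Der cl Γ (tm cOne U)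
  | elOne {Γ} : Der cl Γ ok → Der cl Γ (tyEq (El .cOne) One)
  | cZero {Γ} : Der cl Γ ok → Der cl Γ (tm cZero U)
  | elZero {Γ} : Der cl Γ ok → Der cl Γ (tyEq (El .cZero) Zero)
  | cSum {Γ a b} : Der cl Γ (tm a U) → Der cl Γ (tm b U) → Der cl Γ (tm (cSum a b) U)
  | cSumCong {Γ a a' b b'} : Der cl Γ (tmEq a a' U) → Der cl Γ (tmEq b b' U) →
      Der cl Γ (tmEq (.cSum a b) (.cSum a' b') U)
  | elSum {Γ a b} : Der cl Γ (tm a U) → Der cl Γ (tm b U) →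
      Der cl Γ (tyEq (El (.cSum a b)) (Sum (El a) (El b)))
  | cTr {Γ a} : Der cl Γ (tm a U) → Der cl Γ (tm (cTr a) U)
  | cTrCong {Γ a a'} : Der cl Γ (tmEq a a' U) → Der cl Γ (tmEq (.cTr a) (.cTr a') U)
  | elTr {Γ a} : Der cl Γ (tm a U) → Der cl Γ (tyEq (El (.cTr a)) (Tr (El a)))
  -- dependent functions
  | lam {Γ A B b} : Der cl Γ (ty A) → Der cl (A :: Γ) (tm b B) → Der cl Γ (tm (lam A b) (Pi A B))
  | lamCong {Γ A A' B b b'} : Der cl Γ (tyEq A A') → Der cl (A :: Γ) (tmEq b b' B) →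
      Der cl Γ (tmEq (.lam A b) (.lam A' b') (Pi A B))
  | app {Γ A B f a} : Der cl (A :: Γ) (ty B) → Der cl Γ (tm f (Pi A B)) → Der cl Γ (tm a A) →
      Der cl Γ (tm (app f a) (B.inst a))
  | appCong {Γ A B f f' a a'} : Der cl (A :: Γ) (ty B) → Der cl Γ (tmEq f f' (Pi A B)) →
      Der cl Γ (tmEq a a' A) → Der cl Γ (tmEq (.app f a) (.app f' a') (B.inst a))
  | piBeta {Γ A B b a} : Der cl Γ (ty A) → Der cl (A :: Γ) (tm b B) → Der cl Γ (tm a A) →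
      Der cl Γ (tmEq (.app (.lam A b) a) (b.inst a) (B.inst a))
  | piEta {Γ A B f} : Der cl (A :: Γ) (ty B) → Der cl Γ (tm f (Pi A B)) →
      Der cl Γ (tmEq f (.lam A (.app f.wk (.var 0))) (Pi A B))
  -- dependent pairs
  | pair {Γ A B a b} : Der cl (A :: Γ) (ty B) → Der cl Γ (tm a A) → Der cl Γ (tm b (B.inst a)) →
      Der cl Γ (tm (pair a b) (Sg A B))
  | pairCong {Γ A B a a' b b'} : Der cl (A :: Γ) (ty B) → Der cl Γ (tmEq a a' A) →
      Der cl Γ (tmEq b b' (B.inst a)) → Der cl Γ (tmEq (.pair a b) (.pair a' b') (Sg A B))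
  | indSg {Γ A B C d p} : Der cl (Sg A B :: Γ) (ty C) →
      Der cl (B :: A :: Γ) (tm d (C.plug 2 (.pair (.var 1) (.var 0)))) →
      Der cl Γ (tm p (Sg A B)) → Der cl Γ (tm (indSg C d p) (C.inst p))
  | indSgCong {Γ A B C C' d d' p p'} : Der cl (Sg A B :: Γ) (tyEq C C') →
      Der cl (B :: A :: Γ) (tmEq d d' (C.plug 2 (.pair (.var 1) (.var 0)))) →
      Der cl Γ (tmEq p p' (Sg A B)) →
      Der cl Γ (tmEq (.indSg C d p) (.indSg C' d' p') (C.inst p))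
  | sgBeta {Γ A B C d a b} : Der cl (Sg A B :: Γ) (ty C) →
      Der cl (B :: A :: Γ) (tm d (C.plug 2 (.pair (.var 1) (.var 0)))) →
      Der cl Γ (tm a A) → Der cl Γ (tm b (B.inst a)) →
      Der cl Γ (tmEq (.indSg C d (.pair a b)) (d.inst2 a b) (C.inst (.pair a b)))
  -- the unit type and the empty type
  | star {Γ} : Der cl Γ ok → Der cl Γ (tm star One)
  | indOne {Γ C c t} : Der cl (One :: Γ) (ty C) → Der cl Γ (tm c (C.inst .star)) →
      Der cl Γ (tm t One) → Der cl Γ (tm (indOne C c t) (C.inst t))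
  | indOneCong {Γ C C' c c' t t'} : Der cl (One :: Γ) (tyEq C C') →
      Der cl Γ (tmEq c c' (C.inst .star)) → Der cl Γ (tmEq t t' One) →
      Der cl Γ (tmEq (.indOne C c t) (.indOne C' c' t') (C.inst t))
  | oneBeta {Γ C c} : Der cl (One :: Γ) (ty C) → Der cl Γ (tm c (C.inst .star)) →
      Der cl Γ (tmEq (.indOne C c .star) c (C.inst .star))
  | indZero {Γ C t} : Der cl (Zero :: Γ) (ty C) → Der cl Γ (tm t Zero) →
      Der cl Γ (tm (indZero C t) (C.inst t))
  | indZeroCong {Γ C C' t t'} : Der cl (Zero :: Γ) (tyEq C C') → Der cl Γ (tmEq t t' Zero) →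
      Der cl Γ (tmEq (.indZero C t) (.indZero C' t') (C.inst t))
  -- binary sums
  | inl {Γ A B a} : Der cl Γ (ty B) → Der cl Γ (tm a A) → Der cl Γ (tm (inl a) (Sum A B))
  | inlCong {Γ A B a a'} : Der cl Γ (ty B) → Der cl Γ (tmEq a a' A) →
      Der cl Γ (tmEq (.inl a) (.inl a') (Sum A B))
  | inr {Γ A B b} : Der cl Γ (ty A) → Der cl Γ (tm b B) → Der cl Γ (tm (inr b) (Sum A B))
  | inrCong {Γ A B b b'} : Der cl Γ (ty A) → Der cl Γ (tmEq b b' B) →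
      Der cl Γ (tmEq (.inr b) (.inr b') (Sum A B))
  | indSum {Γ A B C l r t} : Der cl (Sum A B :: Γ) (ty C) →
      Der cl (A :: Γ) (tm l (C.plug 1 (.inl (.var 0)))) →
      Der cl (B :: Γ) (tm r (C.plug 1 (.inr (.var 0)))) →
      Der cl Γ (tm t (Sum A B)) → Der cl Γ (tm (indSum C l r t) (C.inst t))
  | indSumCong {Γ A B C C' l l' r r' t t'} : Der cl (Sum A B :: Γ) (tyEq C C') →
      Der cl (A :: Γ) (tmEq l l' (C.plug 1 (.inl (.var 0)))) →
      Der cl (B :: Γ) (tmEq r r' (C.plug 1 (.inr (.var 0)))) →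
      Der cl Γ (tmEq t t' (Sum A B)) →
      Der cl Γ (tmEq (.indSum C l r t) (.indSum C' l' r' t') (C.inst t))
  | inlBeta {Γ A B C l r a} : Der cl (Sum A B :: Γ) (ty C) →
      Der cl (A :: Γ) (tm l (C.plug 1 (.inl (.var 0)))) →
      Der cl (B :: Γ) (tm r (C.plug 1 (.inr (.var 0)))) →
      Der cl Γ (tm a A) →
      Der cl Γ (tmEq (.indSum C l r (.inl a)) (l.inst a) (C.inst (.inl a)))
  | inrBeta {Γ A B C l r b} : Der cl (Sum A B :: Γ) (ty C) →
      Der cl (A :: Γ) (tm l (C.plug 1 (.inl (.var 0)))) →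
      Der cl (B :: Γ) (tm r (C.plug 1 (.inr (.var 0)))) →
      Der cl Γ (tm b B) →
      Der cl Γ (tmEq (.indSum C l r (.inr b)) (r.inst b) (C.inst (.inr b)))
  -- identity types
  | refl {Γ A a} : Der cl Γ (tm a A) → Der cl Γ (tm (refl a) (Id A a a))
  | reflCong {Γ A a a'} : Der cl Γ (tmEq a a' A) →
      Der cl Γ (tmEq (.refl a) (.refl a') (Id A a a))
  | indId {Γ A a C d b p} : Der cl Γ (tm a A) →
      Der cl (Id A.wk a.wk (.var 0) :: A :: Γ) (ty C) →
      Der cl Γ (tm d (C.inst2 a (.refl a))) → Der cl Γ (tm b A) → Der cl Γ (tm p (Id A a b)) →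
      Der cl Γ (tm (indId a C d b p) (C.inst2 b p))
  | indIdCong {Γ A a a' C C' d d' b b' p p'} : Der cl Γ (tmEq a a' A) →
      Der cl (Id A.wk a.wk (.var 0) :: A :: Γ) (tyEq C C') →
      Der cl Γ (tmEq d d' (C.inst2 a (.refl a))) → Der cl Γ (tmEq b b' A) →
      Der cl Γ (tmEq p p' (Id A a b)) →
      Der cl Γ (tmEq (.indId a C d b p) (.indId a' C' d' b' p') (C.inst2 b p))
  | idBeta {Γ A a C d} : Der cl Γ (tm a A) →
      Der cl (Id A.wk a.wk (.var 0) :: A :: Γ) (ty C) →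
      Der cl Γ (tm d (C.inst2 a (.refl a))) →
      Der cl Γ (tmEq (.indId a C d a (.refl a)) d (C.inst2 a (.refl a)))
  -- propositional truncation
  | tr {Γ A a} : Der cl Γ (tm a A) → Der cl Γ (tm (tr a) (Tr A))
  | trTmCong {Γ A a a'} : Der cl Γ (tmEq a a' A) → Der cl Γ (tmEq (.tr a) (.tr a') (Tr A))
  | squash {Γ A x y} : Der cl Γ (tm x (Tr A)) → Der cl Γ (tm y (Tr A)) →
      Der cl Γ (tm (squash x y) (Id (Tr A) x y))
  | squashCong {Γ A x x' y y'} : Der cl Γ (tmEq x x' (Tr A)) → Der cl Γ (tmEq y y' (Tr A)) →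
      Der cl Γ (tmEq (.squash x y) (.squash x' y') (Id (Tr A) x y))
  | trRec {Γ A B h f t} : Der cl Γ (ty B) → Der cl Γ (tm h (isProp B)) →
      Der cl Γ (tm f (arrow A B)) → Der cl Γ (tm t (Tr A)) → Der cl Γ (tm (trRec B h f t) B)
  | trRecCong {Γ A B B' h h' f f' t t'} : Der cl Γ (tyEq B B') →
      Der cl Γ (tmEq h h' (isProp B)) → Der cl Γ (tmEq f f' (arrow A B)) →
      Der cl Γ (tmEq t t' (Tr A)) → Der cl Γ (tmEq (.trRec B h f t) (.trRec B' h' f' t') B)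
  | trBeta {Γ A B h f a} : Der cl Γ (ty B) → Der cl Γ (tm h (isProp B)) →
      Der cl Γ (tm f (arrow A B)) → Der cl Γ (tm a A) →
      Der cl Γ (tmEq (.trRec B h f (.tr a)) (.app f a) B)
  -- function extensionality, univalence, excluded middle
  | funext {Γ A B f g} : Der cl (A :: Γ) (ty B) → Der cl Γ (tm f (Pi A B)) →
      Der cl Γ (tm g (Pi A B)) → Der cl Γ (tm (funext A B f g) (funextTy A B f g))
  | funextCong {Γ A A' B B' f f' g g'} : Der cl Γ (tyEq A A') → Der cl (A :: Γ) (tyEq B B') →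
      Der cl Γ (tmEq f f' (Pi A B)) → Der cl Γ (tmEq g g' (Pi A B)) →
      Der cl Γ (tmEq (.funext A B f g) (.funext A' B' f' g') (funextTy A B f g))
  | ua {Γ X Y} : Der cl Γ (tm X U) → Der cl Γ (tm Y U) → Der cl Γ (tm (ua X Y) (uaTy X Y))
  | uaCong {Γ X X' Y Y'} : Der cl Γ (tmEq X X' U) → Der cl Γ (tmEq Y Y' U) →
      Der cl Γ (tmEq (.ua X Y) (.ua X' Y') (uaTy X Y))
  | lem {Γ} : cl = true → Der cl Γ ok → Der cl Γ (tm lem lemTy)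

end HoTT

/-! ## Signatures -/

namespace FOLIso

/-- A non-identity arrow `K ⟶ A` of an inverse category. Inverse categories have no non-identity
endomorphisms, so these are the arrows with distinct domain and codomain. -/
structure NHom {C : Type} [SmallCategory C] (K A : C) where
  hom : K ⟶ A
  ne : A ≠ K

/-- The set `K // L` of non-identity arrows with domain `K`. -/
structure Arr {C : Type} [SmallCategory C] (K : C) where
  cod : C
  arr : NHom K cod

/-- A FOLDS signature: an inverse category with a proper order. The order on the arrows with
domain `K` is given by listing `K // L` in increasing order; finite fan-out is part of this. -/
structure Signature where
  Obj : Type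
  [cat : SmallCategory Obj]
  endo_eq_id : ∀ {K : Obj} (f : K ⟶ K), f = 𝟙 K
  skeletal : Skeletal Obj
  lt : Obj → Obj → Prop
  lt_irrefl : ∀ K, ¬ lt K K
  lt_trans : ∀ {A B K}, lt A B → lt B K → lt A K
  lt_of_arr : ∀ {K A : Obj}, NHom K A → lt A K
  arrows : (K : Obj) → List (Arr K)
  arrows_nodup : ∀ K, (arrows K).Nodup
  mem_arrows : ∀ {K} (f : Arr K), f ∈ arrows K
  arrows_ordered : ∀ K, (arrows K).Pairwise fun f g => ¬ lt g.cod f.cod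

attribute [instance] Signature.cat

variable {L : Signature}

/-- The composite `g ∘ f` of non-identity arrows. -/
def NHom.comp {K A B : L.Obj} (f : NHom K A) (g : NHom A B) : NHom K B where
  hom := f.hom ≫ g.hom
  ne := by
    rintro rfl
    exact L.lt_irrefl _ (L.lt_trans (L.lt_of_arr f) (L.lt_of_arr g))

/-- The composite `p ∘ f` as an element of `K // L`. -/
def NHom.andThen {K A : L.Obj} (f : NHom K A) (p : Arr A) : Arr K := ⟨p.cod, f.comp p.arr⟩

def NHom.toArr {K A : L.Obj} (f : NHom K A) : Arr K := ⟨A, f⟩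

/-- An arrow is top-level if it does not factor through another one. -/
def NHom.TopLevel {K A : L.Obj} (f : NHom K A) : Prop :=
  ∀ (B : L.Obj) (g : NHom K B) (k : NHom B A), f ≠ g.comp k

/-- The number of objects below `K`; it decreases along non-identity arrows. -/
noncomputable def Signature.rank (L : Signature) (K : L.Obj) : ℕ :=
  Set.ncard {A : L.Obj | Nonempty (NHom K A)}

theorem Signature.rank_lt (L : Signature) {K A : L.Obj} (f : NHom K A) : L.rank A < L.rank K := by
  refine Set.ncard_lt_ncard ⟨?_, ?_⟩ ?_
  · rintro B ⟨g⟩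
    exact ⟨f.comp g⟩
  · intro h
    obtain ⟨g⟩ := h (show A ∈ {A : L.Obj | Nonempty (NHom K A)} from ⟨f⟩)
    exact g.ne rfl
  · refine (List.finite_toSet ((L.arrows K).map Arr.cod)).subset ?_
    rintro B ⟨g⟩
    exact List.mem_map.2 ⟨⟨B, g⟩, L.mem_arrows _, rfl⟩

/-- The kind of the sort `E`: a non-logical sort, the isomorphism sort `≅_K` with its arrows
`s`, `t`, the reflexivity sort `ρ_K` with its arrow `r` to `I = ≅_K`, or the transport sort `τ_f`
for `f : A ⟶ K` with its arrows `e` to `I = ≅_K` and `f₁`, `f₂` to `A`. -/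
inductive Kind {C : Type} [SmallCategory C] (E : C) : Type
  | nonlogical
  | iso (K : C) (s t : NHom E K)
  | refl (K I : C) (s t : NHom I K) (r : NHom E I)
  | transp (A K I : C) (f : NHom A K) (s t : NHom I K) (e : NHom E I) (f₁ f₂ : NHom E A)

/-- An essentially finite `h`-signature. The field `sorts` lists the non-logical sorts in
increasing order. Subtraction on `ℕ∞` satisfies `⊤ - m = ⊤`. -/
structure HSignature extends Signature where
  kind : (E : Obj) → Kind E
  h : Obj → ℕ∞
  iso_spec : ∀ {E K : Obj} {s t : NHom E K}, kind E = .iso K s t →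
    2 ≤ h K ∧ s ≠ t ∧
    (∀ {B : Obj} (g : NHom E B),
      NHom.TopLevel (L := toSignature) g ↔
        (⟨B, g⟩ : Arr E) = ⟨K, s⟩ ∨ (⟨B, g⟩ : Arr E) = ⟨K, t⟩) ∧
    (∀ {B : Obj} (g : NHom K B), s.hom ≫ g.hom = t.hom ≫ g.hom) ∧
    h E = h K - 1
  refl_spec : ∀ {E K I : Obj} {s t : NHom I K} {r : NHom E I}, kind E = .refl K I s t r →
    kind I = .iso K s t ∧ 2 ≤ h K ∧
    (∀ {B : Obj} (g : NHom E B),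
      NHom.TopLevel (L := toSignature) g ↔ (⟨B, g⟩ : Arr E) = ⟨I, r⟩) ∧
    r.hom ≫ s.hom = r.hom ≫ t.hom ∧
    h E = h K - 2
  transp_spec : ∀ {E A K I : Obj} {f : NHom A K} {s t : NHom I K} {e : NHom E I}
    {f₁ f₂ : NHom E A}, kind E = .transp A K I f s t e f₁ f₂ →
    kind I = .iso K s t ∧ NHom.TopLevel (L := toSignature) f ∧
    f₁ ≠ f₂ ∧ (⟨I, e⟩ : Arr E) ≠ ⟨A, f₁⟩ ∧ (⟨I, e⟩ : Arr E) ≠ ⟨A, f₂⟩ ∧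
    (∀ {B : Obj} (g : NHom E B),
      NHom.TopLevel (L := toSignature) g ↔
        (⟨B, g⟩ : Arr E) = ⟨I, e⟩ ∨ (⟨B, g⟩ : Arr E) = ⟨A, f₁⟩ ∨ (⟨B, g⟩ : Arr E) = ⟨A, f₂⟩) ∧
    e.hom ≫ s.hom = f₁.hom ≫ f.hom ∧ e.hom ≫ t.hom = f₂.hom ≫ f.hom ∧
    (∀ {B : Obj} (g : NHom A B), (⟨B, g⟩ : Arr A) ≠ ⟨K, f⟩ →
      f₁.hom ≫ g.hom = f₂.hom ≫ g.hom) ∧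
    h E = h A - 1
  -- each logical symbol occurs at most once
  iso_unique : ∀ {E E' K : Obj} {s t : NHom E K} {s' t' : NHom E' K},
    kind E = .iso K s t → kind E' = .iso K s' t' → E = E'
  refl_unique : ∀ {E E' K I : Obj} {s t : NHom I K} {r : NHom E I} {r' : NHom E' I},
    kind E = .refl K I s t r → kind E' = .refl K I s t r' → E = E'
  transp_unique : ∀ {E E' A K I : Obj} {f : NHom A K} {s t : NHom I K} {e : NHom E I}
    {f₁ f₂ : NHom E A} {e' : NHom E' I} {f₁' f₂' : NHom E' A},
    kind E = .transp A K I f s t e f₁ f₂ → kind E' = .transp A K I f s t e' f₁' f₂' → E = E'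
  -- sorts of `h`-level `0` are logical (by `iso_spec`, not isomorphism sorts)
  h_ne_zero_of_nonlogical : ∀ {E : Obj}, kind E = .nonlogical → h E ≠ 0
  sorts : List Obj
  sorts_nodup : sorts.Nodup
  mem_sorts : ∀ {K}, K ∈ sorts ↔ kind K = .nonlogical
  sorts_ordered : sorts.Pairwise fun A B => ¬ lt B A

/-! ## Syntax -/

/-- A raw sort `A(x_f)_{f ∈ A // L}`; variables are de Bruijn indices. -/
structure SortExpr (L : Signature) where
  head : L.Obj
  args : Arr head → ℕ

def SortExpr.rename (r : ℕ → ℕ) (K : SortExpr L) : SortExpr L := ⟨K.head, fun f => r (K.args f)⟩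

/-- The sort `K_f(x_{pf})_p` that the variable at position `f` of `K(x_f)_f` has to have. -/
def SortExpr.face (K : SortExpr L) (f : Arr K.head) : SortExpr L :=
  ⟨f.cod, fun p => K.args (f.arr.andThen p)⟩

inductive Form (L : Signature) : Type
  | bot
  | top
  | and (φ ψ : Form L)
  | or (φ ψ : Form L)
  | imp (φ ψ : Form L)
  | all (K : SortExpr L) (φ : Form L)
  | ex (K : SortExpr L) (φ : Form L)

namespace Form

/-- Substitution of variables for variables. -/
def rename : (ℕ → ℕ) → Form L → Form L
  | _, bot => bot
  | _, top => top
  | r, and φ ψ => and (φ.rename r) (ψ.rename r)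
  | r, or φ ψ => or (φ.rename r) (ψ.rename r)
  | r, imp φ ψ => imp (φ.rename r) (ψ.rename r)
  | r, all K φ => all (K.rename r) (φ.rename (HoTT.Expr.liftR r))
  | r, ex K φ => ex (K.rename r) (φ.rename (HoTT.Expr.liftR r))

def wk (φ : Form L) : Form L := φ.rename Nat.succ

/-- A sort `K`, read as the formula `∃ x : K. ⊤`. -/
def ofSort (K : SortExpr L) : Form L := ex K top

end Form

/-- Raw contexts; the head of the list is the sort of the variable `0`. -/
abbrev Ctx (L : Signature) := List (SortExpr L)

/-- `Γ ⊢ x : K`. -/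
def HasSort (Γ : Ctx L) (x : ℕ) (K : SortExpr L) : Prop :=
  ∃ K₀, Γ[x]? = some K₀ ∧ K = K₀.rename (· + (x + 1))

/-- `Γ ⊢ K Sort`, for a well-formed context `Γ`. -/
def SortWF (Γ : Ctx L) (K : SortExpr L) : Prop :=
  ∀ f : Arr K.head, HasSort Γ (K.args f) (K.face f)

/-- `Γ ok`. -/
def CtxWF : Ctx L → Prop
  | [] => True
  | K :: Γ => CtxWF Γ ∧ SortWF Γ K

/-- `Γ ⊢ φ formula`, for a well-formed context `Γ`. -/
def FormWF : Ctx L → Form L → Prop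
  | _, .bot => True
  | _, .top => True
  | Γ, .and φ ψ => FormWF Γ φ ∧ FormWF Γ ψ
  | Γ, .or φ ψ => FormWF Γ φ ∧ FormWF Γ ψ
  | Γ, .imp φ ψ => FormWF Γ φ ∧ FormWF Γ ψ
  | Γ, .all K φ => SortWF Γ K ∧ FormWF (K :: Γ) φ
  | Γ, .ex K φ => SortWF Γ K ∧ FormWF (K :: Γ) φ

/-- The variables `r 0, r 1, …` form a context morphism `Γ ⇒ Δ`. -/
def CtxMor (Γ Δ : Ctx L) (r : ℕ → ℕ) : Prop :=
  ∀ x K, HasSort Δ x K → HasSort Γ (r x) (K.rename r)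

/-- A raw sequent `Γ | φ ⇒ ψ`. -/
structure Sequent (L : Signature) where
  ctx : Ctx L
  hyp : Form L
  concl : Form L

def Sequent.WF (σ : Sequent L) : Prop :=
  CtxWF σ.ctx ∧ FormWF σ.ctx σ.hyp ∧ FormWF σ.ctx σ.concl

/-- A theory: a set of (well-formed) sequents. -/
structure Theory (L : Signature) where
  axioms : Set (Sequent L)
  wf : ∀ σ ∈ axioms, σ.WF

/-! ## The deductive system -/

/-- `r` acting below `n` bound variables. -/
def liftN (r : ℕ → ℕ) : ℕ → ℕ → ℕ
  | 0 => r
  | n + 1 => HoTT.Expr.liftR (liftN r n)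

/-- Substitution in a telescope. -/
def renameTele (r : ℕ → ℕ) : Ctx L → Ctx L
  | [] => []
  | K :: Γ => K.rename (liftN r Γ.length) :: renameTele r Γ

/-- The transposition of the variables `0` and `1`. -/
def swap01 : ℕ → ℕ
  | 0 => 1
  | 1 => 0
  | n + 2 => n + 2

/-- The map identifying the variables `0` and `1`. -/
def contract01 : ℕ → ℕ
  | 0 => 0
  | n + 1 => n

/-- `Entails L cl T σ`: the sequent `σ` is derivable from `T` in the deductive system of
first-order logic with isomorphism, intuitionistically (`cl = false`) or with excluded middle
(`cl = true`). All sequents that occur are well-formed; in `rho`, `tauRho` and `J` this determines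
the arguments of the logical sorts which are not displayed. -/
inductive Entails (L : HSignature) (cl : Bool) (T : Theory L.toSignature) :
    Sequent L.toSignature → Prop
  | ax {σ} : σ ∈ T.axioms → Entails L cl T σ
  -- structural rules
  | iden {Γ φ} : (Sequent.mk Γ φ φ).WF → Entails L cl T ⟨Γ, φ, φ⟩
  | sub {Γ Δ φ ψ r} : CtxWF Γ → CtxMor Γ Δ r → Entails L cl T ⟨Δ, φ, ψ⟩ →
      Entails L cl T ⟨Γ, φ.rename r, ψ.rename r⟩
  | cut {Γ φ ψ χ} : Entails L cl T ⟨Γ, φ, ψ⟩ → Entails L cl T ⟨Γ, ψ, χ⟩ →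
      Entails L cl T ⟨Γ, φ, χ⟩
  | conWk {Γ K φ ψ} : SortWF Γ K → Entails L cl T ⟨Γ, φ, ψ⟩ →
      Entails L cl T ⟨K :: Γ, φ.wk, ψ.wk⟩
  | conExch {Γ Γ' K K' φ ψ} : SortWF Γ K → SortWF Γ K' →
      Entails L cl T ⟨Γ' ++ K'.rename Nat.succ :: K :: Γ, φ, ψ⟩ →
      Entails L cl T ⟨renameTele swap01 Γ' ++ K.rename Nat.succ :: K' :: Γ,
        φ.rename (liftN swap01 Γ'.length), ψ.rename (liftN swap01 Γ'.length)⟩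
  -- logical rules
  | top {Γ φ} : (Sequent.mk Γ φ .top).WF → Entails L cl T ⟨Γ, φ, .top⟩
  | bot {Γ φ} : (Sequent.mk Γ .bot φ).WF → Entails L cl T ⟨Γ, .bot, φ⟩
  | exTop {Γ K φ} : (Sequent.mk Γ (.ex K φ) (.ex K .top)).WF →
      Entails L cl T ⟨Γ, .ex K φ, .ex K .top⟩
  | andIntro {Γ θ φ ψ} : Entails L cl T ⟨Γ, θ, φ⟩ → Entails L cl T ⟨Γ, θ, ψ⟩ →
      Entails L cl T ⟨Γ, θ, .and φ ψ⟩
  | andLeft {Γ θ φ ψ} : Entails L cl T ⟨Γ, θ, .and φ ψ⟩ → Entails L cl T ⟨Γ, θ, φ⟩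
  | andRight {Γ θ φ ψ} : Entails L cl T ⟨Γ, θ, .and φ ψ⟩ → Entails L cl T ⟨Γ, θ, ψ⟩
  | orElim {Γ θ φ ψ} : Entails L cl T ⟨Γ, φ, θ⟩ → Entails L cl T ⟨Γ, ψ, θ⟩ →
      Entails L cl T ⟨Γ, .or φ ψ, θ⟩
  | orLeft {Γ θ φ ψ} : Entails L cl T ⟨Γ, .or φ ψ, θ⟩ → Entails L cl T ⟨Γ, φ, θ⟩
  | orRight {Γ θ φ ψ} : Entails L cl T ⟨Γ, .or φ ψ, θ⟩ → Entails L cl T ⟨Γ, ψ, θ⟩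
  | impIntro {Γ θ φ ψ} : Entails L cl T ⟨Γ, .and θ φ, ψ⟩ → Entails L cl T ⟨Γ, θ, .imp φ ψ⟩
  | impElim {Γ θ φ ψ} : Entails L cl T ⟨Γ, θ, .imp φ ψ⟩ → Entails L cl T ⟨Γ, .and θ φ, ψ⟩
  | allIntro {Γ K θ φ} : FormWF Γ θ → Entails L cl T ⟨K :: Γ, θ.wk, φ⟩ →
      Entails L cl T ⟨Γ, θ, .all K φ⟩
  | allElim {Γ K θ φ} : Entails L cl T ⟨Γ, θ, .all K φ⟩ → Entails L cl T ⟨K :: Γ, θ.wk, φ⟩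
  | exElim {Γ K θ φ} : FormWF Γ θ → Entails L cl T ⟨K :: Γ, φ, θ.wk⟩ →
      Entails L cl T ⟨Γ, .ex K φ, θ⟩
  | exIntro {Γ K θ φ} : Entails L cl T ⟨Γ, .ex K φ, θ⟩ → Entails L cl T ⟨K :: Γ, φ, θ.wk⟩
  | frob {Γ K φ ψ} : (Sequent.mk Γ (.and φ (.ex K ψ)) (.ex K (.and φ.wk ψ))).WF →
      Entails L cl T ⟨Γ, .and φ (.ex K ψ), .ex K (.and φ.wk ψ)⟩
  | dist {Γ φ ψ χ} : (Sequent.mk Γ (.and φ (.or ψ χ)) (.or (.and φ ψ) (.and φ χ))).WF →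
      Entails L cl T ⟨Γ, .and φ (.or ψ χ), .or (.and φ ψ) (.and φ χ)⟩
  | lem {Γ φ} : cl = true → (Sequent.mk Γ .top (.or φ (.imp φ .bot))).WF →
      Entails L cl T ⟨Γ, .top, .or φ (.imp φ .bot)⟩
  /- `Γ, x : K | θ ⇒ ∃ q : x ≅ x. ρ(q)` -/
  | rho {Γ K θ A I R} {s t : NHom I A} {r : NHom R I} {q : Arr I → ℕ} {w : Arr R → ℕ} :
      L.kind I = .iso A s t → L.kind R = .refl A I s t r →
      q s.toArr = 0 → q t.toArr = 0 → w r.toArr = 0 →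
      (Sequent.mk (K :: Γ) θ (.ex ⟨I, q⟩ (.ofSort ⟨R, w⟩))).WF →
      Entails L cl T ⟨K :: Γ, θ, .ex ⟨I, q⟩ (.ofSort ⟨R, w⟩)⟩
  /- `Γ, x : K, α : A, q : x ≅ x | ρ(q) ∧ θ ⇒ τ_f(q, α, α)` -/
  | tauRho {Γ K A' θ A B I R E} {f : NHom B A} {s t : NHom I A} {r : NHom R I}
      {e : NHom E I} {f₁ f₂ : NHom E B} {q : Arr I → ℕ} {w : Arr R → ℕ} {u : Arr E → ℕ} :
      L.kind R = .refl A I s t r → L.kind E = .transp B A I f s t e f₁ f₂ →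
      q s.toArr = 1 → q t.toArr = 1 → w r.toArr = 0 →
      u e.toArr = 0 → u f₁.toArr = 1 → u f₂.toArr = 1 →
      (Sequent.mk (⟨I, q⟩ :: A' :: K :: Γ) (.and (.ofSort ⟨R, w⟩) θ) (.ofSort ⟨E, u⟩)).WF →
      Entails L cl T ⟨⟨I, q⟩ :: A' :: K :: Γ, .and (.ofSort ⟨R, w⟩) θ, .ofSort ⟨E, u⟩⟩
  /- from `Γ, x : K, q : x ≅ x | ρ(q) ∧ θ[x, x, q] ⇒ φ[x, x, q]` infer
  `Γ, x : K, y : K, p : x ≅ y | θ ⇒ φ` -/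
  | J {Γ K θ φ A I R} {s t : NHom I A} {r : NHom R I} {p : Arr I → ℕ} {w : Arr R → ℕ} :
      L.kind I = .iso A s t → L.kind R = .refl A I s t r →
      p s.toArr = 1 → p t.toArr = 0 → w r.toArr = 0 →
      (Sequent.mk (⟨I, p⟩ :: K.rename Nat.succ :: K :: Γ) θ φ).WF →
      Entails L cl T ⟨⟨I, fun g => contract01 (p g)⟩ :: K :: Γ,
        .and (.ofSort ⟨R, w⟩) (θ.rename (HoTT.Expr.liftR contract01)),
        φ.rename (HoTT.Expr.liftR contract01)⟩ →
      Entails L cl T ⟨⟨I, p⟩ :: K.rename Nat.succ :: K :: Γ, θ, φ⟩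

/-! ## Homotopy semantics -/

open HoTT HoTT.Expr

/-- The type `U_m` of types of `h`-level `m` in `U`, with `U_∞ = U`. -/
noncomputable def typesOfHLevel (m : ℕ∞) : Expr :=
  open Classical in if m = ⊤ then U else Sg U (isOfHLevel m.toNat (El (var 0)))

/-- The type underlying a term of `U_m`. -/
noncomputable def underlying (m : ℕ∞) (c : Expr) : Expr :=
  open Classical in if m = ⊤ then El c else El (fst U c)

/-- `app[c(p₁, …, pₙ)]`; a function of no arguments is applied to the point of `1`. -/
def apps (c : Expr) : List Expr → Expr
  | [] => app c star
  | p :: ps => ps.foldl app (app c p)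

/-- The value `t` at `i`, the values of `a` elsewhere. -/
noncomputable def setAt {ι : Type} (a : ι → Expr) (i : ι) (t : Expr) : ι → Expr :=
  open Classical in fun j => if j = i then t else a j

namespace HSignature

variable (L : HSignature)

/-- The type interpreting the sort `K` with the term `a f` at position `f`, where non-logical
sorts `A` are interpreted by the terms `N A`. -/
noncomputable def interpSort (N : L.Obj → Expr) (K : L.Obj) (a : Arr K → Expr) : Expr :=
  match L.kind K with
  | .nonlogical => underlying (L.h K) (apps (N K) ((L.arrows K).map a))
  | .iso A s t =>
      Id (interpSort N A fun p => a (NHom.andThen (L := L.toSignature) s p))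
        (a (NHom.toArr (L := L.toSignature) s)) (a (NHom.toArr (L := L.toSignature) t))
  | .refl A I s t r =>
      let r' := NHom.andThen (L := L.toSignature) r
      let x := a (r' ⟨A, s⟩)
      Id (Id (interpSort N A fun p => a (r' (NHom.andThen (L := L.toSignature) s p)))
          x (a (r' ⟨A, t⟩)))
        (a (NHom.toArr (L := L.toSignature) r)) (.refl x)
  | .transp A B _ f _ _ e f₁ f₂ =>
      let x₁ := NHom.andThen (L := L.toSignature) f₁
      let x₂ := NHom.andThen (L := L.toSignature) f₂
      let P := interpSort (fun C => (N C).wk) A (setAt (fun p => (a (x₁ p)).wk) ⟨B, f⟩ (var 0))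
      Id (interpSort N A fun p => a (x₂ p))
        (a (NHom.toArr (L := L.toSignature) f₂))
        (trans P (a (x₁ ⟨B, f⟩)) (a (x₂ ⟨B, f⟩)) (a (NHom.toArr (L := L.toSignature) e))
          (a (NHom.toArr (L := L.toSignature) f₁)))
termination_by L.rank K
decreasing_by
  · exact L.rank_lt s
  · exact (L.rank_lt s).trans (L.rank_lt r)
  · exact L.rank_lt f₁
  · exact L.rank_lt f₁

/-- `Π (f : K̂_f)_f. U_{h(K)}`, where `f` runs over the given list of arrows and `a` assigns terms
to the arrows already bound. -/
noncomputable def sortTyAux (K : L.Obj) :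
    (L.Obj → Expr) → (Arr K → Expr) → List (Arr K) → Expr
  | _, _, [] => typesOfHLevel (L.h K)
  | N, a, f :: fs =>
      Pi (L.interpSort N f.cod fun p => a (NHom.andThen (L := L.toSignature) f.arr p))
        (sortTyAux K (fun C => (N C).wk) (setAt (fun g => (a g).wk) f (var 0)) fs)

/-- The type `T_K` of interpretations of a non-logical sort `K`, given interpretations `N` of the
smaller ones. -/
noncomputable def sortTy (N : L.Obj → Expr) (K : L.Obj) : Expr :=
  match L.arrows K with
  | [] => arrow One (typesOfHLevel (L.h K))
  | f :: fs => L.sortTyAux K N (fun _ => star) (f :: fs)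

/-- `Σ (K : T_K)` over the given list of non-logical sorts. -/
noncomputable def strucTyAux : (L.Obj → Expr) → List L.Obj → Expr
  | _, [] => One
  | N, [K] => L.sortTy N K
  | N, K :: K' :: Ks =>
      Sg (L.sortTy N K) (strucTyAux (setAt (fun A => (N A).wk) K (var 0)) (K' :: Ks))

/-- The closed type of homotopy `L`-structures. -/
noncomputable def strucTy : Expr := L.strucTyAux (fun _ => star) L.sorts

/-- The projections of a term `M` of `strucTyAux N Ks`, added to `N`. -/
noncomputable def projAux : (L.Obj → Expr) → List L.Obj → Expr → L.Obj → Expr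
  | N, [], _ => N
  | N, [K], M => setAt N K M
  | N, K :: K' :: Ks, M =>
      projAux (setAt N K (fst (L.sortTy N K) M)) (K' :: Ks)
        (snd (L.sortTy N K) (L.strucTyAux (setAt (fun A => (N A).wk) K (var 0)) (K' :: Ks)) M)

/-- `K^M`, for `K` non-logical. -/
noncomputable def proj (M : Expr) : L.Obj → Expr := L.projAux (fun _ => star) L.sorts M

/-- The type interpreting a formula; `v` assigns terms to its variables. -/
noncomputable def interpForm : (L.Obj → Expr) → (ℕ → Expr) → Form L.toSignature → Expr
  | _, _, .bot => Zero
  | _, _, .top => One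
  | N, v, .and φ ψ => prod (interpForm N v φ) (interpForm N v ψ)
  | N, v, .or φ ψ => Tr (Sum (interpForm N v φ) (interpForm N v ψ))
  | N, v, .imp φ ψ => arrow (interpForm N v φ) (interpForm N v ψ)
  | N, v, .all K φ =>
      Pi (L.interpSort N K.head fun f => v (K.args f)) (interpForm (fun A => (N A).wk) (liftS v) φ)
  | N, v, .ex K φ =>
      Tr (Sg (L.interpSort N K.head fun f => v (K.args f))
        (interpForm (fun A => (N A).wk) (liftS v) φ))

/-- `Π (Γ^M) B`. -/
noncomputable def piCtx (M : Expr) : Ctx L.toSignature → Expr → Expr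
  | [], B => B
  | K :: Γ, B =>
      piCtx M Γ (Pi (L.interpSort (fun A => (L.proj M A).wkN Γ.length) K.head
        fun f => var (K.args f)) B)

/-- `(Γ | φ ⇒ ψ)^M = Π (Γ^M) (φ^M → ψ^M)`. -/
noncomputable def interpSequent (M : Expr) (σ : Sequent L.toSignature) : Expr :=
  let N := fun A => (L.proj M A).wkN σ.ctx.length
  L.piCtx M σ.ctx (arrow (L.interpForm N var σ.hyp) (L.interpForm N var σ.concl))

/-- `M` is a homotopy `L`-structure, in the context `Γ₀` of HoTT or of HoTT with excluded middle. -/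
def IsStructure (cl : Bool) (Γ₀ : List Expr) (M : Expr) : Prop :=
  Der cl Γ₀ (.tm M L.strucTy)

/-- `M ⊨ σ`: the type `σ^M` is inhabited. -/
def Satisfies (cl : Bool) (Γ₀ : List Expr) (M : Expr) (σ : Sequent L.toSignature) : Prop :=
  ∃ t, Der cl Γ₀ (.tm t (L.interpSequent M σ))

/-- `T ⊨ σ`: every homotopy structure that satisfies the sequents of `T` satisfies `σ`. Structures
may be given by closed terms (`Γ₀ = []`) or by terms in a context. -/
def SemConsequence (cl : Bool) (T : Theory L.toSignature) (σ : Sequent L.toSignature) : Prop :=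
  ∀ (Γ₀ : List Expr) (M : Expr), L.IsStructure cl Γ₀ M →
    (∀ σ' ∈ T.axioms, L.Satisfies cl Γ₀ M σ') → L.Satisfies cl Γ₀ M σ

end HSignature

end FOLIso

/-!
To verify that a rule preserves satisfaction it suffices to keep track of which types are inhabited,
not of the terms that inhabit them. A sequent is satisfied by `M` if and only if it is *forced*: in
every context over that of `M` and for every well-typed valuation of the variables, inhabitation of
the hypothesis gives inhabitation of the conclusion. Since an arbitrary extension of the context
adds generic elements of any type, the logical rules become the usual clauses of Kripke semantics.
Formulas are interpreted by small propositions, so truncations may be eliminated into them and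
excluded middle applies to them. The rules for `ρ`, `τ` and `J` are reflexivity, transport along
`refl`, and path induction; the equations between composites of arrows in a signature say precisely
that the types involved agree, here as syntactic expressions.
-/

/-! ### Substitutions -/

namespace HoTT.Expr

/-- The substitution `t, s 0, s 1, …`. -/
def scons (t : Expr) (s : ℕ → Expr) : ℕ → Expr
  | 0 => t
  | n + 1 => s n

/-- The weakening substitution. -/
def shift : ℕ → Expr := fun i => var (i + 1)

/-- Composition of substitutions, `s` first. -/
def comp (s t : ℕ → Expr) : ℕ → Expr := fun i => (s i).subst t

theorem liftS_var_comp (r : ℕ → ℕ) : liftS (fun i => var (r i)) = fun i => var (liftR r i) := by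
  funext i
  cases i <;> rfl

theorem rename_eq_subst (e : Expr) (r : ℕ → ℕ) : e.rename r = e.subst fun i => var (r i) := by
  induction e generalizing r <;> simp [rename, subst, liftS_var_comp, *]

theorem liftR_comp (r r' : ℕ → ℕ) : (fun i => liftR r' (liftR r i)) = liftR fun i => r' (r i) := by
  funext i
  cases i <;> rfl

theorem rename_rename (e : Expr) (r r' : ℕ → ℕ) :
    (e.rename r).rename r' = e.rename fun i => r' (r i) := by
  induction e generalizing r r' <;> simp [rename, liftR_comp, *]

theorem liftS_liftR (r : ℕ → ℕ) (s : ℕ → Expr) :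
    (fun i => liftS s (liftR r i)) = liftS fun i => s (r i) := by
  funext i
  cases i <;> rfl

theorem subst_rename_left (e : Expr) (r : ℕ → ℕ) (s : ℕ → Expr) :
    (e.rename r).subst s = e.subst fun i => s (r i) := by
  induction e generalizing r s <;> simp [rename, subst, liftS_liftR, *]

theorem liftS_rename (s : ℕ → Expr) (r : ℕ → ℕ) :
    (fun i => (liftS s i).rename (liftR r)) = liftS fun i => (s i).rename r := by
  funext i
  cases i with
  | zero => rfl
  | succ n => simp [liftS, wk, rename_rename, liftR]

theorem rename_subst (e : Expr) (s : ℕ → Expr) (r : ℕ → ℕ) :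
    (e.subst s).rename r = e.subst fun i => (s i).rename r := by
  induction e generalizing r s <;> simp [rename, subst, liftS_rename, *]

theorem liftS_liftS (s t : ℕ → Expr) :
    (fun i => (liftS s i).subst (liftS t)) = liftS fun i => (s i).subst t := by
  funext i
  cases i with
  | zero => rfl
  | succ n => simp [liftS, wk, subst_rename_left, rename_subst]

@[simp]
theorem subst_subst (e : Expr) (s t : ℕ → Expr) : (e.subst s).subst t = e.subst (comp s t) := by
  unfold comp
  induction e generalizing s t <;> simp [subst, liftS_liftS, *]

@[simp]
theorem liftS_eq (s : ℕ → Expr) : liftS s = scons (var 0) (comp s shift) := by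
  funext i
  cases i with
  | zero => rfl
  | succ n => exact rename_eq_subst _ _

theorem liftS_var : liftS var = var := by
  funext i
  cases i <;> rfl

@[simp]
theorem subst_var (e : Expr) : e.subst var = e := by
  induction e <;> simp only [subst, liftS_var, *]

@[simp]
theorem wk_eq (e : Expr) : e.wk = e.subst shift := rename_eq_subst _ _

@[simp]
theorem comp_var_left (s : ℕ → Expr) : comp var s = s := rfl

@[simp]
theorem comp_var_right (s : ℕ → Expr) : comp s var = s := by
  funext i
  simp [comp]

@[simp]
theorem comp_assoc (s t u : ℕ → Expr) : comp (comp s t) u = comp s (comp t u) := by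
  funext i
  simp [comp]

@[simp]
theorem comp_shift_scons (t : Expr) (s : ℕ → Expr) : comp shift (scons t s) = s := rfl

@[simp]
theorem comp_scons (t : Expr) (s u : ℕ → Expr) :
    comp (scons t s) u = scons (t.subst u) (comp s u) := by
  funext i
  cases i <;> rfl

@[simp]
theorem scons_var_shift : scons (var 0) shift = var := by
  funext i
  cases i <;> rfl

@[simp]
theorem scons_var_one_shift : scons (var 1) (comp shift shift) = shift := by
  funext i
  cases i <;> rfl

@[simp]
theorem scons_eta (s : ℕ → Expr) : scons (s 0) (comp shift s) = s := by
  funext i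
  cases i <;> rfl

@[simp]
theorem scons_zero (t : Expr) (s : ℕ → Expr) : scons t s 0 = t := rfl

@[simp]
theorem scons_succ (t : Expr) (s : ℕ → Expr) (n : ℕ) : scons t s (n + 1) = s n := rfl

@[simp]
theorem shift_apply (i : ℕ) : shift i = var (i + 1) := rfl

@[simp]
theorem comp_apply (s t : ℕ → Expr) (i : ℕ) : comp s t i = (s i).subst t := rfl

@[simp]
theorem inst_eq (B a : Expr) : B.inst a = B.subst (scons a var) := by
  unfold inst plug
  congr 1

@[simp]
theorem plug_one_eq (B t : Expr) : B.plug 1 t = B.subst (scons t shift) := by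
  unfold plug
  congr 1

@[simp]
theorem plug_two_eq (B t : Expr) : B.plug 2 t = B.subst (scons t (comp shift shift)) := by
  unfold plug
  congr 1

@[simp]
theorem inst2_eq (C a b : Expr) : C.inst2 a b = C.subst (scons b (scons a var)) := by
  unfold inst2
  congr 1
  funext i
  rcases i with _ | _ | i <;> rfl

theorem wkN_eq_subst (n : ℕ) (e : Expr) : e.wkN n = e.subst fun i => var (i + n) :=
  rename_eq_subst _ _

theorem wkN_succ (n : ℕ) (e : Expr) : e.wkN (n + 1) = (e.wkN n).subst shift := by
  simp only [wkN_eq_subst, subst_subst]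
  rfl

theorem wkN_zero (e : Expr) : e.wkN 0 = e := (wkN_eq_subst 0 e).trans (subst_var e)

theorem wkN_one (e : Expr) : e.wkN 1 = e.subst shift := by
  simp [wkN_succ, wkN_zero]

theorem wkN_add_one_scons (n : ℕ) (e t : Expr) (s : ℕ → Expr) :
    (e.wkN (n + 1)).subst (scons t s) = (e.wkN n).subst s := by
  simp [wkN_succ]

theorem rename_liftR_add_three (e : Expr) :
    e.rename (liftR (· + 3)) =
      e.subst (scons (var 0) (comp shift (comp shift (comp shift shift)))) := by
  rw [rename_eq_subst]
  congr 1
  funext i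
  cases i <;> rfl

attribute [simp] subst

@[simp]
theorem subst_arrow (A B : Expr) (s : ℕ → Expr) :
    (arrow A B).subst s = arrow (A.subst s) (B.subst s) := by
  simp [arrow]

@[simp]
theorem subst_prod (A B : Expr) (s : ℕ → Expr) :
    (prod A B).subst s = prod (A.subst s) (B.subst s) := by
  simp [prod]

@[simp]
theorem subst_fst (A p : Expr) (s : ℕ → Expr) :
    (fst A p).subst s = fst (A.subst s) (p.subst s) := by
  simp [fst]

@[simp]
theorem subst_trans (P a b p t : Expr) (s : ℕ → Expr) :
    (trans P a b p t).subst s =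
      trans (P.subst (scons (var 0) (comp s shift))) (a.subst s) (b.subst s) (p.subst s)
        (t.subst s) := by
  simp [trans]

@[simp]
theorem subst_isProp (A : Expr) (s : ℕ → Expr) :
    (isProp A).subst s = isProp (A.subst s) := by
  simp [isProp]

@[simp]
theorem subst_isOfHLevel (n : ℕ) (A : Expr) (s : ℕ → Expr) :
    (isOfHLevel n A).subst s = isOfHLevel n (A.subst s) := by
  induction n generalizing A s with
  | zero => simp [isOfHLevel, isContr]
  | succ n ih => simp [isOfHLevel, ih]

end HoTT.Expr

namespace HoTT

open HoTT.Expr HoTT.Jdg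

variable {cl : Bool} {Γ Δ Ε : List Expr} {A A' B C P a a' b b' c f g p q t : Expr} {J : Jdg}
  {s s' : ℕ → Expr} {n : ℕ}

/-! ### Context morphisms and generic elements -/

namespace Jdg

@[simp]
theorem subst_ok : ok.subst s = ok := rfl

@[simp]
theorem subst_ty : (ty A).subst s = ty (A.subst s) := rfl

@[simp]
theorem subst_tm : (tm a A).subst s = tm (a.subst s) (A.subst s) := rfl

@[simp]
theorem subst_tyEq : (tyEq A B).subst s = tyEq (A.subst s) (B.subst s) := rfl

@[simp]
theorem subst_tmEq : (tmEq a b A).subst s = tmEq (a.subst s) (b.subst s) (A.subst s) := rfl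

@[simp]
theorem subst_subst (J : Jdg) (s s' : ℕ → Expr) : (J.subst s).subst s' = J.subst (comp s s') := by
  cases J <;> simp

@[simp]
theorem subst_var (J : Jdg) : J.subst .var = J := by
  cases J <;> simp

end Jdg

theorem Der.ctx_ok (h : Der cl Γ J) : Der cl Γ ok := by
  induction h <;> first | assumption | exact .ctxNil | (apply Der.ctxCons; assumption)

theorem Der.ty_of_ok_cons (h : Der cl (A :: Γ) ok) : Der cl Γ (ty A) := by
  generalize hΔ : A :: Γ = Δ at h
  generalize hJ : ok = J at h
  induction h with
  | ctxCons h _ => cases hΔ; exact h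
  | subst _ _ _ ih _ _ => exact ih hΔ rfl
  | _ => cases hΔ <;> cases hJ

theorem Der.head_form (h : Der cl (A :: Γ) J) : Der cl Γ (ty A) :=
  h.ctx_ok.ty_of_ok_cons

/-- `s` is a context morphism from the well-formed context `Δ` to `Γ`: it provides terms over `Δ`
of the types declared in `Γ`. -/
structure SubstWF (cl : Bool) (Δ : List Expr) (s : ℕ → Expr) (Γ : List Expr) : Prop where
  ok : Der cl Δ ok
  var : ∀ i A, Γ[i]? = some A → Der cl Δ (tm (s i) ((A.wkN (i + 1)).subst s))

theorem Der.substWF (h : Der cl Γ J) (hs : SubstWF cl Δ s Γ) : Der cl Δ (J.subst s) :=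
  .subst hs.ok hs.var h

namespace SubstWF

theorem id (hΓ : Der cl Γ .ok) : SubstWF cl Γ Expr.var Γ where
  ok := hΓ
  var i A h := by simpa using Der.var hΓ h

theorem shift (hA : Der cl Γ (ty A)) : SubstWF cl (A :: Γ) shift Γ where
  ok := .ctxCons hA
  var i A' h := by
    simpa [wkN_succ] using
      Der.var (cl := cl) (Γ := A :: Γ) (i := i + 1) (A := A') (.ctxCons hA) (by simpa using h)

theorem comp (hs : SubstWF cl Δ s Γ) (hs' : SubstWF cl Ε s' Δ) : SubstWF cl Ε (comp s s') Γ where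
  ok := hs'.ok
  var i A h := by simpa using (hs.var i A h).substWF hs'

theorem scons (hs : SubstWF cl Δ s Γ) (ht : Der cl Δ (tm t (A.subst s))) :
    SubstWF cl Δ (scons t s) (A :: Γ) where
  ok := hs.ok
  var
    | 0, A', h => by
      obtain rfl : A = A' := by simpa using h
      simpa [wkN_one] using ht
    | n + 1, A', h => by simpa [wkN_add_one_scons] using hs.var n A' (by simpa using h)

end SubstWF

theorem Der.weaken (h : Der cl Γ J) (hA : Der cl Γ (ty A)) : Der cl (A :: Γ) (J.subst shift) :=
  h.substWF (.shift hA)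

theorem Der.var_zero (hA : Der cl Γ (ty A)) :
    Der cl (A :: Γ) (tm (.var 0) (A.subst shift)) := by
  simpa [wkN_one] using Der.var (cl := cl) (Γ := A :: Γ) (i := 0) (.ctxCons hA) rfl

theorem Der.var_one (hB : Der cl (A :: Γ) (ty B)) :
    Der cl (B :: A :: Γ) (tm (.var 1) (A.subst (comp shift shift))) := by
  simpa using hB.head_form.var_zero.weaken hB

theorem Der.instantiate (h : Der cl (A :: Γ) J) (ha : Der cl Γ (tm a A)) :
    Der cl Γ (J.subst (scons a .var)) :=
  h.substWF (.scons (.id ha.ctx_ok) (by simpa using ha))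

theorem SubstWF.lift (hs : SubstWF cl Δ s Γ) (hA : Der cl Γ (ty A)) :
    SubstWF cl (A.subst s :: Δ) (Expr.scons (.var 0) (Expr.comp s Expr.shift)) (A :: Γ) :=
  have hA' := hA.substWF hs
  (hs.comp (.shift hA')).scons (by simpa using hA'.var_zero)

theorem Der.substWF_lift (h : Der cl (A :: Γ) J) (hs : SubstWF cl Δ s Γ) :
    Der cl (A.subst s :: Δ) (J.subst (scons (.var 0) (comp s shift))) :=
  h.substWF (hs.lift h.head_form)

theorem Der.weaken_under (h : Der cl (B :: Γ) J) (hA : Der cl Γ (ty A)) :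
    Der cl (B.subst shift :: A :: Γ) (J.subst (scons (.var 0) (comp shift shift))) :=
  h.substWF_lift (.shift hA)

-- The variable `x` is itself an element of `A` in the context `Γ, x : A`.
theorem Der.of_generic (hA : Der cl Γ (ty A))
    (h : ∀ {Δ s a}, SubstWF cl Δ s Γ → Der cl Δ (tm a (A.subst s)) →
      Der cl Δ (J.subst (scons a s))) : Der cl (A :: Γ) J := by
  simpa using h (.shift hA) hA.var_zero

theorem Der.substEq_scons (hs : SubstWF cl Δ s Γ) (hB : Der cl (A :: Γ) (ty B))
    (ha : Der cl Δ (tm a (A.subst s))) (hb : Der cl Δ (tm b (A.subst s)))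
    (hab : Der cl Δ (tmEq a b (A.subst s))) :
    Der cl Δ (tyEq (B.subst (scons a s)) (B.subst (scons b s))) := by
  refine .substTyEq hs.ok (hs.scons ha).var (hs.scons hb).var (fun i A' h => ?_) hB
  cases i with
  | zero =>
    obtain rfl : A = A' := by simpa using h
    simpa [wkN_one] using hab
  | succ n =>
    simpa [wkN_add_one_scons] using Der.tmRefl (hs.var n A' (by simpa using h))

theorem Der.convCtx (h : Der cl (A :: Γ) J) (hA' : Der cl Γ (ty A'))
    (hA : Der cl Γ (tyEq A' A)) : Der cl (A' :: Γ) J := by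
  simpa using h.substWF ((SubstWF.shift hA').scons (hA'.var_zero.conv (hA.weaken hA')))

/-- The type `A` is inhabited. -/
def Inh (cl : Bool) (Γ : List Expr) (A : Expr) : Prop := ∃ t, Der cl Γ (tm t A)

namespace Inh

theorem substWF (h : Inh cl Γ A) (hs : SubstWF cl Δ s Γ) : Inh cl Δ (A.subst s) :=
  h.elim fun _ h => ⟨_, h.substWF hs⟩

theorem conv (h : Inh cl Γ A) (hAB : Der cl Γ (tyEq A B)) : Inh cl Γ B :=
  h.elim fun _ h => ⟨_, h.conv hAB⟩

theorem var_zero (hA : Der cl Γ (ty A)) : Inh cl (A :: Γ) (A.subst shift) :=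
  ⟨_, hA.var_zero⟩

end Inh

/-! ### Functions -/

theorem Der.arrowForm (hA : Der cl Γ (ty A)) (hB : Der cl Γ (ty B)) : Der cl Γ (ty (arrow A B)) :=
  .piForm hA (by simpa using hB.weaken hA)

theorem Der.app_arrow (hB : Der cl Γ (ty B)) (hf : Der cl Γ (tm f (arrow A B)))
    (ha : Der cl Γ (tm a A)) (hA : Der cl Γ (ty A)) : Der cl Γ (tm (.app f a) B) := by
  simpa using Der.app (B := B.subst shift) (hB.weaken hA) (by simpa [arrow] using hf) ha

theorem Der.app_var_zero (hB : Der cl (A :: Γ) (ty B))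
    (hf : Der cl Γ (tm f (Pi A B))) : Der cl (A :: Γ) (tm (.app (f.subst shift) (.var 0)) B) := by
  have hA := hB.head_form
  simpa using Der.app (hB.weaken_under hA) (by simpa using hf.weaken hA) hA.var_zero

namespace Inh

theorem lam (h : Inh cl (A :: Γ) B) : Inh cl Γ (Pi A B) :=
  h.elim fun _ h => ⟨_, .lam h.head_form h⟩

theorem app (hB : Der cl (A :: Γ) (ty B)) (h : Inh cl Γ (Pi A B)) (ha : Der cl Γ (tm a A)) :
    Inh cl Γ (B.subst (scons a .var)) :=
  h.elim fun _ h => ⟨_, by simpa using Der.app hB h ha⟩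

theorem app_var_zero (hB : Der cl (A :: Γ) (ty B)) (h : Inh cl Γ (Pi A B)) : Inh cl (A :: Γ) B :=
  h.elim fun _ h => ⟨_, .app_var_zero hB h⟩

theorem arrow_intro (hA : Der cl Γ (ty A))
    (h : ∀ {Δ s}, SubstWF cl Δ s Γ → Inh cl Δ (A.subst s) → Inh cl Δ (B.subst s)) :
    Inh cl Γ (arrow A B) := by
  simpa [arrow] using (h (.shift hA) (.var_zero hA)).lam

theorem arrow_elim (hA : Der cl Γ (ty A)) (hB : Der cl Γ (ty B)) (h : Inh cl Γ (arrow A B))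
    (ha : Inh cl Γ A) : Inh cl Γ B :=
  let ⟨_, hf⟩ := h
  let ⟨_, ha⟩ := ha
  ⟨_, .app_arrow hB hf ha hA⟩

end Inh

/-! ### Pairs -/

theorem Der.prodForm (hA : Der cl Γ (ty A)) (hB : Der cl Γ (ty B)) : Der cl Γ (ty (prod A B)) :=
  .sgForm hA (by simpa using hB.weaken hA)

theorem Der.prod_pair (hA : Der cl Γ (ty A)) (hB : Der cl Γ (ty B)) (ha : Der cl Γ (tm a A))
    (hb : Der cl Γ (tm b B)) : Der cl Γ (tm (.pair a b) (prod A B)) :=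
  .pair (by simpa using hB.weaken hA) ha (by simpa using hb)

theorem Der.fst (hB : Der cl (A :: Γ) (ty B)) (hp : Der cl Γ (tm p (Sg A B))) :
    Der cl Γ (tm (fst A p) A) := by
  have hC := hB.head_form.weaken (.sgForm hB.head_form hB)
  simpa [Expr.fst] using
    Der.indSg (C := A.subst shift) (d := .var 1) hC (by simpa using Der.var_one hB) hp

theorem Der.fst_pair (hB : Der cl (A :: Γ) (ty B)) (ha : Der cl Γ (tm a A))
    (hb : Der cl Γ (tm b (B.subst (scons a .var)))) :
    Der cl Γ (tmEq (Expr.fst A (.pair a b)) a A) := by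
  have hC := hB.head_form.weaken (.sgForm hB.head_form hB)
  simpa [Expr.fst] using Der.sgBeta (C := A.subst shift) (d := .var 1) hC
    (by simpa using Der.var_one hB) ha (by simpa using hb)

theorem Der.subst_fst_pair (hs : SubstWF cl Δ s Γ) (hB : Der cl (A :: Γ) (ty B))
    (ha : Der cl Δ (tm a (A.subst s))) (hb : Der cl Δ (tm b (B.subst (scons a s)))) :
    Der cl Δ (tyEq (B.subst (scons a s))
      (B.subst (scons (Expr.fst (A.subst s) (.pair a b)) s))) := by
  have hB' := hB.substWF_lift hs
  have hb' : Der cl Δ (tm b ((B.subst (scons (.var 0) (comp s shift))).subst (scons a .var))) := by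
    simpa using hb
  have hpair := Der.pair hB' ha (by simpa using hb)
  exact .substEq_scons hs hB ha (.fst hB' hpair) (.tmSymm (.fst_pair hB' ha hb'))

theorem Der.sndMotive (hB : Der cl (A :: Γ) (ty B)) :
    Der cl (Sg A B :: Γ) (ty (B.subst (scons (Expr.fst (A.subst shift) (.var 0)) shift))) := by
  have hS := Der.sgForm hB.head_form hB
  exact hB.substWF
    (.scons (.shift hS) (.fst (hB.weaken_under hS) (by simpa using Der.var_zero hS)))

theorem Der.snd (hB : Der cl (A :: Γ) (ty B)) (hp : Der cl Γ (tm p (Sg A B))) :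
    Der cl Γ (tm (snd A B p) (B.subst (scons (Expr.fst A p) .var))) := by
  have heq := Der.subst_fst_pair ((SubstWF.shift hB.head_form).comp (.shift hB)) hB
    (.var_one hB) (b := .var 0) (by simpa using Der.var_zero hB)
  simpa [Expr.snd] using Der.indSg (.sndMotive hB) (d := .var 0)
    (.conv (.var_zero hB) (by simpa using heq)) hp

namespace Inh

theorem pair (hB : Der cl (A :: Γ) (ty B)) (ha : Der cl Γ (tm a A))
    (hb : Inh cl Γ (B.subst (scons a .var))) : Inh cl Γ (Sg A B) :=
  hb.elim fun _ hb => ⟨_, .pair hB ha (by simpa using hb)⟩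

theorem fst (hB : Der cl (A :: Γ) (ty B)) (h : Inh cl Γ (Sg A B)) : Inh cl Γ A :=
  h.elim fun _ h => ⟨_, .fst hB h⟩

theorem prod_intro (hA : Der cl Γ (ty A)) (hB : Der cl Γ (ty B)) (ha : Inh cl Γ A)
    (hb : Inh cl Γ B) : Inh cl Γ (prod A B) :=
  let ⟨_, ha⟩ := ha
  let ⟨_, hb⟩ := hb
  ⟨_, .prod_pair hA hB ha hb⟩

theorem prod_left (hA : Der cl Γ (ty A)) (hB : Der cl Γ (ty B)) (h : Inh cl Γ (prod A B)) :
    Inh cl Γ A :=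
  .fst (B := B.subst shift) (hB.weaken hA) (by simpa [Expr.prod] using h)

theorem prod_right (hA : Der cl Γ (ty A)) (hB : Der cl Γ (ty B)) (h : Inh cl Γ (prod A B)) :
    Inh cl Γ B :=
  h.elim fun _ h => ⟨_, by
    simpa using Der.snd (B := B.subst shift) (hB.weaken hA) (by simpa [Expr.prod] using h)⟩

theorem sg_ind (hB : Der cl (A :: Γ) (ty B)) (hC : Der cl (Sg A B :: Γ) (ty C))
    (h : ∀ {Δ s a b}, SubstWF cl Δ s Γ → Der cl Δ (tm a (A.subst s)) →
      Der cl Δ (tm b (B.subst (scons a s))) → Inh cl Δ (C.subst (scons (.pair a b) s)))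
    (hp : Der cl Γ (tm p (Sg A B))) : Inh cl Γ (C.subst (scons p .var)) := by
  obtain ⟨d, hd⟩ := h ((SubstWF.shift hB.head_form).comp (.shift hB)) (.var_one hB)
    (by simpa using Der.var_zero hB)
  exact ⟨_, by simpa using Der.indSg hC (by simpa using hd) hp⟩

theorem sg_elim (hB : Der cl (A :: Γ) (ty B)) (hC : Der cl Γ (ty C))
    (h : ∀ {Δ s a}, SubstWF cl Δ s Γ → Der cl Δ (tm a (A.subst s)) →
      Inh cl Δ (B.subst (scons a s)) → Inh cl Δ (C.subst s))
    (hp : Inh cl Γ (Sg A B)) : Inh cl Γ C := by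
  obtain ⟨p, hp⟩ := hp
  simpa using Inh.sg_ind (C := C.subst shift) hB (hC.weaken (.sgForm hB.head_form hB))
    (fun hs ha hb => by simpa using h hs ha ⟨_, hb⟩) hp

theorem prod_ind (hA : Der cl Γ (ty A)) (hB : Der cl Γ (ty B))
    (hC : Der cl (prod A B :: Γ) (ty C))
    (h : ∀ {Δ s a b}, SubstWF cl Δ s Γ → Der cl Δ (tm a (A.subst s)) →
      Der cl Δ (tm b (B.subst s)) → Inh cl Δ (C.subst (scons (.pair a b) s)))
    (hp : Der cl Γ (tm p (prod A B))) : Inh cl Γ (C.subst (scons p .var)) := by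
  simp only [Expr.prod, wk_eq] at hC hp
  exact sg_ind (hB.weaken hA) hC (fun hs ha hb => h hs ha (by simpa using hb)) hp

end Inh

/-! ### Sums and truncations -/

namespace Inh

theorem inl (hB : Der cl Γ (ty B)) (h : Inh cl Γ A) : Inh cl Γ (Sum A B) :=
  h.elim fun _ h => ⟨_, .inl hB h⟩

theorem inr (hA : Der cl Γ (ty A)) (h : Inh cl Γ B) : Inh cl Γ (Sum A B) :=
  h.elim fun _ h => ⟨_, .inr hA h⟩

theorem sum_elim (hA : Der cl Γ (ty A)) (hB : Der cl Γ (ty B)) (hC : Der cl Γ (ty C))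
    (hl : ∀ {Δ s}, SubstWF cl Δ s Γ → Inh cl Δ (A.subst s) → Inh cl Δ (C.subst s))
    (hr : ∀ {Δ s}, SubstWF cl Δ s Γ → Inh cl Δ (B.subst s) → Inh cl Δ (C.subst s))
    (h : Inh cl Γ (Sum A B)) : Inh cl Γ C := by
  obtain ⟨l, hl⟩ := hl (.shift hA) (.var_zero hA)
  obtain ⟨r, hr⟩ := hr (.shift hB) (.var_zero hB)
  obtain ⟨t, ht⟩ := h
  exact ⟨_, by
    simpa using Der.indSum (C := C.subst shift) (hC.weaken (.sumForm hA hB))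
      (by simpa using hl) (by simpa using hr) ht⟩

theorem exfalso (hC : Der cl Γ (ty C)) (h : Inh cl Γ Zero) : Inh cl Γ C :=
  h.elim fun _ h => ⟨_, by
    simpa using Der.indZero (C := C.subst shift) (hC.weaken (.zeroForm hC.ctx_ok)) h⟩

theorem tr (h : Inh cl Γ A) : Inh cl Γ (Tr A) := h.elim fun _ h => ⟨_, .tr h⟩

theorem tr_elim (hA : Der cl Γ (ty A)) (hC : Der cl Γ (ty C)) (pC : Inh cl Γ (isProp C))
    (h : ∀ {Δ s}, SubstWF cl Δ s Γ → Inh cl Δ (A.subst s) → Inh cl Δ (C.subst s))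
    (ht : Inh cl Γ (Tr A)) : Inh cl Γ C :=
  let ⟨_, hp⟩ := pC
  let ⟨_, hf⟩ := arrow_intro hA h
  let ⟨_, ht⟩ := ht
  ⟨_, .trRec hC hp hf ht⟩

theorem tr_sum_elim (hA : Der cl Γ (ty A)) (hB : Der cl Γ (ty B)) (hC : Der cl Γ (ty C))
    (pC : Inh cl Γ (isProp C))
    (hl : ∀ {Δ s}, SubstWF cl Δ s Γ → Inh cl Δ (A.subst s) → Inh cl Δ (C.subst s))
    (hr : ∀ {Δ s}, SubstWF cl Δ s Γ → Inh cl Δ (B.subst s) → Inh cl Δ (C.subst s))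
    (h : Inh cl Γ (Tr (Sum A B))) : Inh cl Γ C :=
  tr_elim (.sumForm hA hB) hC pC (fun hs h => sum_elim (hA.substWF hs) (hB.substWF hs)
    (hC.substWF hs) (fun hs' h' => by simpa using hl (hs.comp hs') (by simpa using h'))
    (fun hs' h' => by simpa using hr (hs.comp hs') (by simpa using h')) h) h

theorem tr_sg_elim (hB : Der cl (A :: Γ) (ty B)) (hC : Der cl Γ (ty C))
    (pC : Inh cl Γ (isProp C))
    (h : ∀ {Δ s a}, SubstWF cl Δ s Γ → Der cl Δ (tm a (A.subst s)) →
      Inh cl Δ (B.subst (scons a s)) → Inh cl Δ (C.subst s))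
    (ht : Inh cl Γ (Tr (Sg A B))) : Inh cl Γ C :=
  tr_elim (.sgForm hB.head_form hB) hC pC (fun hs hp => sg_elim (hB.substWF_lift hs)
    (hC.substWF hs) (fun hs' ha hb => by
      simpa using h (hs.comp hs') (by simpa using ha) (by simpa using hb))
    (by simpa using hp)) ht

end Inh

/-! ### Identity types -/

theorem Der.pathForm (hA : Der cl Γ (ty A)) (ha : Der cl Γ (tm a A)) :
    Der cl (A :: Γ) (ty (Id (A.subst shift) (a.subst shift) (.var 0))) :=
  .idForm (hA.weaken hA) (ha.weaken hA) hA.var_zero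

theorem Der.of_path (hA : Der cl Γ (ty A)) (ha : Der cl Γ (tm a A))
    (h : ∀ {Δ s b p}, SubstWF cl Δ s Γ → Der cl Δ (tm b (A.subst s)) →
      Der cl Δ (tm p (Id (A.subst s) (a.subst s) b)) →
      Der cl Δ (J.subst (scons p (scons b s)))) :
    Der cl (Id (A.subst shift) (a.subst shift) (.var 0) :: A :: Γ) J := by
  have hI := Der.pathForm hA ha
  have hvar : Der cl (Id (A.subst shift) (a.subst shift) (.var 0) :: A :: Γ) (tm (.var 0)
      (Id (A.subst (comp shift shift)) (a.subst (comp shift shift)) (.var 1))) := by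
    simpa using hI.var_zero
  simpa using h ((SubstWF.shift hA).comp (.shift hI)) (.var_one hI) hvar

theorem Der.trans (ha : Der cl Γ (tm a A)) (hb : Der cl Γ (tm b A))
    (hp : Der cl Γ (tm p (Id A a b))) (hP : Der cl (A :: Γ) (ty P))
    (ht : Der cl Γ (tm t (P.subst (scons a .var)))) :
    Der cl Γ (tm (Expr.trans P a b p t) (P.subst (scons b .var))) := by
  simpa [Expr.trans] using Der.indId (C := P.subst shift) ha
    (by simpa using hP.weaken (.pathForm hP.head_form ha)) (by simpa using ht) hb hp

theorem Der.trans_refl (ha : Der cl Γ (tm a A)) (hP : Der cl (A :: Γ) (ty P))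
    (ht : Der cl Γ (tm t (P.subst (scons a .var)))) :
    Der cl Γ (tmEq (Expr.trans P a a (.refl a) t) t (P.subst (scons a .var))) := by
  simpa [Expr.trans] using Der.idBeta (C := P.subst shift) (d := t) ha
    (by simpa using hP.weaken (.pathForm hP.head_form ha)) (by simpa using ht)

namespace Inh

theorem path_ind (ha : Der cl Γ (tm a A))
    (hC : Der cl (Id (A.subst shift) (a.subst shift) (.var 0) :: A :: Γ) (ty C))
    (hd : Inh cl Γ (C.subst (scons (.refl a) (scons a .var))))
    (hb : Der cl Γ (tm b A)) (hp : Der cl Γ (tm p (Id A a b))) :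
    Inh cl Γ (C.subst (scons p (scons b .var))) :=
  hd.elim fun _ hd =>
    ⟨_, by simpa using Der.indId (C := C) ha (by simpa using hC) (by simpa using hd) hb hp⟩

theorem transport (ha : Der cl Γ (tm a A)) (hb : Der cl Γ (tm b A)) (hp : Inh cl Γ (Id A a b))
    (hP : Der cl (A :: Γ) (ty P)) (h : Inh cl Γ (P.subst (scons a .var))) :
    Inh cl Γ (P.subst (scons b .var)) :=
  let ⟨_, hp⟩ := hp
  let ⟨_, ht⟩ := h
  ⟨_, .trans ha hb hp hP ht⟩

theorem id_refl (ha : Der cl Γ (tm a A)) : Inh cl Γ (Id A a a) := ⟨_, .refl ha⟩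

theorem id_symm (hA : Der cl Γ (ty A)) (ha : Der cl Γ (tm a A)) (hb : Der cl Γ (tm b A))
    (h : Inh cl Γ (Id A a b)) : Inh cl Γ (Id A b a) := by
  simpa using h.transport (P := Id (A.subst shift) (.var 0) (a.subst shift)) ha hb
    (.idForm (hA.weaken hA) hA.var_zero (ha.weaken hA)) (by simpa using id_refl ha)

theorem id_trans (hA : Der cl Γ (ty A)) (ha : Der cl Γ (tm a A)) (hb : Der cl Γ (tm b A))
    (hc : Der cl Γ (tm c A)) (h : Inh cl Γ (Id A a b)) (h' : Inh cl Γ (Id A b c)) :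
    Inh cl Γ (Id A a c) := by
  simpa using h'.transport (P := Id (A.subst shift) (a.subst shift) (.var 0)) hb hc
    (.pathForm hA ha) (by simpa using h)

theorem id_map (hB : Der cl Γ (ty B)) (hf : Der cl (A :: Γ) (tm f (B.subst shift)))
    (ha : Der cl Γ (tm a A)) (hb : Der cl Γ (tm b A)) (h : Inh cl Γ (Id A a b)) :
    Inh cl Γ (Id B (f.subst (scons a .var)) (f.subst (scons b .var))) := by
  have hA := hf.head_form
  have hfa : Der cl Γ (tm (f.subst (scons a .var)) B) := by simpa using hf.instantiate ha
  have := h.transport (P := Id (B.subst shift) ((f.subst (scons a .var)).subst shift) f) ha hb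
    (.idForm (hB.weaken hA) (hfa.weaken hA) hf) (by simpa using id_refl hfa)
  simpa using this

theorem id_trans_of_refl (ha : Der cl Γ (tm a A)) (hP : Der cl (A :: Γ) (ty P))
    (ht : Der cl Γ (tm t (P.subst (scons a .var)))) (hq : Der cl Γ (tm q (Id A a a)))
    (h : Inh cl Γ (Id (Id A a a) q (.refl a))) :
    Inh cl Γ (Id (P.subst (scons a .var)) t (Expr.trans P a a q t)) := by
  have hA := hP.head_form
  have hI := Der.idForm hA ha ha
  have hPa : Der cl Γ (ty (P.subst (scons a .var))) := hP.instantiate ha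
  have hform : Der cl (Id A a a :: Γ) (ty (Id ((P.subst (scons a .var)).subst shift) (t.subst shift)
      (Expr.trans (P.subst (scons (.var 0) (comp shift shift))) (a.subst shift) (a.subst shift)
        (.var 0) (t.subst shift)))) := by
    have ht' := ht.weaken hI
    have htr := Der.trans (ha.weaken hI) (ha.weaken hI) hI.var_zero (hP.weaken_under hI)
      (by simpa using ht')
    exact .idForm (hPa.weaken hI) ht' (by simpa using htr)
  have hrefl := (id_refl ht).conv
    (.idCong (.tyRefl hPa) (.tmRefl ht) (.tmSymm (.trans_refl ha hP ht)))
  simpa using (h.id_symm hI hq (.refl ha)).transport (.refl ha) hq hform (by simpa using hrefl)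

end Inh

/-! ### Propositions -/

theorem Der.isPropBody (hA : Der cl Γ (ty A)) :
    Der cl (A.subst shift :: A :: Γ) (ty (Id (A.subst (comp shift shift)) (.var 1) (.var 0))) := by
  have hA' := hA.weaken hA
  exact .idForm (by simpa using hA'.weaken hA') (.var_one hA') (by simpa using hA'.var_zero)

theorem Der.isPropForm (hA : Der cl Γ (ty A)) : Der cl Γ (ty (isProp A)) := by
  simpa [isProp] using Der.piForm hA (.piForm (hA.weaken hA) (.isPropBody hA))

theorem Der.isPropCong (hA : Der cl Γ (ty A)) (h : Der cl Γ (tyEq A B)) :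
    Der cl Γ (tyEq (isProp A) (isProp B)) := by
  have hA' := hA.weaken hA
  have hAB := h.weaken hA
  have hAB' : Der cl (A.subst shift :: A :: Γ)
      (tyEq (A.subst (comp shift shift)) (B.subst (comp shift shift))) := by
    simpa using hAB.weaken hA'
  simpa [isProp] using Der.piCong h (.piCong hAB
    (.idCong hAB' (.tmRefl (.var_one hA')) (.tmRefl (by simpa using hA'.var_zero))))

theorem Der.isOfHLevelForm (hA : Der cl Γ (ty A)) : Der cl Γ (ty (isOfHLevel n A)) := by
  induction n generalizing A Γ with
  | zero =>
    simpa [isOfHLevel, isContr] using Der.sgForm hA (.piForm (hA.weaken hA) (.isPropBody hA))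
  | succ n ih =>
    simpa [isOfHLevel] using Der.piForm hA (.piForm (hA.weaken hA) (ih (.isPropBody hA)))

namespace Inh

theorem isProp_intro (hA : Der cl Γ (ty A))
    (h : ∀ {Δ s a b}, SubstWF cl Δ s Γ → Der cl Δ (tm a (A.subst s)) →
      Der cl Δ (tm b (A.subst s)) → Inh cl Δ (Id (A.subst s) a b)) : Inh cl Γ (isProp A) := by
  have hA' := hA.weaken hA
  have := h ((SubstWF.shift hA).comp (.shift hA')) (.var_one hA') (by simpa using hA'.var_zero)
  simpa [isProp] using this.lam.lam

theorem isProp_elim (hA : Der cl Γ (ty A)) (h : Inh cl Γ (isProp A))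
    (ha : Der cl Γ (tm a A)) (hb : Der cl Γ (tm b A)) : Inh cl Γ (Id A a b) := by
  have hA' := hA.weaken hA
  have hbody := Der.isPropBody hA
  have hfa := Inh.app (.piForm hA' hbody) (by simpa [isProp] using h) ha
  simpa using Inh.app (A := A) (B := Id (A.subst shift) (a.subst shift) (.var 0))
    (.pathForm hA ha) (by simpa using hfa) hb

theorem isProp_subst (h : Inh cl Γ (isProp A)) (hs : SubstWF cl Δ s Γ) :
    Inh cl Δ (isProp (A.subst s)) := by
  simpa using h.substWF hs

theorem id_one (ha : Der cl Γ (tm a One)) : Inh cl Γ (Id One star a) :=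
  have hstar := Der.star ha.ctx_ok
  ⟨_, by
    simpa using Der.indOne (C := Id One star (.var 0)) (c := refl star)
      (by simpa using Der.pathForm (.oneForm ha.ctx_ok) hstar) (by simpa using Der.refl hstar) ha⟩

theorem isProp_one (hΓ : Der cl Γ ok) : Inh cl Γ (isProp One) :=
  isProp_intro (.oneForm hΓ) fun {Δ _ _ _} hs ha hb =>
    have hO : Der cl Δ (ty One) := .oneForm hs.ok
    have hstar := Der.star hs.ok
    ((id_one ha).id_symm hO hstar ha).id_trans hO ha hstar hb (id_one hb)

theorem isProp_zero (hΓ : Der cl Γ ok) : Inh cl Γ (isProp Zero) :=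
  isProp_intro (.zeroForm hΓ) fun hs ha hb => exfalso (.idForm (.zeroForm hs.ok) ha hb) ⟨_, ha⟩

theorem isProp_tr (hA : Der cl Γ (ty A)) : Inh cl Γ (isProp (Tr A)) :=
  isProp_intro (.trForm hA) fun _ ha hb => ⟨_, .squash ha hb⟩

theorem id_pair (hA : Der cl Γ (ty A)) (hB : Der cl Γ (ty B)) (ha : Der cl Γ (tm a A))
    (ha' : Der cl Γ (tm a' A)) (hb : Der cl Γ (tm b B)) (hb' : Der cl Γ (tm b' B))
    (h : Inh cl Γ (Id A a a')) (h' : Inh cl Γ (Id B b b')) :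
    Inh cl Γ (Id (Expr.prod A B) (.pair a b) (.pair a' b')) := by
  have hP := Der.prodForm hA hB
  have h₁ : Inh cl Γ (Id (Expr.prod A B) (.pair a b) (.pair a' b)) := by
    simpa using h.id_map (f := .pair (.var 0) (b.subst shift)) hP
      (by simpa using Der.prod_pair (hA.weaken hA) (hB.weaken hA) hA.var_zero (hb.weaken hA)) ha ha'
  have h₂ : Inh cl Γ (Id (Expr.prod A B) (.pair a' b) (.pair a' b')) := by
    simpa using h'.id_map (f := .pair (a'.subst shift) (.var 0)) hP
      (by simpa using Der.prod_pair (hA.weaken hB) (hB.weaken hB) (ha'.weaken hB) hB.var_zero)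
      hb hb'
  exact h₁.id_trans hP (.prod_pair hA hB ha hb) (.prod_pair hA hB ha' hb)
    (.prod_pair hA hB ha' hb') h₂

theorem id_prod_pair (hA : Der cl Γ (ty A)) (hB : Der cl Γ (ty B)) (pA : Inh cl Γ (isProp A))
    (pB : Inh cl Γ (isProp B)) (ha : Der cl Γ (tm a A)) (hb : Der cl Γ (tm b B))
    (hq : Der cl Γ (tm q (Expr.prod A B))) : Inh cl Γ (Id (Expr.prod A B) (.pair a b) q) := by
  have hP := Der.prodForm hA hB
  have := prod_ind (C := Id ((Expr.prod A B).subst shift) ((Expr.pair a b).subst shift) (.var 0))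
    hA hB (.pathForm hP (.prod_pair hA hB ha hb)) (fun hs ha' hb' => by
      have hA' := hA.substWF hs
      have hB' := hB.substWF hs
      simpa using id_pair hA' hB' (ha.substWF hs) ha' (hb.substWF hs) hb'
        ((pA.isProp_subst hs).isProp_elim hA' (ha.substWF hs) ha')
        ((pB.isProp_subst hs).isProp_elim hB' (hb.substWF hs) hb')) hq
  simpa using this

theorem isProp_prod (hA : Der cl Γ (ty A)) (hB : Der cl Γ (ty B)) (pA : Inh cl Γ (isProp A))
    (pB : Inh cl Γ (isProp B)) : Inh cl Γ (isProp (Expr.prod A B)) := by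
  refine isProp_intro (.prodForm hA hB) fun {Δ s p q} hs hp hq => ?_
  simp only [subst_prod] at hp hq ⊢
  have hA := hA.substWF hs
  have hB := hB.substWF hs
  have hP := Der.prodForm hA hB
  have := prod_ind (C := Id ((Expr.prod (A.subst s) (B.subst s)).subst shift) (.var 0)
    (q.subst shift)) hA hB (.idForm (hP.weaken hP) hP.var_zero (hq.weaken hP))
    (fun hs' ha hb => by
      simpa using id_prod_pair (hA.substWF hs') (hB.substWF hs')
        (by simpa using pA.isProp_subst (hs.comp hs'))
        (by simpa using pB.isProp_subst (hs.comp hs')) ha hb (by simpa using hq.substWF hs')) hp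
  simpa using this

end Inh

/-! ### Function extensionality -/

/-- The type `Π (x : A), f x = g x` of homotopies between `f g : Pi A B`. -/
def homotopy (A B f g : Expr) : Expr :=
  Pi A (Id B (.app (f.subst shift) (.var 0)) (.app (g.subst shift) (.var 0)))

@[simp]
theorem subst_homotopy (A B f g : Expr) (s : ℕ → Expr) : (homotopy A B f g).subst s =
    homotopy (A.subst s) (B.subst (scons (.var 0) (comp s shift))) (f.subst s) (g.subst s) := by
  simp [homotopy]

namespace Der

theorem leftInverseForm (hA : Der cl Γ (ty A)) (hB : Der cl Γ (ty B))
    (hf : Der cl Γ (tm f (arrow A B))) (hg : Der cl Γ (tm g (arrow B A))) :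
    Der cl Γ (ty (Pi A
      (Id (A.subst shift) (.app (g.subst shift) (.app (f.subst shift) (.var 0))) (.var 0)))) :=
  have hA' := hA.weaken hA
  have hB' := hB.weaken hA
  .piForm hA (.idForm hA' (.app_arrow hA' (by simpa using hg.weaken hA)
    (.app_arrow hB' (by simpa using hf.weaken hA) hA.var_zero hA') hB') hA.var_zero)

theorem rightInverseForm (hA : Der cl Γ (ty A)) (hB : Der cl Γ (ty B))
    (hf : Der cl Γ (tm f (arrow A B))) :
    Der cl (arrow B A :: Γ) (ty (Pi B.wk
      (Id B.wk.wk (.app f.wk.wk (.app (.var 1) (.var 0))) (.var 0)))) :=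
  .of_generic (.arrowForm hB hA) fun {_ s _} hs hg => by
    simpa using leftInverseForm (g := f.subst s) (hB.substWF hs) (hA.substWF hs)
      (by simpa using hg) (by simpa using hf.substWF hs)

theorem retractionForm (hA : Der cl Γ (ty A)) (hB : Der cl Γ (ty B))
    (hf : Der cl Γ (tm f (arrow A B))) :
    Der cl Γ (ty (Sg (arrow B A) (Pi A.wk
      (Id A.wk.wk (.app (.var 1) (.app f.wk.wk (.var 0))) (.var 0))))) :=
  .sgForm (.arrowForm hB hA) <| .of_generic (.arrowForm hB hA) fun {_ s _} hs hg => by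
    simpa using leftInverseForm (f := f.subst s) (hA.substWF hs) (hB.substWF hs)
      (by simpa using hf.substWF hs) (by simpa using hg)

theorem homotopyForm (hB : Der cl (A :: Γ) (ty B)) (hf : Der cl Γ (tm f (Pi A B)))
    (hg : Der cl Γ (tm g (Pi A B))) : Der cl Γ (ty (homotopy A B f g)) :=
  .piForm hB.head_form (.idForm hB (.app_var_zero hB hf) (.app_var_zero hB hg))

theorem homotopy_of_path (hB : Der cl (A :: Γ) (ty B)) (hf : Der cl Γ (tm f (Pi A B)))
    (hg : Der cl Γ (tm g (Pi A B))) (hp : Der cl Γ (tm p (Id (Pi A B) f g))) :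
    Der cl Γ (tm (.indId f
        (homotopy (A.subst (comp shift shift)) (B.subst (scons (.var 0) (comp shift
          (comp shift shift)))) (f.subst (comp shift shift)) (.var 1))
        (.lam A (.refl (.app (f.subst shift) (.var 0)))) g p) (homotopy A B f g)) := by
  have hA := hB.head_form
  have hrefl : Der cl Γ (tm (.lam A (.refl (.app (f.subst shift) (.var 0)))) (homotopy A B f f)) :=
    .lam hA (.refl (.app_var_zero hB hf))
  have hC : Der cl (Id ((Pi A B).subst shift) (f.subst shift) (.var 0) :: Pi A B :: Γ)
      (ty (homotopy (A.subst (comp shift shift)) (B.subst (scons (.var 0) (comp shift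
        (comp shift shift)))) (f.subst (comp shift shift)) (.var 1))) :=
    .of_path (.piForm hA hB) hf fun hs hg' _ => by
      simpa using homotopyForm (hB.substWF_lift hs) (by simpa using hf.substWF hs)
        (by simpa using hg')
  have := Der.indId hf (by simpa using hC) (by simpa using hrefl) hg hp
  simpa using this

theorem happly (hB : Der cl (A :: Γ) (ty B)) (hf : Der cl Γ (tm f (Pi A B)))
    (hg : Der cl Γ (tm g (Pi A B))) :
    Der cl Γ (tm (happly A B f g) (arrow (Id (Pi A B) f g) (homotopy A B f g))) := by
  have hI := Der.idForm (.piForm hB.head_form hB) hf hg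
  have hp := homotopy_of_path (hB.weaken_under hI) (by simpa using hf.weaken hI)
    (by simpa using hg.weaken hI) (by simpa using hI.var_zero)
  simpa [arrow, Expr.happly, homotopy, rename_liftR_add_three] using Der.lam hI hp

end Der

namespace Inh

theorem of_isEquiv (hA : Der cl Γ (ty A)) (hB : Der cl Γ (ty B))
    (hf : Der cl Γ (tm f (arrow A B))) (h : Inh cl Γ (isEquiv A B f)) : Inh cl Γ (arrow B A) :=
  have hr := Der.rightInverseForm hA hB hf
  (h.prod_left (.sgForm hr.head_form hr) (.retractionForm hA hB hf)).fst hr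

theorem funext (hB : Der cl (A :: Γ) (ty B)) (hf : Der cl Γ (tm f (Pi A B)))
    (hg : Der cl Γ (tm g (Pi A B))) (h : Inh cl Γ (homotopy A B f g)) :
    Inh cl Γ (Id (Pi A B) f g) :=
  have hI := Der.idForm (.piForm hB.head_form hB) hf hg
  have hH := Der.homotopyForm hB hf hg
  have hequiv : Inh cl Γ (isEquiv (Id (Pi A B) f g) (homotopy A B f g) (Expr.happly A B f g)) :=
    ⟨_, by simpa [funextTy, homotopy] using Der.funext hB hf hg⟩
  (of_isEquiv hI hH (.happly hB hf hg) hequiv).arrow_elim hH hI h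

theorem isProp_pi (hB : Der cl (A :: Γ) (ty B)) (pB : Inh cl (A :: Γ) (isProp B)) :
    Inh cl Γ (isProp (Pi A B)) :=
  isProp_intro (.piForm hB.head_form hB) fun hs hf hg => by
    have hB' := hB.substWF_lift hs
    simp only [Expr.subst, liftS_eq] at hf hg ⊢
    exact funext hB' hf hg (lam ((pB.isProp_subst (hs.lift hB.head_form)).isProp_elim hB'
      (.app_var_zero hB' hf) (.app_var_zero hB' hg)))

theorem isProp_arrow (hA : Der cl Γ (ty A)) (hB : Der cl Γ (ty B))
    (pB : Inh cl Γ (isProp B)) : Inh cl Γ (isProp (arrow A B)) := by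
  simpa [arrow] using isProp_pi (B := B.subst shift) (hB.weaken hA)
    (pB.isProp_subst (.shift hA))

end Inh

/-! ### Small types and excluded middle -/

/-- `A` is a type in the context `Γ` which has a code in the universe. -/
structure IsSmall (cl : Bool) (Γ : List Expr) (A : Expr) : Prop where
  form : Der cl Γ (ty A)
  code : ∃ c, Der cl Γ (tm c U) ∧ Der cl Γ (tyEq (El c) A)

namespace IsSmall

theorem el (h : Der cl Γ (tm c U)) : IsSmall cl Γ (El c) := ⟨.elForm h, c, h, .tyRefl (.elForm h)⟩

theorem one (hΓ : Der cl Γ ok) : IsSmall cl Γ One := ⟨.oneForm hΓ, _, .cOne hΓ, .elOne hΓ⟩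

theorem zero (hΓ : Der cl Γ ok) : IsSmall cl Γ Zero := ⟨.zeroForm hΓ, _, .cZero hΓ, .elZero hΓ⟩

theorem id (hA : IsSmall cl Γ A) (ha : Der cl Γ (tm a A)) (hb : Der cl Γ (tm b A)) :
    IsSmall cl Γ (Id A a b) :=
  let ⟨_, hc, h⟩ := hA.code
  have ha' := ha.conv h.tySymm
  have hb' := hb.conv h.tySymm
  ⟨.idForm hA.form ha hb, _, .cId hc ha' hb',
    .tyTrans (.elId hc ha' hb') (.idCong h (.tmRefl ha') (.tmRefl hb'))⟩

theorem pi (hA : IsSmall cl Γ A) (hB : IsSmall cl (A :: Γ) B) : IsSmall cl Γ (Pi A B) :=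
  let ⟨_, hc, h⟩ := hA.code
  let ⟨_, hd, h'⟩ := hB.code
  have hd := hd.convCtx (.elForm hc) h
  ⟨.piForm hA.form hB.form, _, .cPi hc hd,
    .tyTrans (.elPi hc hd) (.piCong h (h'.convCtx (.elForm hc) h))⟩

theorem sg (hA : IsSmall cl Γ A) (hB : IsSmall cl (A :: Γ) B) : IsSmall cl Γ (Sg A B) :=
  let ⟨_, hc, h⟩ := hA.code
  let ⟨_, hd, h'⟩ := hB.code
  have hd := hd.convCtx (.elForm hc) h
  ⟨.sgForm hA.form hB.form, _, .cSg hc hd,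
    .tyTrans (.elSg hc hd) (.sgCong h (h'.convCtx (.elForm hc) h))⟩

theorem weaken (hB : IsSmall cl Γ B) (hA : Der cl Γ (ty A)) :
    IsSmall cl (A :: Γ) (B.subst shift) :=
  let ⟨_, hc, h⟩ := hB.code
  ⟨hB.form.weaken hA, _, hc.weaken hA, h.weaken hA⟩

theorem arrow (hA : IsSmall cl Γ A) (hB : IsSmall cl Γ B) : IsSmall cl Γ (arrow A B) := by
  simpa [Expr.arrow] using hA.pi (hB.weaken hA.form)

theorem prod (hA : IsSmall cl Γ A) (hB : IsSmall cl Γ B) : IsSmall cl Γ (Expr.prod A B) := by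
  simpa [Expr.prod] using hA.sg (hB.weaken hA.form)

theorem sum (hA : IsSmall cl Γ A) (hB : IsSmall cl Γ B) : IsSmall cl Γ (Sum A B) :=
  let ⟨_, hc, h⟩ := hA.code
  let ⟨_, hd, h'⟩ := hB.code
  ⟨.sumForm hA.form hB.form, _, .cSum hc hd, .tyTrans (.elSum hc hd) (.sumCong h h')⟩

theorem tr (hA : IsSmall cl Γ A) : IsSmall cl Γ (Tr A) :=
  let ⟨_, hc, h⟩ := hA.code
  ⟨.trForm hA.form, _, .cTr hc, .tyTrans (.elTr hc) (.trCong h)⟩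

end IsSmall

theorem Der.decForm (hA : Der cl Γ (ty A)) : Der cl Γ (ty (Sum A (arrow A Zero))) :=
  .sumForm hA (.arrowForm hA (.zeroForm hA.ctx_ok))

theorem Der.decCong (hA : Der cl Γ (ty A)) (h : Der cl Γ (tyEq A B)) :
    Der cl Γ (tyEq (Sum A (arrow A Zero)) (Sum B (arrow B Zero))) :=
  .sumCong h (by simpa [arrow] using Der.piCong h (.tyRefl (.zeroForm (.ctxCons hA))))

theorem Inh.lem_el (hcl : cl = true) (hc : Der cl Γ (tm c U)) (p : Inh cl Γ (isProp (El c))) :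
    Inh cl Γ (Sum (El c) (arrow (El c) Zero)) := by
  have hU : Der cl Γ (ty U) := .uForm hc.ctx_ok
  have hX : Der cl (U :: Γ) (ty (El (.var 0))) := .elForm (by simpa using hU.var_zero)
  have hbody : Der cl (isProp (El (.var 0)) :: U :: Γ)
      (ty (Sum (El (.var 1)) (arrow (El (.var 1)) Zero))) := by
    simpa using (Der.decForm hX).weaken (.isPropForm hX)
  have h := Inh.app (.piForm (.isPropForm hX) hbody)
    ⟨_, by simpa [lemTy] using Der.lem hcl hc.ctx_ok⟩ hc
  have hEl := Der.elForm hc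
  exact arrow_elim (.isPropForm hEl) (.decForm hEl) (by simpa [arrow] using h) p

theorem Inh.lem (hcl : cl = true) (hA : IsSmall cl Γ A) (pA : Inh cl Γ (isProp A)) :
    Inh cl Γ (Sum A (arrow A Zero)) :=
  let ⟨_, hc, h⟩ := hA.code
  (lem_el hcl hc (pA.conv (.isPropCong hA.form h.tySymm))).conv (.decCong (.elForm hc) h)

end HoTT

namespace FOLIso

open HoTT HoTT.Expr HoTT.Jdg

/-! ### Arrows of a signature -/

section

variable {L : Signature} {K A B I : L.Obj} {α β : Type} {P fs : List (Arr K)} {f : Arr K}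

theorem NHom.andThen_andThen (f : NHom K A) (p : Arr A) (q : Arr p.cod) :
    (f.andThen p).arr.andThen q = f.andThen (p.arr.andThen q) := by
  simp [NHom.andThen, NHom.comp]

theorem NHom.andThen_ne (f : NHom K A) (p : Arr A) : f.andThen p ≠ f.toArr := fun h =>
  p.arr.ne (congrArg Arr.cod h)

theorem Signature.andThen_mem_of_arrows_eq (hl : L.arrows K = P ++ fs) {g : Arr K} (hg : g ∈ P)
    (p : Arr g.cod) : g.arr.andThen p ∈ P := by
  have hm := L.mem_arrows (g.arr.andThen p)
  have ho := L.arrows_ordered K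
  rw [hl, List.mem_append] at hm
  rw [hl, List.pairwise_append] at ho
  exact hm.resolve_right fun hm => ho.2.2 g hg _ hm (L.lt_of_arr p.arr)

theorem Signature.andThen_head_mem_of_arrows_eq (hl : L.arrows K = P ++ f :: fs) (p : Arr f.cod) :
    f.arr.andThen p ∈ P := by
  have := L.andThen_mem_of_arrows_eq (P := P ++ [f]) (by simpa using hl) (by simp) p
  simp only [List.mem_append, List.mem_singleton] at this
  exact this.resolve_right (f.arr.andThen_ne p)

theorem Signature.head_notMem_of_arrows_eq (hl : L.arrows K = P ++ f :: fs) : f ∉ P := fun hf => by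
  have := L.arrows_nodup K
  rw [hl, List.nodup_append] at this
  exact this.2.2 f hf f (by simp) rfl

/-- The family on `A // L` obtained from a family `a` on `K // L` by precomposing its indices with
`f : K ⟶ A`: the arguments which `a` determines for the type of its value at `f`. -/
def face (f : NHom K A) (a : Arr K → α) : Arr A → α := fun p => a (f.andThen p)

theorem map_face (F : α → β) (f : NHom K A) (a : Arr K → α) :
    (fun p => F (face f a p)) = face f fun p => F (a p) := rfl

theorem face_toArr (f : NHom K A) (g : NHom A B) (a : Arr K → α) :
    face f a g.toArr = a (f.comp g).toArr := rfl

theorem face_face (f : NHom K A) (g : NHom A B) (a : Arr K → α) :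
    face g (face f a) = face (f.comp g) a :=
  funext fun p => congrArg a (f.andThen_andThen g.toArr p).symm

theorem face_congr {a b : Arr K → α} {f : NHom K A}
    (h : ∀ p, a (f.andThen p) = b (f.andThen p)) : face f a = face f b := funext h

theorem toArr_congr {f : NHom K A} {g : NHom A B} {f' : NHom K I} {g' : NHom I B}
    (h : f.hom ≫ g.hom = f'.hom ≫ g'.hom) : (f.comp g).toArr = (f'.comp g').toArr := by
  simp [NHom.toArr, NHom.comp, h]

end

/-! ### Updating a family of terms -/

section

variable {ι : Type} (a : ι → Expr) (i : ι) (t : Expr)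

@[simp]
theorem setAt_self : setAt a i t i = t := by
  simp [setAt]

theorem setAt_of_ne {j : ι} (h : j ≠ i) : setAt a i t j = a j := by
  simp [setAt, h]

theorem subst_setAt (s : ℕ → Expr) :
    (fun j => (setAt a i t j).subst s) = setAt (fun j => (a j).subst s) i (t.subst s) := by
  funext j
  by_cases h : j = i
  · subst h; simp
  · simp [setAt_of_ne _ _ _ h]

theorem setAt_eq_of_forall_ne {b : ι → Expr} (hi : t = b i) (h : ∀ j ≠ i, a j = b j) :
    setAt a i t = b := by
  funext j
  by_cases hj : j = i
  · subst hj; simp [hi]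
  · simp [setAt_of_ne _ _ _ hj, h j hj]

theorem face_setAt {L : Signature} {K : L.Obj} (a : Arr K → Expr) {f g : Arr K} (t : Expr)
    (h : ∀ p, g.arr.andThen p ≠ f) : face g.arr (setAt a f t) = face g.arr a :=
  funext fun p => setAt_of_ne _ _ _ (h p)

end

/-! ### Universes of types of given `h`-level -/

section

variable {cl : Bool} {Γ : List Expr} {c : Expr}

@[simp]
theorem subst_typesOfHLevel (m : ℕ∞) (s : ℕ → Expr) :
    (typesOfHLevel m).subst s = typesOfHLevel m := by
  unfold typesOfHLevel
  split <;> simp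

theorem typesOfHLevel_form (m : ℕ∞) (hΓ : Der cl Γ ok) : Der cl Γ (ty (typesOfHLevel m)) := by
  have hU : Der cl Γ (ty U) := .uForm hΓ
  unfold typesOfHLevel
  split
  · exact hU
  · exact .sgForm hU (.isOfHLevelForm (.elForm (by simpa using Der.var_zero hU)))

@[simp]
theorem subst_underlying (m : ℕ∞) (c : Expr) (s : ℕ → Expr) :
    (underlying m c).subst s = underlying m (c.subst s) := by
  unfold underlying
  split <;> simp

theorem isSmall_underlying {m : ℕ∞} (hc : Der cl Γ (tm c (typesOfHLevel m))) :
    IsSmall cl Γ (underlying m c) := by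
  have hU : Der cl Γ (ty U) := .uForm hc.ctx_ok
  unfold typesOfHLevel at hc
  unfold underlying
  split_ifs at hc ⊢
  · exact .el hc
  · exact .el (.fst (.isOfHLevelForm (.elForm (by simpa using Der.var_zero hU))) hc)

theorem subst_foldl_app (l : List Expr) (c : Expr) (s : ℕ → Expr) :
    (l.foldl app c).subst s = (l.map (Expr.subst s)).foldl app (c.subst s) := by
  induction l generalizing c with
  | nil => rfl
  | cons a l ih => simp [ih]

@[simp]
theorem subst_apps (c : Expr) (l : List Expr) (s : ℕ → Expr) :
    (apps c l).subst s = apps (c.subst s) (l.map (Expr.subst s)) := by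
  cases l <;> simp [apps, subst_foldl_app]

end

namespace HSignature

variable {L : HSignature} {N N' : L.Obj → Expr} {K A B I : L.Obj} {α : Type}

/-! ### Faces of logical sorts -/

section

variable {f : NHom A B} {s t : NHom I B} {e : NHom K I} {f₁ f₂ : NHom K A}

theorem face_source_eq_target (hk : L.kind I = .iso B s t) (a : Arr I → α) :
    face s a = face t a :=
  funext fun p => congrArg a (toArr_congr ((L.iso_spec hk).2.2.2.1 p.arr))

theorem refl_source_eq_target {r : NHom K I} (hk : L.kind K = .refl B I s t r) (a : Arr K → α) :
    face r a s.toArr = face r a t.toArr :=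
  congrArg a (toArr_congr (L.refl_spec hk).2.2.2.1)

theorem transp_source (hk : L.kind K = .transp A B I f s t e f₁ f₂) (a : Arr K → α) :
    face e a s.toArr = face f₁ a f.toArr :=
  congrArg a (toArr_congr (L.transp_spec hk).2.2.2.2.2.2.1)

theorem transp_target (hk : L.kind K = .transp A B I f s t e f₁ f₂) (a : Arr K → α) :
    face e a t.toArr = face f₂ a f.toArr :=
  congrArg a (toArr_congr (L.transp_spec hk).2.2.2.2.2.2.2.1)

theorem transp_of_ne (hk : L.kind K = .transp A B I f s t e f₁ f₂) (a : Arr K → α) {g : Arr A}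
    (hg : g ≠ f.toArr) : face f₁ a g = face f₂ a g :=
  congrArg a (toArr_congr ((L.transp_spec hk).2.2.2.2.2.2.2.2.1 g.arr hg))

theorem andThen_ne_of_topLevel {L : Signature} {A B : L.Obj} {f : NHom A B} (hf : f.TopLevel)
    (g : Arr A) (p : Arr g.cod) : g.arr.andThen p ≠ f.toArr := by
  intro h
  obtain ⟨C, p⟩ := p
  simp only [NHom.andThen, NHom.toArr, Arr.mk.injEq] at h
  obtain ⟨rfl, h⟩ := h
  exact hf _ _ _ (eq_of_heq h).symm

theorem transp_face_source (hk : L.kind K = .transp A B I f s t e f₁ f₂) (a : Arr K → α) :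
    face s (face e a) = face f (face f₁ a) := by
  rw [face_face, face_face]
  exact congrArg (face · a) (by simp [NHom.comp, (L.transp_spec hk).2.2.2.2.2.2.1])

theorem transp_face_face (hk : L.kind K = .transp A B I f s t e f₁ f₂) (a : Arr K → α) :
    face f (face f₁ a) = face f (face f₂ a) :=
  funext fun p => transp_of_ne hk a
    (andThen_ne_of_topLevel (L.transp_spec hk).2.1 f.toArr p)

end

/-! ### Interpretation of sorts -/

/-- The family of types along which the sort `τ_f` transports, for `f : A ⟶ B`: the sort `A` with
arguments `a`, the one at `f` replaced by a variable. -/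
noncomputable def transpMotive (L : HSignature) {A B : L.Obj} (N : L.Obj → Expr) (f : NHom A B)
    (a : Arr A → Expr) : Expr :=
  L.interpSort (fun C => (N C).subst shift) A
    (setAt (fun p => (a p).subst shift) f.toArr (var 0))

theorem interpSort_nonlogical (hk : L.kind K = .nonlogical) (N : L.Obj → Expr)
    (a : Arr K → Expr) :
    L.interpSort N K a = underlying (L.h K) (apps (N K) ((L.arrows K).map a)) := by
  rw [interpSort, hk]

theorem interpSort_iso {s t : NHom K A} (hk : L.kind K = .iso A s t) (N : L.Obj → Expr)
    (a : Arr K → Expr) :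
    L.interpSort N K a = Id (L.interpSort N A (face s a)) (a s.toArr) (a t.toArr) := by
  rw [interpSort, hk]
  rfl

theorem interpSort_refl {s t : NHom I A} {r : NHom K I} (hk : L.kind K = .refl A I s t r)
    (N : L.Obj → Expr) (a : Arr K → Expr) :
    L.interpSort N K a =
      Id (L.interpSort N I (face r a)) (a r.toArr) (.refl (face r a s.toArr)) := by
  rw [interpSort, hk, interpSort_iso (L.refl_spec hk).1]
  rfl

theorem interpSort_transp {f : NHom A B} {s t : NHom I B} {e : NHom K I} {f₁ f₂ : NHom K A}
    (hk : L.kind K = .transp A B I f s t e f₁ f₂) (N : L.Obj → Expr) (a : Arr K → Expr) :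
    L.interpSort N K a =
      Id (L.interpSort N A (face f₂ a)) (a f₂.toArr)
        (Expr.trans (L.transpMotive N f (face f₁ a)) (face f₁ a f.toArr) (face f₂ a f.toArr)
          (a e.toArr) (a f₁.toArr)) := by
  rw [interpSort, hk]
  simp only [wk_eq]
  rfl

theorem induction_rank {P : L.Obj → Prop} (h : ∀ K, (∀ A, Nonempty (NHom K A) → P A) → P K)
    (K : L.Obj) : P K :=
  (measure L.rank).wf.induction K fun K ih => h K fun _ ⟨f⟩ => ih _ (L.rank_lt f)

@[simp]
theorem subst_interpSort (N : L.Obj → Expr) (K : L.Obj) (a : Arr K → Expr) (s : ℕ → Expr) :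
    (L.interpSort N K a).subst s =
      L.interpSort (fun A => (N A).subst s) K fun f => (a f).subst s := by
  induction K using induction_rank generalizing N s with
  | h K ih =>
    cases hk : L.kind K with
    | nonlogical => simp [interpSort_nonlogical hk, Function.comp_def]
    | iso A s t => simp [interpSort_iso hk, ih A ⟨s⟩, map_face]
    | refl A I s t r => simp [interpSort_refl hk, ih I ⟨r⟩, map_face, face_toArr]
    | transp A B I f s t e f₁ f₂ =>
      simp [interpSort_transp hk, transpMotive, ih A ⟨f₁⟩, subst_setAt, map_face, face_toArr]

theorem subst_transpMotive (N : L.Obj → Expr) (f : NHom A B) (a : Arr A → Expr) (t : Expr) :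
    (L.transpMotive N f a).subst (scons t var) = L.interpSort N A (setAt a f.toArr t) := by
  simp [transpMotive, subst_setAt]

theorem transpMotive_self (N : L.Obj → Expr) (f : NHom A B) (a : Arr A → Expr) :
    (L.transpMotive N f a).subst (scons (a f.toArr) var) = L.interpSort N A a := by
  rw [subst_transpMotive, setAt_eq_of_forall_ne _ _ _ rfl fun _ _ => rfl]

theorem transpMotive_target {f : NHom A B} {s t : NHom I B} {e : NHom K I} {f₁ f₂ : NHom K A}
    (hk : L.kind K = .transp A B I f s t e f₁ f₂) (N : L.Obj → Expr) (a : Arr K → Expr) :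
    (L.transpMotive N f (face f₁ a)).subst (scons (face f₂ a f.toArr) var) =
      L.interpSort N A (face f₂ a) := by
  rw [subst_transpMotive, setAt_eq_of_forall_ne _ _ _ rfl fun _ hp => transp_of_ne hk a hp]

/-- The sorts strictly below `K`. -/
def below (L : HSignature) (K : L.Obj) : Set L.Obj := {A | Nonempty (NHom K A)}

theorem insert_below_subset (f : NHom K A) : insert A (L.below A) ⊆ L.below K := by
  rintro C (rfl | ⟨⟨g⟩⟩)
  · exact ⟨f⟩
  · exact ⟨f.comp g⟩

theorem interpSort_congr (h : ∀ A ∈ insert K (L.below K), N A = N' A) (a : Arr K → Expr) :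
    L.interpSort N K a = L.interpSort N' K a := by
  induction K using induction_rank generalizing N N' with
  | h K ih =>
    have hb {A} (f : NHom K A) : ∀ C ∈ insert A (L.below A), N C = N' C :=
      fun C hC => h C (.inr (insert_below_subset f hC))
    cases hk : L.kind K with
    | nonlogical => simp only [interpSort_nonlogical hk, h K (Set.mem_insert _ _)]
    | iso A s t => simp only [interpSort_iso hk, ih A ⟨s⟩ (hb s)]
    | refl A I s t r => simp only [interpSort_refl hk, ih I ⟨r⟩ (hb r)]
    | transp A B I f s t e f₁ f₂ =>
      simp only [interpSort_transp hk, transpMotive, ih A ⟨f₁⟩ (hb f₁)]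
      rw [ih A ⟨f₁⟩ fun C hC => congrArg (Expr.subst shift) (hb f₁ C hC)]

theorem sortTyAux_cons (N : L.Obj → Expr) (a : Arr K → Expr) (f : Arr K) (fs : List (Arr K)) :
    L.sortTyAux K N a (f :: fs) = Pi (L.interpSort N f.cod (face f.arr a))
      (L.sortTyAux K (fun C => (N C).subst shift) (setAt (fun g => (a g).subst shift) f (var 0))
        fs) := by
  simp only [sortTyAux, wk_eq]
  rfl

@[simp]
theorem subst_sortTyAux (N : L.Obj → Expr) (a : Arr K → Expr) (fs : List (Arr K)) (s : ℕ → Expr) :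
    (L.sortTyAux K N a fs).subst s =
      L.sortTyAux K (fun A => (N A).subst s) (fun f => (a f).subst s) fs := by
  induction fs generalizing N a s with
  | nil => simp [sortTyAux]
  | cons f fs ih => simp [sortTyAux_cons, ih, subst_setAt, map_face]

theorem sortTyAux_congr (h : ∀ A ∈ L.below K, N A = N' A) (a : Arr K → Expr)
    (fs : List (Arr K)) : L.sortTyAux K N a fs = L.sortTyAux K N' a fs := by
  induction fs generalizing N N' a with
  | nil => simp [sortTyAux]
  | cons f fs ih =>
    rw [sortTyAux_cons, sortTyAux_cons, ih fun C hC => congrArg (Expr.subst shift) (h C hC),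
      interpSort_congr fun C hC => h C (insert_below_subset f.arr hC)]

@[simp]
theorem subst_sortTy (N : L.Obj → Expr) (K : L.Obj) (s : ℕ → Expr) :
    (L.sortTy N K).subst s = L.sortTy (fun A => (N A).subst s) K := by
  unfold sortTy
  split <;> simp

theorem sortTy_congr (h : ∀ A ∈ L.below K, N A = N' A) : L.sortTy N K = L.sortTy N' K := by
  unfold sortTy
  split
  · rfl
  · exact sortTyAux_congr h _ _

/-! ### Well-typed interpretations and arguments -/

variable {cl : Bool} {E Δ : List Expr}

/-- In the context `E`, the terms `N A` interpret the non-logical sorts `A` in the set `S`. -/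
structure InterpWF (L : HSignature) (cl : Bool) (E : List Expr) (N : L.Obj → Expr)
    (S : Set L.Obj) : Prop where
  ok : Der cl E ok
  interp : ∀ A ∈ S, L.kind A = .nonlogical → Der cl E (tm (N A) (L.sortTy N A))

/-- For `f` in the set `S`, the term `a f` has the type required of an argument of the sort `K` at
position `f`. -/
def ArgsWF (L : HSignature) (cl : Bool) (E : List Expr) (N : L.Obj → Expr) {K : L.Obj}
    (a : Arr K → Expr) (S : Set (Arr K)) : Prop :=
  ∀ f ∈ S, Der cl E (tm (a f) (L.interpSort N f.cod (face f.arr a)))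

namespace InterpWF

variable {S S' : Set L.Obj} {s : ℕ → Expr} {t T : Expr}

theorem mono (h : L.InterpWF cl E N S) (hS : S' ⊆ S) : L.InterpWF cl E N S' :=
  ⟨h.ok, fun A hA => h.interp A (hS hA)⟩

theorem substWF (h : L.InterpWF cl E N S) (hs : SubstWF cl Δ s E) :
    L.InterpWF cl Δ (fun A => (N A).subst s) S :=
  ⟨hs.ok, fun A hA hk => by simpa using (h.interp A hA hk).substWF hs⟩

theorem weaken (h : L.InterpWF cl E N S) (hT : Der cl E (ty T)) :
    L.InterpWF cl (T :: E) (fun A => (N A).subst shift) S :=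
  h.substWF (.shift hT)

theorem setAt (h : L.InterpWF cl E N S) (hK : ∀ A ∈ insert K S, K ∉ L.below A)
    (ht : Der cl E (tm t (L.sortTy N K))) : L.InterpWF cl E (setAt N K t) (insert K S) where
  ok := h.ok
  interp A hA hk := by
    rw [sortTy_congr fun C hC => setAt_of_ne N K t fun h => hK A hA (h ▸ hC)]
    by_cases hAK : A = K
    · subst hAK
      rwa [setAt_self]
    · rw [setAt_of_ne _ _ _ hAK]
      exact h.interp A (hA.resolve_left hAK) hk

end InterpWF

namespace ArgsWF

variable {a b : Arr K → Expr} {S S' : Set (Arr K)} {f : Arr K} {P fs : List (Arr K)} {t T : Expr}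

theorem mono (h : L.ArgsWF cl E N a S) (hS : S' ⊆ S) : L.ArgsWF cl E N a S' :=
  fun f hf => h f (hS hf)

theorem weaken (h : L.ArgsWF cl E N a S) (hT : Der cl E (ty T)) :
    L.ArgsWF cl (T :: E) (fun A => (N A).subst shift) (fun f => (a f).subst shift) S :=
  fun f hf => by simpa [map_face] using (h f hf).weaken hT

theorem face {f : NHom K A} (h : L.ArgsWF cl E N a S) (hf : ∀ p, f.andThen p ∈ S) :
    L.ArgsWF cl E N (face f a) Set.univ := fun p _ => by
  rw [face_face]
  exact h (f.andThen p) (hf p)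

theorem face_univ (h : L.ArgsWF cl E N a Set.univ) (f : NHom K A) :
    L.ArgsWF cl E N (FOLIso.face f a) Set.univ :=
  h.face fun _ => trivial

theorem toArr (h : L.ArgsWF cl E N a Set.univ) (f : NHom K A) :
    Der cl E (tm (a f.toArr) (L.interpSort N A (FOLIso.face f a))) :=
  h f.toArr trivial

theorem setAt (h : L.ArgsWF cl E N a S) (hf : ∀ g ∈ insert f S, ∀ p, g.arr.andThen p ≠ f)
    (ht : Der cl E (tm t (L.interpSort N f.cod (FOLIso.face f.arr a)))) :
    L.ArgsWF cl E N (setAt a f t) (insert f S) := fun g hg => by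
  rw [face_setAt a t (hf g hg)]
  by_cases hgf : g = f
  · subst hgf
    rwa [setAt_self]
  · rw [setAt_of_ne _ _ _ hgf]
    exact h g (hg.resolve_left hgf)

theorem setAt_head (hl : L.arrows K = P ++ f :: fs) (h : L.ArgsWF cl E N a {g | g ∈ P})
    (ht : Der cl E (tm t (L.interpSort N f.cod (FOLIso.face f.arr a)))) :
    L.ArgsWF cl E N (FOLIso.setAt a f t) {g | g ∈ P ++ [f]} := by
  refine (h.setAt ?_ ht).mono fun g hg => by simpa [or_comm] using hg
  rintro g (rfl | hg) p
  · exact g.arr.andThen_ne p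
  · exact fun h => L.head_notMem_of_arrows_eq hl (h ▸ L.andThen_mem_of_arrows_eq hl hg p)

theorem congr (hl : L.arrows K = P ++ fs) (h : L.ArgsWF cl E N a {g | g ∈ P})
    (hab : ∀ g ∈ P, a g = b g) : L.ArgsWF cl E N b {g | g ∈ P} := fun g hg => by
  rw [← hab g hg, ← face_congr fun p => hab _ (L.andThen_mem_of_arrows_eq hl hg p)]
  exact h g hg

end ArgsWF

/-- Well-typed arguments of the sort `K` yield a small type. -/
def SortFormWF (L : HSignature) (cl : Bool) (K : L.Obj) : Prop :=
  ∀ ⦃E : List Expr⦄ ⦃N : L.Obj → Expr⦄ ⦃a : Arr K → Expr⦄,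
    L.InterpWF cl E N (insert K (L.below K)) → L.ArgsWF cl E N a Set.univ →
    IsSmall cl E (L.interpSort N K a)

/-! ### The types of interpretations of sorts -/

section

variable {a a₀ : Arr K → Expr} {f : Arr K} {P fs : List (Arr K)} {c : Expr}

theorem sortTyAux_domain_form (ih : ∀ A ∈ L.below K, L.SortFormWF cl A)
    (hl : L.arrows K = P ++ f :: fs) (hN : L.InterpWF cl E N (L.below K))
    (ha : L.ArgsWF cl E N a {g | g ∈ P}) :
    Der cl E (ty (L.interpSort N f.cod (face f.arr a))) :=
  (ih f.cod ⟨f.arr⟩ (hN.mono (insert_below_subset f.arr))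
    (ha.face (L.andThen_head_mem_of_arrows_eq hl))).form

theorem sortTyAux_form (ih : ∀ A ∈ L.below K, L.SortFormWF cl A) (hl : L.arrows K = P ++ fs)
    (hN : L.InterpWF cl E N (L.below K)) (ha : L.ArgsWF cl E N a {g | g ∈ P}) :
    Der cl E (ty (L.sortTyAux K N a fs)) := by
  induction fs generalizing P E N a with
  | nil => exact typesOfHLevel_form _ hN.ok
  | cons f fs ihfs =>
    have hf := sortTyAux_domain_form ih hl hN ha
    rw [sortTyAux_cons]
    exact .piForm hf (ihfs (P := P ++ [f]) (by simp [hl]) (hN.weaken hf)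
      ((ha.weaken hf).setAt_head hl (by simpa [map_face] using Der.var_zero hf)))

theorem sortTy_form (ih : ∀ A ∈ L.below K, L.SortFormWF cl A)
    (hN : L.InterpWF cl E N (L.below K)) : Der cl E (ty (L.sortTy N K)) := by
  unfold sortTy
  split
  · exact .arrowForm (.oneForm hN.ok) (typesOfHLevel_form _ hN.ok)
  · next h => exact sortTyAux_form (P := []) ih h hN fun f hf => absurd hf List.not_mem_nil

theorem app_sortTyAux (ih : ∀ A ∈ L.below K, L.SortFormWF cl A) (hl : L.arrows K = P ++ f :: fs)
    (hN : L.InterpWF cl E N (L.below K)) (ha : L.ArgsWF cl E N a {g | g ∈ P})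
    (hc : Der cl E (tm c (L.sortTyAux K N a (f :: fs)))) {t : Expr}
    (ht : Der cl E (tm t (L.interpSort N f.cod (face f.arr a)))) :
    Der cl E (tm (app c t) (L.sortTyAux K N (setAt a f t) fs)) := by
  have hf := sortTyAux_domain_form ih hl hN ha
  have hbody := sortTyAux_form (P := P ++ [f]) (fs := fs) ih (by simp [hl]) (hN.weaken hf)
    ((ha.weaken hf).setAt_head hl (by simpa [map_face] using Der.var_zero hf))
  rw [sortTyAux_cons] at hc
  simpa [subst_setAt] using Der.app hbody hc ht

theorem foldl_app_form (ih : ∀ A ∈ L.below K, L.SortFormWF cl A) (hl : L.arrows K = P ++ fs)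
    (hN : L.InterpWF cl E N (L.below K)) (ha : L.ArgsWF cl E N a Set.univ)
    (haa : ∀ g ∈ P, a g = a₀ g) (hc : Der cl E (tm c (L.sortTyAux K N a₀ fs))) :
    Der cl E (tm ((fs.map a).foldl app c) (typesOfHLevel (L.h K))) := by
  induction fs generalizing P a₀ c with
  | nil => simpa [sortTyAux] using hc
  | cons f fs ihfs =>
    have ha₀ : L.ArgsWF cl E N a₀ {g | g ∈ P} := (ha.mono (Set.subset_univ _)).congr hl haa
    have hf : face f.arr a = face f.arr a₀ :=
      face_congr fun p => haa _ (L.andThen_head_mem_of_arrows_eq hl p)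
    have happ := app_sortTyAux ih hl hN ha₀ hc (hf ▸ ha f trivial)
    refine ihfs (P := P ++ [f]) (a₀ := setAt a₀ f (a f)) (by simp [hl]) ?_ happ
    intro g hg
    by_cases hgf : g = f
    · subst hgf
      rw [setAt_self]
    · rw [setAt_of_ne _ _ _ hgf]
      exact haa g (by simpa [hgf] using hg)

theorem apps_form (ih : ∀ A ∈ L.below K, L.SortFormWF cl A) (hN : L.InterpWF cl E N (L.below K))
    (ha : L.ArgsWF cl E N a Set.univ) (hc : Der cl E (tm c (L.sortTy N K))) :
    Der cl E (tm (apps c ((L.arrows K).map a)) (typesOfHLevel (L.h K))) := by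
  unfold sortTy at hc
  split at hc
  · next h =>
    rw [h]
    exact .app_arrow (typesOfHLevel_form _ hN.ok) hc (.star hN.ok) (.oneForm hN.ok)
  · next h =>
    have := foldl_app_form (P := []) ih h hN ha (fun g hg => absurd hg List.not_mem_nil) hc
    rw [h]
    exact this

end

/-! ### Formation of sorts -/

section

variable {a : Arr K → Expr}

theorem isSmall_iso {s t : NHom K A} (hk : L.kind K = .iso A s t) (ih : L.SortFormWF cl A)
    (hN : L.InterpWF cl E N (L.below K)) (ha : L.ArgsWF cl E N a Set.univ) :
    IsSmall cl E (L.interpSort N K a) := by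
  rw [interpSort_iso hk]
  exact (ih (hN.mono (insert_below_subset s)) (ha.face_univ s)).id (ha.toArr s)
    (face_source_eq_target hk a ▸ ha.toArr t)

theorem isSmall_refl {s t : NHom I A} {r : NHom K I} (hk : L.kind K = .refl A I s t r)
    (ih : L.SortFormWF cl I) (hN : L.InterpWF cl E N (L.below K))
    (ha : L.ArgsWF cl E N a Set.univ) : IsSmall cl E (L.interpSort N K a) := by
  have hrefl : Der cl E (tm (.refl (face r a s.toArr)) (L.interpSort N I (face r a))) := by
    rw [interpSort_iso (L.refl_spec hk).1, ← refl_source_eq_target hk]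
    exact .refl ((ha.face_univ r).toArr s)
  rw [interpSort_refl hk]
  exact (ih (hN.mono (insert_below_subset r)) (ha.face_univ r)).id (ha.toArr r) hrefl

theorem transpMotive_form {f : NHom A B} {b : Arr A → Expr} (hf : f.TopLevel)
    (hA : L.SortFormWF cl A) (hN : L.InterpWF cl E N (insert A (L.below A)))
    (hb : L.ArgsWF cl E N b Set.univ) (hB : Der cl E (ty (L.interpSort N B (face f b)))) :
    Der cl (L.interpSort N B (face f b) :: E) (ty (L.transpMotive N f b)) := by
  refine (hA (hN.weaken hB) ?_).form
  refine ((hb.weaken hB).setAt (f := f.toArr) (fun g _ p => ?_) ?_).mono (Set.subset_insert _ _)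
  · exact andThen_ne_of_topLevel hf g p
  · have := Der.var_zero hB
    rwa [subst_interpSort] at this

theorem isSmall_transp {f : NHom A B} {s t : NHom I B} {e : NHom K I} {f₁ f₂ : NHom K A}
    (hk : L.kind K = .transp A B I f s t e f₁ f₂) (hA : L.SortFormWF cl A)
    (hB : L.SortFormWF cl B) (hN : L.InterpWF cl E N (L.below K))
    (ha : L.ArgsWF cl E N a Set.univ) : IsSmall cl E (L.interpSort N K a) := by
  have hNA := hN.mono (insert_below_subset f₁)
  have hP := transpMotive_form (L.transp_spec hk).2.1 hA hNA (ha.face_univ f₁)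
    (hB (hN.mono (insert_below_subset (f₁.comp f))) ((ha.face_univ f₁).face_univ f)).form
  have hx₁ := (ha.face_univ f₁).toArr f
  have hx₂ := (ha.face_univ f₂).toArr f
  have he := ha.toArr e
  rw [← transp_face_face hk] at hx₂
  rw [interpSort_iso (L.transp_spec hk).1, transp_face_source hk, transp_source hk,
    transp_target hk] at he
  have htr := Der.trans hx₁ hx₂ he hP (by rw [transpMotive_self]; exact ha.toArr f₁)
  rw [transpMotive_target hk] at htr
  rw [interpSort_transp hk]
  exact (hA hNA (ha.face_univ f₂)).id (ha.toArr f₂) htr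

theorem sortFormWF (cl : Bool) (K : L.Obj) : L.SortFormWF cl K := by
  induction K using induction_rank with
  | h K ih =>
    intro E N a hN ha
    have hN' := hN.mono (Set.subset_insert K (L.below K))
    cases hk : L.kind K with
    | nonlogical =>
      rw [interpSort_nonlogical hk]
      exact isSmall_underlying (apps_form ih hN' ha (hN.interp K (Set.mem_insert _ _) hk))
    | iso A s t => exact isSmall_iso hk (ih A ⟨s⟩) hN' ha
    | refl A I s t r => exact isSmall_refl hk (ih I ⟨r⟩) hN' ha
    | transp A B I f s t e f₁ f₂ =>
      exact isSmall_transp hk (ih A ⟨f₁⟩) (ih B ⟨f₁.comp f⟩) hN' ha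

end

/-! ### Structures -/

section

variable {P Ks : List L.Obj} {M t : Expr}

theorem mem_of_mem_below (hl : L.sorts = P ++ K :: Ks) (hA : A ∈ L.below K)
    (hk : L.kind A = .nonlogical) : A ∈ P := by
  obtain ⟨f⟩ := hA
  have hm := L.mem_sorts.2 hk
  have ho := L.sorts_ordered
  rw [hl, List.pairwise_append, List.pairwise_cons] at ho
  rw [hl, List.mem_append, List.mem_cons] at hm
  rcases hm with hm | rfl | hm
  · exact hm
  · exact absurd rfl f.ne
  · exact absurd (L.lt_of_arr f) (ho.2.1.1 A hm)

theorem notMem_below (hl : L.sorts = P ++ K :: Ks) (hA : A ∈ insert K {A | A ∈ P}) :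
    K ∉ L.below A := by
  rintro ⟨f⟩
  have ho := L.sorts_ordered
  rw [hl, List.pairwise_append] at ho
  rcases hA with rfl | hA
  · exact f.ne rfl
  · exact ho.2.2 A hA K (by simp) (L.lt_of_arr f)

theorem InterpWF.sortTy_form (h : L.InterpWF cl E N {A | A ∈ P}) (hl : L.sorts = P ++ K :: Ks) :
    Der cl E (ty (L.sortTy N K)) :=
  HSignature.sortTy_form (fun A _ => sortFormWF cl A)
    ⟨h.ok, fun A hA hk => h.interp A (mem_of_mem_below hl hA hk) hk⟩

theorem InterpWF.setAt_head (h : L.InterpWF cl E N {A | A ∈ P}) (hl : L.sorts = P ++ K :: Ks)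
    (ht : Der cl E (tm t (L.sortTy N K))) :
    L.InterpWF cl E (FOLIso.setAt N K t) {A | A ∈ P ++ [K]} :=
  (h.setAt (fun _ hA => notMem_below hl hA) ht).mono fun A hA => by simpa [or_comm] using hA

theorem strucTyAux_cons_cons (N : L.Obj → Expr) (K K' : L.Obj) (Ks : List L.Obj) :
    L.strucTyAux N (K :: K' :: Ks) = Sg (L.sortTy N K)
      (L.strucTyAux (setAt (fun A => (N A).subst shift) K (var 0)) (K' :: Ks)) := by
  simp only [strucTyAux, wk_eq]

@[simp]
theorem subst_strucTyAux (N : L.Obj → Expr) (Ks : List L.Obj) (s : ℕ → Expr) :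
    (L.strucTyAux N Ks).subst s = L.strucTyAux (fun A => (N A).subst s) Ks := by
  induction Ks generalizing N s with
  | nil => simp [strucTyAux]
  | cons K Ks ih =>
    cases Ks with
    | nil => simp [strucTyAux]
    | cons K' Ks => simp [strucTyAux_cons_cons, ih, subst_setAt]

theorem InterpWF.strucTyAux_form (h : L.InterpWF cl E N {A | A ∈ P}) (hl : L.sorts = P ++ Ks) :
    Der cl E (ty (L.strucTyAux N Ks)) := by
  induction Ks generalizing P E N with
  | nil => exact .oneForm h.ok
  | cons K Ks ih =>
    have hK := h.sortTy_form hl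
    cases Ks with
    | nil => exact hK
    | cons K' Ks =>
      rw [strucTyAux_cons_cons]
      exact .sgForm hK (ih ((h.weaken hK).setAt_head hl (by simpa using Der.var_zero hK))
        (by simp [hl]))

theorem InterpWF.projAux (h : L.InterpWF cl E N {A | A ∈ P}) (hl : L.sorts = P ++ Ks)
    (hM : Der cl E (tm M (L.strucTyAux N Ks))) :
    L.InterpWF cl E (L.projAux N Ks M) {A | A ∈ P ++ Ks} := by
  induction Ks generalizing P N M with
  | nil => simpa [HSignature.projAux] using h
  | cons K Ks ih =>
    have hK := h.sortTy_form hl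
    cases Ks with
    | nil => exact h.setAt_head hl hM
    | cons K' Ks =>
      rw [strucTyAux_cons_cons] at hM
      have hS := ((h.weaken hK).setAt_head hl (by simpa using Der.var_zero hK)).strucTyAux_form
        (Ks := K' :: Ks) (by simp [hl])
      have hsnd := Der.snd hS hM
      rw [subst_strucTyAux, subst_setAt] at hsnd
      have := ih (h.setAt_head hl (.fst hS hM)) (by simp [hl]) (by simpa using hsnd)
      simpa [HSignature.projAux] using this

theorem IsStructure.interpWF (hM : L.IsStructure cl E M) :
    L.InterpWF cl E (L.proj M) Set.univ where
  ok := hM.ctx_ok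
  interp A _ hk :=
    (InterpWF.projAux (P := []) ⟨hM.ctx_ok, fun _ hA => absurd hA List.not_mem_nil⟩ rfl hM).interp
      A (L.mem_sorts.2 hk) hk

end

end HSignature

end FOLIso
/-! ### Contexts and context morphisms -/

namespace FOLIso

open HoTT HoTT.Expr HoTT.Jdg

section

variable {L : Signature} {Γ Δ : Ctx L} {K K' : SortExpr L} {φ : Form L} {x : ℕ} {r : ℕ → ℕ}

theorem HasSort.lt_length (h : HasSort Γ x K) : x < Γ.length := by
  obtain ⟨K₀, h, -⟩ := h
  exact (List.getElem?_eq_some_iff.1 h).1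

theorem hasSort_zero : HasSort (K :: Γ) 0 (K.rename Nat.succ) := ⟨K, rfl, rfl⟩

theorem HasSort.succ (h : HasSort Γ x K) : HasSort (K' :: Γ) (x + 1) (K.rename Nat.succ) := by
  obtain ⟨K₀, h, rfl⟩ := h
  exact ⟨K₀, h, rfl⟩

theorem HasSort.cases_cons (h : HasSort (K' :: Γ) x K) :
    (x = 0 ∧ K = K'.rename Nat.succ) ∨
      ∃ y K₀, x = y + 1 ∧ K = K₀.rename Nat.succ ∧ HasSort Γ y K₀ := by
  obtain ⟨K₀, h, rfl⟩ := h
  cases x with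
  | zero =>
    obtain rfl : K' = K₀ := Option.some.inj h
    exact .inl ⟨rfl, rfl⟩
  | succ y => exact .inr ⟨y, K₀.rename (· + (y + 1)), rfl, rfl, K₀, h, rfl⟩

theorem HasSort.eq_of_zero (h : HasSort (K' :: Γ) 0 K) : K = K'.rename Nat.succ := by
  obtain ⟨K₀, h, rfl⟩ := h
  rw [← Option.some.inj h]

namespace CtxMor

theorem succ (K : SortExpr L) : CtxMor (K :: Γ) Γ Nat.succ := fun _ _ h => h.succ

theorem lift (h : CtxMor Γ Δ r) (K : SortExpr L) :
    CtxMor (K.rename r :: Γ) (K :: Δ) (liftR r) := by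
  intro x K' hx
  rcases hx.cases_cons with ⟨rfl, rfl⟩ | ⟨y, K₀, rfl, rfl, hy⟩
  · exact hasSort_zero
  · exact (h y K₀ hy).succ

theorem swap01 (K K' : SortExpr L) :
    CtxMor (K.rename Nat.succ :: K' :: Γ) (K'.rename Nat.succ :: K :: Γ) swap01 := by
  intro x K₁ hx
  rcases hx.cases_cons with ⟨rfl, rfl⟩ | ⟨y, K₀, rfl, rfl, hy⟩
  · exact hasSort_zero.succ
  rcases hy.cases_cons with ⟨rfl, rfl⟩ | ⟨z, K₀, rfl, rfl, hz⟩
  · exact hasSort_zero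
  · exact hz.succ.succ

theorem renameTele (h : CtxMor Γ Δ r) (Γ' : Ctx L) :
    CtxMor (renameTele r Γ' ++ Γ) (Γ' ++ Δ) (liftN r Γ'.length) := by
  induction Γ' with
  | nil => exact h
  | cons K Γ' ih => exact ih.lift K

end CtxMor

theorem SortWF.rename (hK : SortWF Δ K) (h : CtxMor Γ Δ r) : SortWF Γ (K.rename r) :=
  fun f => h _ _ (hK f)

theorem FormWF.rename (hφ : FormWF Δ φ) (h : CtxMor Γ Δ r) : FormWF Γ (φ.rename r) := by
  induction φ generalizing Γ Δ r with
  | bot => trivial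
  | top => trivial
  | and φ ψ ih₁ ih₂ => exact ⟨ih₁ hφ.1 h, ih₂ hφ.2 h⟩
  | or φ ψ ih₁ ih₂ => exact ⟨ih₁ hφ.1 h, ih₂ hφ.2 h⟩
  | imp φ ψ ih₁ ih₂ => exact ⟨ih₁ hφ.1 h, ih₂ hφ.2 h⟩
  | all K φ ih => exact ⟨hφ.1.rename h, ih hφ.2 (h.lift K)⟩
  | ex K φ ih => exact ⟨hφ.1.rename h, ih hφ.2 (h.lift K)⟩

theorem FormWF.wk (hφ : FormWF Γ φ) (K : SortExpr L) : FormWF (K :: Γ) φ.wk :=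
  hφ.rename (.succ K)

theorem CtxWF.renameTele {Γ' : Ctx L} (h : CtxMor Γ Δ r) (hΓ : CtxWF Γ) (hΔ : CtxWF (Γ' ++ Δ)) :
    CtxWF (renameTele r Γ' ++ Γ) := by
  induction Γ' with
  | nil => exact hΓ
  | cons K Γ' ih => exact ⟨ih hΔ.1, hΔ.2.rename (h.renameTele Γ')⟩

theorem CtxWF.of_append {Γ' : Ctx L} (h : CtxWF (Γ' ++ Γ)) : CtxWF Γ := by
  induction Γ' with
  | nil => exact h
  | cons _ _ ih => exact ih h.1

theorem Sequent.WF.exchange {Γ' : Ctx L} {φ ψ : Form L}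
    (h : (Sequent.mk (Γ' ++ K'.rename Nat.succ :: K :: Γ) φ ψ).WF) (hK : SortWF Γ K)
    (hK' : SortWF Γ K') :
    (Sequent.mk (renameTele FOLIso.swap01 Γ' ++ K.rename Nat.succ :: K' :: Γ)
      (φ.rename (liftN FOLIso.swap01 Γ'.length)) (ψ.rename (liftN FOLIso.swap01 Γ'.length))).WF :=
  have hm := CtxMor.swap01 (Γ := Γ) K K'
  have hΓ : CtxWF Γ := h.1.of_append.1.1
  ⟨.renameTele hm ⟨⟨hΓ, hK'⟩, hK.rename (.succ K')⟩ h.1, h.2.1.rename (hm.renameTele Γ'),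
    h.2.2.rename (hm.renameTele Γ')⟩

end

theorem Entails.wf {L : HSignature} {cl : Bool} {T : Theory L.toSignature}
    {σ : Sequent L.toSignature} (h : Entails L cl T σ) : σ.WF := by
  induction h with
  | ax h => exact T.wf _ h
  | sub hΓ hr _ ih => exact ⟨hΓ, ih.2.1.rename hr, ih.2.2.rename hr⟩
  | cut _ _ ih₁ ih₂ => exact ⟨ih₁.1, ih₁.2.1, ih₂.2.2⟩
  | conWk hK _ ih => exact ⟨⟨ih.1, hK⟩, ih.2.1.wk _, ih.2.2.wk _⟩
  | conExch hK hK' _ ih => exact ih.exchange hK hK'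
  | andIntro _ _ ih₁ ih₂ => exact ⟨ih₁.1, ih₁.2.1, ih₁.2.2, ih₂.2.2⟩
  | andLeft _ ih => exact ⟨ih.1, ih.2.1, ih.2.2.1⟩
  | andRight _ ih => exact ⟨ih.1, ih.2.1, ih.2.2.2⟩
  | orElim _ _ ih₁ ih₂ => exact ⟨ih₁.1, ⟨ih₁.2.1, ih₂.2.1⟩, ih₁.2.2⟩
  | orLeft _ ih => exact ⟨ih.1, ih.2.1.1, ih.2.2⟩
  | orRight _ ih => exact ⟨ih.1, ih.2.1.2, ih.2.2⟩
  | impIntro _ ih => exact ⟨ih.1, ih.2.1.1, ih.2.1.2, ih.2.2⟩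
  | impElim _ ih => exact ⟨ih.1, ⟨ih.2.1, ih.2.2.1⟩, ih.2.2.2⟩
  | allIntro hθ _ ih => exact ⟨ih.1.1, hθ, ih.1.2, ih.2.2⟩
  | allElim _ ih => exact ⟨⟨ih.1, ih.2.2.1⟩, ih.2.1.wk _, ih.2.2.2⟩
  | exElim hθ _ ih => exact ⟨ih.1.1, ⟨ih.1.2, ih.2.1⟩, hθ⟩
  | exIntro _ ih => exact ⟨⟨ih.1, ih.2.1.1⟩, ih.2.1.2, ih.2.2.wk _⟩
  | _ => assumption

/-! ### Interpretation of formulas -/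

namespace HSignature

variable {L : HSignature} {cl : Bool} {E E' : List Expr} {N : L.Obj → Expr} {v v' s : ℕ → Expr}
  {Γ Δ : Ctx L.toSignature} {K : SortExpr L.toSignature} {φ : Form L.toSignature} {t T : Expr}

/-- The type `⟦K_f(x_{pf})_p⟧` interpreting a sort expression, where `v` assigns terms to its
variables. -/
noncomputable def interpSortExpr (L : HSignature) (N : L.Obj → Expr) (v : ℕ → Expr)
    (K : SortExpr L.toSignature) : Expr :=
  L.interpSort N K.head fun f => v (K.args f)

@[simp]
theorem subst_interpSortExpr (N : L.Obj → Expr) (v : ℕ → Expr) (K : SortExpr L.toSignature)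
    (s : ℕ → Expr) : (L.interpSortExpr N v K).subst s =
      L.interpSortExpr (fun A => (N A).subst s) (comp v s) K :=
  subst_interpSort _ _ _ _

theorem interpSortExpr_congr (hK : SortWF Γ K) (h : ∀ i < Γ.length, v i = v' i) :
    L.interpSortExpr N v K = L.interpSortExpr N v' K :=
  congrArg (L.interpSort N K.head) (funext fun f => h _ (hK f).lt_length)

@[simp]
theorem subst_interpForm (N : L.Obj → Expr) (v : ℕ → Expr) (φ : Form L.toSignature)
    (s : ℕ → Expr) :
    (L.interpForm N v φ).subst s = L.interpForm (fun A => (N A).subst s) (comp v s) φ := by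
  induction φ generalizing N v s with
  | bot => simp [interpForm]
  | top => simp [interpForm]
  | and φ ψ ih₁ ih₂ => simp [interpForm, ih₁, ih₂]
  | or φ ψ ih₁ ih₂ => simp [interpForm, ih₁, ih₂]
  | imp φ ψ ih₁ ih₂ => simp [interpForm, ih₁, ih₂]
  | all K φ ih => simp [interpForm, ih]
  | ex K φ ih => simp [interpForm, ih]

theorem interpForm_all (N : L.Obj → Expr) (v : ℕ → Expr) (K : SortExpr L.toSignature)
    (φ : Form L.toSignature) : L.interpForm N v (.all K φ) = Pi (L.interpSortExpr N v K)
      (L.interpForm (fun A => (N A).subst shift) (scons (var 0) (comp v shift)) φ) := by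
  simp only [interpForm, interpSortExpr, wk_eq, liftS_eq]

theorem interpForm_ex (N : L.Obj → Expr) (v : ℕ → Expr) (K : SortExpr L.toSignature)
    (φ : Form L.toSignature) : L.interpForm N v (.ex K φ) = Tr (Sg (L.interpSortExpr N v K)
      (L.interpForm (fun A => (N A).subst shift) (scons (var 0) (comp v shift)) φ)) := by
  simp only [interpForm, interpSortExpr, wk_eq, liftS_eq]

theorem interpForm_rename (N : L.Obj → Expr) (v : ℕ → Expr) (φ : Form L.toSignature)
    (r : ℕ → ℕ) : L.interpForm N v (φ.rename r) = L.interpForm N (fun i => v (r i)) φ := by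
  induction φ generalizing N v r with
  | bot => rfl
  | top => rfl
  | and φ ψ ih₁ ih₂ => simp only [interpForm, Form.rename, ih₁, ih₂]
  | or φ ψ ih₁ ih₂ => simp only [interpForm, Form.rename, ih₁, ih₂]
  | imp φ ψ ih₁ ih₂ => simp only [interpForm, Form.rename, ih₁, ih₂]
  | all K φ ih => simp only [interpForm, Form.rename, ih, liftS_liftR]; rfl
  | ex K φ ih => simp only [interpForm, Form.rename, ih, liftS_liftR]; rfl

theorem interpForm_wk (N : L.Obj → Expr) (v : ℕ → Expr) (φ : Form L.toSignature) :
    L.interpForm N v φ.wk = L.interpForm N (comp shift v) φ :=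
  interpForm_rename N v φ Nat.succ

theorem interpForm_congr (hφ : FormWF Γ φ) (h : ∀ i < Γ.length, v i = v' i) :
    L.interpForm N v φ = L.interpForm N v' φ := by
  have hlift {v v' : ℕ → Expr} {Γ : Ctx L.toSignature} (K) (h : ∀ i < Γ.length, v i = v' i) :
      ∀ i < (K :: Γ).length, scons (var 0) (comp v shift) i = scons (var 0) (comp v' shift) i := by
    rintro (_ | i) hi
    · rfl
    · exact congrArg (Expr.subst shift) (h i (Nat.lt_of_succ_lt_succ hi))
  induction φ generalizing N v v' Γ with
  | bot => rfl
  | top => rfl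
  | and φ ψ ih₁ ih₂ => simp only [interpForm, ih₁ hφ.1 h, ih₂ hφ.2 h]
  | or φ ψ ih₁ ih₂ => simp only [interpForm, ih₁ hφ.1 h, ih₂ hφ.2 h]
  | imp φ ψ ih₁ ih₂ => simp only [interpForm, ih₁ hφ.1 h, ih₂ hφ.2 h]
  | all K φ ih =>
    rw [interpForm_all, interpForm_all, interpSortExpr_congr hφ.1 h, ih hφ.2 (hlift K h)]
  | ex K φ ih =>
    rw [interpForm_ex, interpForm_ex, interpSortExpr_congr hφ.1 h, ih hφ.2 (hlift K h)]

/-- In the context `E`, the terms `N A` interpret the non-logical sorts and the terms `v x`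
interpret the variables of `Γ`. -/
structure ValWF (L : HSignature) (cl : Bool) (E : List Expr) (N : L.Obj → Expr) (v : ℕ → Expr)
    (Γ : Ctx L.toSignature) : Prop where
  interp : L.InterpWF cl E N Set.univ
  var : ∀ {x K}, HasSort Γ x K → Der cl E (tm (v x) (L.interpSortExpr N v K))

namespace ValWF

theorem argsWF (hv : L.ValWF cl E N v Γ) (hK : SortWF Γ K) :
    L.ArgsWF cl E N (fun f => v (K.args f)) Set.univ := fun f _ => hv.var (hK f)

theorem rename {r : ℕ → ℕ} (hv : L.ValWF cl E N v Γ) (hr : CtxMor Γ Δ r) :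
    L.ValWF cl E N (fun i => v (r i)) Δ := ⟨hv.interp, fun hx => hv.var (hr _ _ hx)⟩

theorem tail (hv : L.ValWF cl E N v (K :: Γ)) : L.ValWF cl E N (comp shift v) Γ :=
  hv.rename (.succ K)

theorem head (hv : L.ValWF cl E N v (K :: Γ)) :
    Der cl E (tm (v 0) (L.interpSortExpr N (comp shift v) K)) := hv.var hasSort_zero

theorem substWF (hv : L.ValWF cl E N v Γ) (hs : SubstWF cl E' s E) :
    L.ValWF cl E' (fun A => (N A).subst s) (comp v s) Γ where
  interp := hv.interp.substWF hs
  var hx := by simpa using (hv.var hx).substWF hs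

theorem weaken (hv : L.ValWF cl E N v Γ) (hT : Der cl E (ty T)) :
    L.ValWF cl (T :: E) (fun A => (N A).subst shift) (comp v shift) Γ :=
  hv.substWF (.shift hT)

theorem scons (hv : L.ValWF cl E N v Γ) (ht : Der cl E (tm t (L.interpSortExpr N v K))) :
    L.ValWF cl E N (scons t v) (K :: Γ) := by
  refine ⟨hv.interp, fun hx => ?_⟩
  rcases hx.cases_cons with ⟨rfl, rfl⟩ | ⟨y, K₀, rfl, rfl, hy⟩
  · exact ht
  · exact hv.var hy

theorem lift (hv : L.ValWF cl E N v Γ) (hK : Der cl E (ty (L.interpSortExpr N v K))) :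
    L.ValWF cl (L.interpSortExpr N v K :: E) (fun A => (N A).subst shift)
      (Expr.scons (.var 0) (comp v shift)) (K :: Γ) :=
  (hv.weaken hK).scons (by simpa using Der.var_zero hK)

theorem isSmall_sort (hv : L.ValWF cl E N v Γ) (hK : SortWF Γ K) :
    IsSmall cl E (L.interpSortExpr N v K) :=
  sortFormWF cl K.head (hv.interp.mono (Set.subset_univ _)) (hv.argsWF hK)

theorem sort_form (hv : L.ValWF cl E N v Γ) (hK : SortWF Γ K) :
    Der cl E (ty (L.interpSortExpr N v K)) :=
  (hv.isSmall_sort hK).form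

theorem isSmall_form (hv : L.ValWF cl E N v Γ) (hφ : FormWF Γ φ) :
    IsSmall cl E (L.interpForm N v φ) := by
  induction φ generalizing E N v Γ with
  | bot => exact .zero hv.interp.ok
  | top => exact .one hv.interp.ok
  | and φ ψ ih₁ ih₂ => exact .prod (ih₁ hv hφ.1) (ih₂ hv hφ.2)
  | or φ ψ ih₁ ih₂ => exact .tr (.sum (ih₁ hv hφ.1) (ih₂ hv hφ.2))
  | imp φ ψ ih₁ ih₂ => exact .arrow (ih₁ hv hφ.1) (ih₂ hv hφ.2)
  | all K φ ih =>
    have hK := hv.isSmall_sort hφ.1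
    rw [interpForm_all]
    exact hK.pi (ih (hv.lift hK.form) hφ.2)
  | ex K φ ih =>
    have hK := hv.isSmall_sort hφ.1
    rw [interpForm_ex]
    exact (hK.sg (ih (hv.lift hK.form) hφ.2)).tr

theorem form (hv : L.ValWF cl E N v Γ) (hφ : FormWF Γ φ) : Der cl E (ty (L.interpForm N v φ)) :=
  (hv.isSmall_form hφ).form

theorem isProp (hv : L.ValWF cl E N v Γ) (hφ : FormWF Γ φ) :
    Inh cl E (isProp (L.interpForm N v φ)) := by
  induction φ generalizing E N v Γ with
  | bot => exact .isProp_zero hv.interp.ok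
  | top => exact .isProp_one hv.interp.ok
  | and φ ψ ih₁ ih₂ =>
    exact .isProp_prod (hv.form hφ.1) (hv.form hφ.2) (ih₁ hv hφ.1) (ih₂ hv hφ.2)
  | or φ ψ => exact .isProp_tr (.sumForm (hv.form hφ.1) (hv.form hφ.2))
  | imp φ ψ _ ih => exact .isProp_arrow (hv.form hφ.1) (hv.form hφ.2) (ih hv hφ.2)
  | all K φ ih =>
    have hv' := hv.lift (hv.sort_form hφ.1)
    rw [interpForm_all]
    exact .isProp_pi (hv'.form hφ.2) (ih hv' hφ.2)
  | ex K φ =>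
    have hK := hv.sort_form hφ.1
    rw [interpForm_ex]
    exact .isProp_tr (.sgForm hK ((hv.lift hK).form hφ.2))

end ValWF

end HSignature

end FOLIso

/-! ### Forcing and the logical rules -/

namespace FOLIso.HSignature

open HoTT HoTT.Expr HoTT.Jdg

variable {L : HSignature} {cl : Bool} {E Δ : List Expr} {N : L.Obj → Expr} {v s : ℕ → Expr}
  {Γ Γ' : Ctx L.toSignature} {K : SortExpr L.toSignature} {φ ψ χ θ : Form L.toSignature}
  {t : Expr}

/-- The Kripke-style semantics of the sequent `Γ | φ ⇒ ψ` over an interpretation `N` of the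
non-logical sorts in the context `E`: in every context over `E` and under every valuation of `Γ`,
if `φ` is inhabited then so is `ψ`. Only inhabitation is recorded, so that the rules can be
verified without writing proof terms. -/
def Forces (L : HSignature) (cl : Bool) (E : List Expr) (N : L.Obj → Expr)
    (Γ : Ctx L.toSignature) (φ ψ : Form L.toSignature) : Prop :=
  ∀ ⦃Δ s v⦄, SubstWF cl Δ s E → L.ValWF cl Δ (fun A => (N A).subst s) v Γ →
    Inh cl Δ (L.interpForm (fun A => (N A).subst s) v φ) →
    Inh cl Δ (L.interpForm (fun A => (N A).subst s) v ψ)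

theorem ValWF.ex_intro (hv : L.ValWF cl E N v Γ) (hK : SortWF Γ K) (hφ : FormWF (K :: Γ) φ)
    (ht : Der cl E (tm t (L.interpSortExpr N v K)))
    (h : Inh cl E (L.interpForm N (Expr.scons t v) φ)) :
    Inh cl E (L.interpForm N v (.ex K φ)) := by
  have hφ' := (hv.lift (hv.sort_form hK)).form hφ
  rw [interpForm_ex]
  exact (Inh.pair hφ' ht (by simpa using h)).tr

namespace Forces

theorem stable {Ε : List Expr} {s' : ℕ → Expr} (h : L.Forces cl E N Γ φ ψ)
    (hs : SubstWF cl Δ s E) (hv : L.ValWF cl Δ (fun A => (N A).subst s) v Γ)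
    (hs' : SubstWF cl Ε s' Δ)
    (hφ : Inh cl Ε ((L.interpForm (fun A => (N A).subst s) v φ).subst s')) :
    Inh cl Ε ((L.interpForm (fun A => (N A).subst s) v ψ).subst s') := by
  have hv' := hv.substWF hs'
  simp only [Expr.subst_subst, subst_interpForm] at hv' hφ ⊢
  exact h (hs.comp hs') hv' hφ

theorem refl : L.Forces cl E N Γ φ φ := fun _ _ _ _ _ h => h

theorem trans (h : L.Forces cl E N Γ φ ψ) (h' : L.Forces cl E N Γ ψ θ) :
    L.Forces cl E N Γ φ θ := fun _ _ _ hs hv hφ => h' hs hv (h hs hv hφ)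

theorem rename {r : ℕ → ℕ} (hr : CtxMor Γ Γ' r) (h : L.Forces cl E N Γ' φ ψ) :
    L.Forces cl E N Γ (φ.rename r) (ψ.rename r) := fun _ _ _ hs hv hφ => by
  rw [interpForm_rename] at hφ ⊢
  exact h hs (hv.rename hr) hφ

theorem top : L.Forces cl E N Γ φ .top := fun _ _ _ _ hv _ => ⟨_, .star hv.interp.ok⟩

theorem bot (hφ : FormWF Γ φ) : L.Forces cl E N Γ .bot φ :=
  fun _ _ _ _ hv h => h.exfalso (hv.form hφ)

theorem and_intro (hφ : FormWF Γ φ) (hψ : FormWF Γ ψ) (h₁ : L.Forces cl E N Γ θ φ)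
    (h₂ : L.Forces cl E N Γ θ ψ) : L.Forces cl E N Γ θ (.and φ ψ) := fun _ _ _ hs hv h =>
  .prod_intro (hv.form hφ) (hv.form hψ) (h₁ hs hv h) (h₂ hs hv h)

theorem and_left (hφ : FormWF Γ φ) (hψ : FormWF Γ ψ) : L.Forces cl E N Γ (.and φ ψ) φ :=
  fun _ _ _ _ hv h => h.prod_left (hv.form hφ) (hv.form hψ)

theorem and_right (hφ : FormWF Γ φ) (hψ : FormWF Γ ψ) : L.Forces cl E N Γ (.and φ ψ) ψ :=
  fun _ _ _ _ hv h => h.prod_right (hv.form hφ) (hv.form hψ)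

theorem and_swap (hφ : FormWF Γ φ) (hψ : FormWF Γ ψ) :
    L.Forces cl E N Γ (.and φ ψ) (.and ψ φ) :=
  and_intro hψ hφ (and_right hφ hψ) (and_left hφ hψ)

theorem or_elim (hφ : FormWF Γ φ) (hψ : FormWF Γ ψ) (hθ : FormWF Γ θ)
    (h₁ : L.Forces cl E N Γ φ θ) (h₂ : L.Forces cl E N Γ ψ θ) :
    L.Forces cl E N Γ (.or φ ψ) θ := fun _ _ _ hs hv h =>
  .tr_sum_elim (hv.form hφ) (hv.form hψ) (hv.form hθ) (hv.isProp hθ) (h₁.stable hs hv ·)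
    (h₂.stable hs hv ·) h

theorem or_left (hψ : FormWF Γ ψ) : L.Forces cl E N Γ φ (.or φ ψ) :=
  fun _ _ _ _ hv h => (h.inl (hv.form hψ)).tr

theorem or_right (hφ : FormWF Γ φ) : L.Forces cl E N Γ ψ (.or φ ψ) :=
  fun _ _ _ _ hv h => (h.inr (hv.form hφ)).tr

theorem imp_intro (hθ : FormWF Γ θ) (hφ : FormWF Γ φ) (h : L.Forces cl E N Γ (.and θ φ) ψ) :
    L.Forces cl E N Γ θ (.imp φ ψ) := fun _ _ _ hs hv hθ' =>
  .arrow_intro (hv.form hφ) fun hs' hφ' => h.stable hs hv hs' <|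
    subst_prod _ _ _ ▸
      .prod_intro ((hv.form hθ).substWF hs') ((hv.form hφ).substWF hs') (hθ'.substWF hs') hφ'

theorem imp_elim (hθ : FormWF Γ θ) (hφ : FormWF Γ φ) (hψ : FormWF Γ ψ)
    (h : L.Forces cl E N Γ θ (.imp φ ψ)) : L.Forces cl E N Γ (.and θ φ) ψ := fun _ _ _ hs hv h' =>
  .arrow_elim (hv.form hφ) (hv.form hψ) (h hs hv (and_left hθ hφ hs hv h'))
    (and_right hθ hφ hs hv h')

theorem all_intro (hK : SortWF Γ K) (h : L.Forces cl E N (K :: Γ) θ.wk φ) :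
    L.Forces cl E N Γ θ (.all K φ) := fun _ _ _ hs hv hθ => by
  have hT := hv.sort_form hK
  have hv' := hv.lift hT
  have hθ' := hθ.substWF (.shift hT)
  simp only [Expr.subst_subst, subst_interpForm] at hv' hθ'
  rw [interpForm_all]
  simp only [Expr.subst_subst]
  exact (h (hs.comp (.shift hT)) hv' (by simpa only [interpForm_wk, comp_shift_scons])).lam

theorem all_elim (hK : SortWF Γ K) (hφ : FormWF (K :: Γ) φ)
    (h : L.Forces cl E N Γ θ (.all K φ)) : L.Forces cl E N (K :: Γ) θ.wk φ := by
  intro _ _ _ hs hv hθ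
  rw [interpForm_wk] at hθ
  have hall := h hs hv.tail hθ
  rw [interpForm_all] at hall
  simpa using hall.app ((hv.tail.lift (hv.tail.sort_form hK)).form hφ) hv.head

theorem ex_intro (hK : SortWF Γ K) (hφ : FormWF (K :: Γ) φ)
    (h : L.Forces cl E N Γ (.ex K φ) θ) : L.Forces cl E N (K :: Γ) φ θ.wk := by
  intro _ _ _ hs hv hφ'
  rw [interpForm_wk]
  exact h hs hv.tail (hv.tail.ex_intro hK hφ hv.head (by rwa [scons_eta]))

theorem ex_elim (hK : SortWF Γ K) (hφ : FormWF (K :: Γ) φ) (hθ : FormWF Γ θ)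
    (h : L.Forces cl E N (K :: Γ) φ θ.wk) : L.Forces cl E N Γ (.ex K φ) θ := by
  intro _ _ _ hs hv hex
  rw [interpForm_ex] at hex
  refine .tr_sg_elim ((hv.lift (hv.sort_form hK)).form hφ) (hv.form hθ) (hv.isProp hθ)
    (fun {Ε s' a} hs' ha hφ' => ?_) hex
  have hv' := hv.substWF hs'
  rw [subst_interpSortExpr] at ha
  replace ha := hv'.scons ha
  simp only [subst_interpForm, comp_scons, comp_assoc, comp_shift_scons,
    Expr.subst_subst] at ha hφ' ⊢
  simpa only [interpForm_wk, comp_shift_scons] using h (hs.comp hs') ha hφ'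

theorem ex_top (hK : SortWF Γ K) (hφ : FormWF (K :: Γ) φ) :
    L.Forces cl E N Γ (.ex K φ) (.ex K .top) :=
  ex_elim hK hφ ⟨hK, trivial⟩ (top.trans (ex_intro (θ := .ex K .top) hK trivial refl))

theorem frobenius (hφ : FormWF Γ φ) (hK : SortWF Γ K) (hψ : FormWF (K :: Γ) ψ) :
    L.Forces cl E N Γ (.and φ (.ex K ψ)) (.ex K (.and φ.wk ψ)) :=
  have hφ' := hφ.wk K
  have hχ : FormWF Γ (.ex K (.and φ.wk ψ)) := ⟨hK, hφ', hψ⟩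
  have hex : FormWF Γ (.ex K ψ) := ⟨hK, hψ⟩
  have h : L.Forces cl E N Γ (.ex K ψ) (.imp φ (.ex K (.and φ.wk ψ))) :=
    ex_elim hK hψ ⟨hφ, hχ⟩
      (imp_intro hψ hφ' ((and_swap hψ hφ').trans (ex_intro hK ⟨hφ', hψ⟩ refl)))
  (and_swap hφ hex).trans (imp_elim hex hφ hχ h)

theorem distrib (hφ : FormWF Γ φ) (hψ : FormWF Γ ψ) (hχ : FormWF Γ χ) :
    L.Forces cl E N Γ (.and φ (.or ψ χ)) (.or (.and φ ψ) (.and φ χ)) :=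
  have hθ : FormWF Γ (.or (.and φ ψ) (.and φ χ)) := ⟨⟨hφ, hψ⟩, hφ, hχ⟩
  have hor : FormWF Γ (.or ψ χ) := ⟨hψ, hχ⟩
  have h : L.Forces cl E N Γ (.or ψ χ) (.imp φ (.or (.and φ ψ) (.and φ χ))) :=
    or_elim hψ hχ ⟨hφ, hθ⟩ (imp_intro hψ hφ ((and_swap hψ hφ).trans (or_left hθ.2)))
      (imp_intro hχ hφ ((and_swap hχ hφ).trans (or_right hθ.1)))
  (and_swap hφ hor).trans (imp_elim hor hφ hθ h)

theorem lem (hcl : cl = true) (hφ : FormWF Γ φ) :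
    L.Forces cl E N Γ .top (.or φ (.imp φ .bot)) := fun _ _ _ _ hv _ =>
  (Inh.lem hcl (hv.isSmall_form hφ) (hv.isProp hφ)).tr

end Forces

end FOLIso.HSignature

/-! ### Forcing the rules for isomorphism, reflexivity and transport sorts -/

namespace FOLIso

theorem SortWF.face_eq_rename {L : Signature} {Γ : Ctx L} {K K' : SortExpr L} {f : Arr K'.head}
    (hK' : SortWF (K :: Γ) K') (hf : K'.args f = 0) : K'.face f = K.rename Nat.succ := by
  have h := hK' f
  rw [hf] at h
  exact h.eq_of_zero

theorem SortWF.face_eq_succ {L : Signature} {Γ : Ctx L} {I R : L.Obj} {q : Arr I → ℕ}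
    {w : Arr R → ℕ} {r : NHom R I} (hw : SortWF (⟨I, q⟩ :: Γ) ⟨R, w⟩) (hr : w r.toArr = 0) :
    face r w = fun p => q p + 1 := by
  have h : (⟨I, face r w⟩ : SortExpr L) = ⟨I, fun p => q p + 1⟩ := hw.face_eq_rename hr
  simpa using h

theorem SortWF.source_eq_target {L : HSignature} {Γ : Ctx L.toSignature} {B I R : L.Obj}
    {s t : NHom I B} {r : NHom R I} {q : Arr I → ℕ} {w : Arr R → ℕ}
    (hw : SortWF (⟨I, q⟩ :: Γ) ⟨R, w⟩) (hR : L.kind R = .refl B I s t r) (hr : w r.toArr = 0) :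
    q s.toArr = q t.toArr := by
  simpa only [hw.face_eq_succ hr, Nat.add_right_cancel_iff] using
    HSignature.refl_source_eq_target hR w

namespace HSignature

open HoTT HoTT.Expr HoTT.Jdg

variable {L : HSignature} {cl : Bool} {E : List Expr} {N : L.Obj → Expr} {v : ℕ → Expr}
  {Γ : Ctx L.toSignature} {K : SortExpr L.toSignature} {χ ψ θ φ : Form L.toSignature}
  {A B I R T : L.Obj} {s t : NHom I B} {r : NHom R I} {f : NHom A B} {e : NHom T I}
  {f₁ f₂ : NHom T A} {p q : Arr I → ℕ} {w : Arr R → ℕ} {u : Arr T → ℕ}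

theorem interpSortExpr_iso (hI : L.kind I = .iso B s t) (hp : SortWF (K :: Γ) ⟨I, p⟩)
    (ht : p t.toArr = 0) (N : L.Obj → Expr) (v : ℕ → Expr) :
    L.interpSortExpr N v ⟨I, p⟩ =
      Id (L.interpSortExpr N (comp shift v) K) (v (p s.toArr)) (v 0) := by
  have hK : (⟨B, face t p⟩ : SortExpr L.toSignature) = K.rename Nat.succ := hp.face_eq_rename ht
  have h : L.interpSortExpr N v ⟨I, p⟩ =
      Id (L.interpSortExpr N v ⟨B, face t p⟩) (v (p s.toArr)) (v (p t.toArr)) := by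
    rw [← face_source_eq_target hI, interpSortExpr, interpSort_iso hI]
    rfl
  rw [h, hK, ht]
  rfl

theorem interpSortExpr_refl (hR : L.kind R = .refl B I s t r)
    (hw : SortWF (⟨I, q⟩ :: Γ) ⟨R, w⟩) (hr : w r.toArr = 0) (N : L.Obj → Expr) (v : ℕ → Expr) :
    L.interpSortExpr N v ⟨R, w⟩ =
      Id (L.interpSortExpr N (comp shift v) ⟨I, q⟩) (v 0) (.refl (v (q s.toArr + 1))) := by
  rw [interpSortExpr, interpSort_refl hR]
  simp only [← map_face v, hw.face_eq_succ hr, hr]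
  rfl

theorem transp_face_eq (hT : L.kind T = .transp A B I f s t e f₁ f₂) {α : Type} {a : Arr T → α}
    (hst : face e a s.toArr = face e a t.toArr) : face f₁ a = face f₂ a := by
  funext g
  by_cases hg : g = f.toArr
  · rw [hg, ← transp_source hT, hst, transp_target hT]
  · exact transp_of_ne hT a hg

theorem ArgsWF.transp_of_refl {a : Arr T → Expr} (hT : L.kind T = .transp A B I f s t e f₁ f₂)
    (hN : L.InterpWF cl E N Set.univ) (ha : L.ArgsWF cl E N a Set.univ)
    (hst : FOLIso.face e a s.toArr = FOLIso.face e a t.toArr) (hf : a f₁.toArr = a f₂.toArr)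
    (h : Inh cl E (Id (L.interpSort N I (FOLIso.face e a)) (a e.toArr)
      (.refl (FOLIso.face e a s.toArr)))) :
    Inh cl E (L.interpSort N T a) := by
  have hb := ha.face_univ f₁
  have hB := (sortFormWF cl B (hN.mono (Set.subset_univ _)) (hb.face_univ f)).form
  have hP := transpMotive_form (L.transp_spec hT).2.1 (sortFormWF cl A)
    (hN.mono (Set.subset_univ _)) hb hB
  have hI : L.interpSort N I (FOLIso.face e a) =
      Id (L.interpSort N B (FOLIso.face f (FOLIso.face f₁ a))) (FOLIso.face f₁ a f.toArr)
        (FOLIso.face f₁ a f.toArr) := by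
    rw [interpSort_iso (L.transp_spec hT).1, ← hst, transp_face_source hT, transp_source hT]
  have hx := hb.toArr f
  have hq := ha.toArr e
  have ht := ha.toArr f₁
  rw [hI] at hq h
  rw [← transpMotive_self N f] at ht
  rw [transp_source hT] at h
  have hd := Inh.id_trans_of_refl hx hP ht hq h
  rwa [interpSort_transp hT, ← transp_face_eq hT hst, ← hf, ← transpMotive_self N f]

namespace ValWF

theorem ofSort_intro (hv : L.ValWF cl E N v Γ) (hK : SortWF Γ K)
    (h : Inh cl E (L.interpSortExpr N v K)) : Inh cl E (L.interpForm N v (.ofSort K)) := by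
  obtain ⟨t, ht⟩ := h
  exact hv.ex_intro hK (φ := .top) trivial ht ⟨_, .star hv.interp.ok⟩

theorem refl (hv : L.ValWF cl E N v Γ) (hI : L.kind I = .iso B s t) (hq : SortWF Γ ⟨I, q⟩)
    (hst : q s.toArr = q t.toArr) :
    Der cl E (tm (.refl (v (q s.toArr))) (L.interpSortExpr N v ⟨I, q⟩)) := by
  have hx : Der cl E (tm (v (q s.toArr)) (L.interpSort N B (face s fun g => v (q g)))) :=
    hv.var (hq s.toArr)
  rw [interpSortExpr, interpSort_iso hI]
  simpa only [← hst] using Der.refl hx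

theorem transp_of_refl (hv : L.ValWF cl E N v Γ) (hR : L.kind R = .refl B I s t r)
    (hT : L.kind T = .transp A B I f s t e f₁ f₂) (hu : SortWF Γ ⟨T, u⟩)
    (hface : face r w = face e u) (hre : w r.toArr = u e.toArr) (hf : u f₁.toArr = u f₂.toArr)
    (h : Inh cl E (L.interpSortExpr N v ⟨R, w⟩)) : Inh cl E (L.interpSortExpr N v ⟨T, u⟩) := by
  have hst := refl_source_eq_target hR w
  rw [hface] at hst
  rw [interpSortExpr, interpSort_refl hR] at h
  simp only [← map_face v, hface, hre] at h
  exact (hv.argsWF hu).transp_of_refl hT hv.interp (congrArg v hst) (congrArg v hf) h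

theorem isRefl_refl (hv : L.ValWF cl E N v Γ) (hR : L.kind R = .refl B I s t r)
    (hq : SortWF Γ ⟨I, q⟩) (hw : SortWF (⟨I, q⟩ :: Γ) ⟨R, w⟩) (hr : w r.toArr = 0) :
    Inh cl E (L.interpForm N (Expr.scons (.refl (v (q s.toArr))) v) (.ofSort ⟨R, w⟩)) := by
  have hrefl := hv.refl (L.refl_spec hR).1 hq (hw.source_eq_target hR hr)
  refine (hv.scons hrefl).ofSort_intro hw ?_
  rw [interpSortExpr_refl hR hw hr]
  exact .id_refl hrefl

theorem path_ind (hv : L.ValWF cl E N v (⟨I, p⟩ :: K.rename Nat.succ :: K :: Γ))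
    (hI : L.kind I = .iso B s t) (hs : p s.toArr = 1) (ht : p t.toArr = 0) (hK : SortWF Γ K)
    (hp : SortWF (K.rename Nat.succ :: K :: Γ) ⟨I, p⟩)
    (hχ : FormWF (⟨I, p⟩ :: K.rename Nat.succ :: K :: Γ) χ)
    (h : Inh cl E (L.interpForm N
      (Expr.scons (.refl (v 2)) (Expr.scons (v 2) (comp shift (comp shift v)))) χ)) :
    Inh cl E (L.interpForm N v χ) := by
  have hK' : SortWF (K :: Γ) (K.rename Nat.succ) := hK.rename (.succ K)
  have hv₁ := hv.tail.tail
  have hv₂ := hv₁.lift (hv₁.sort_form hK')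
  have hC := (hv₂.lift (hv₂.sort_form hp)).form hχ
  have hIso := interpSortExpr_iso hI hp ht
  have ha : Der cl E (tm (v 2) (L.interpSortExpr N (comp shift (comp shift v))
    (K.rename Nat.succ))) := hv₁.head
  have hpath := hv.head
  rw [hIso, hs] at hC hpath
  rw [comp_shift_scons, ← subst_interpSortExpr] at hC
  have hd := Inh.path_ind (C := L.interpForm _ _ χ) ha hC ?_ hv.tail.head hpath
  · have hη : Expr.scons (v 0) (Expr.scons (v 1) (comp shift (comp shift v))) = v := by
      funext i
      rcases i with _ | _ | i <;> rfl
    simpa [hη] using hd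
  · simpa using h

end ValWF

namespace Forces

theorem exists_refl (hR : L.kind R = .refl B I s t r) (hq : SortWF Γ ⟨I, q⟩)
    (hw : SortWF (⟨I, q⟩ :: Γ) ⟨R, w⟩) (hr : w r.toArr = 0) :
    L.Forces cl E N Γ θ (.ex ⟨I, q⟩ (.ofSort ⟨R, w⟩)) := fun _ _ _ _ hv _ =>
  hv.ex_intro hq ⟨hw, trivial⟩ (hv.refl (L.refl_spec hR).1 hq (hw.source_eq_target hR hr))
    (hv.isRefl_refl hR hq hw hr)

theorem transp_of_refl (hR : L.kind R = .refl B I s t r)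
    (hT : L.kind T = .transp A B I f s t e f₁ f₂) (hw : SortWF (⟨I, q⟩ :: Γ) ⟨R, w⟩)
    (hu : SortWF (⟨I, q⟩ :: Γ) ⟨T, u⟩) (hr : w r.toArr = 0) (he : u e.toArr = 0)
    (hf : u f₁.toArr = u f₂.toArr) :
    L.Forces cl E N (⟨I, q⟩ :: Γ) (.ofSort ⟨R, w⟩) (.ofSort ⟨T, u⟩) := by
  have hface : face r w = face e u := (hw.face_eq_succ hr).trans (hu.face_eq_succ he).symm
  refine ex_elim (φ := .top) hw trivial ⟨hu, trivial⟩ fun _ _ _ _ hv _ => ?_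
  rw [interpForm_wk]
  exact hv.tail.ofSort_intro hu
    (hv.tail.transp_of_refl hR hT hu hface (hr.trans he.symm) hf ⟨_, hv.head⟩)

theorem path_ind (hR : L.kind R = .refl B I s t r) (hs : p s.toArr = 1) (ht : p t.toArr = 0)
    (hr : w r.toArr = 0) (hK : SortWF Γ K) (hp : SortWF (K.rename Nat.succ :: K :: Γ) ⟨I, p⟩)
    (hq : SortWF (K :: Γ) ⟨I, fun g => contract01 (p g)⟩)
    (hw : SortWF (⟨I, fun g => contract01 (p g)⟩ :: K :: Γ) ⟨R, w⟩)
    (hχ : FormWF (⟨I, p⟩ :: K.rename Nat.succ :: K :: Γ) χ)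
    (h : L.Forces cl E N (⟨I, fun g => contract01 (p g)⟩ :: K :: Γ) (.ofSort ⟨R, w⟩)
      (χ.rename (liftR contract01))) :
    L.Forces cl E N (⟨I, p⟩ :: K.rename Nat.succ :: K :: Γ) ψ χ := fun Δ σ v hσ hv _ => by
  have hI := (L.refl_spec hR).1
  refine hv.path_ind hI hs ht hK hp hχ ?_
  have hv₁ := hv.tail.tail
  have hrefl := hv₁.refl hI hq (hw.source_eq_target hR hr)
  have hd := h hσ (hv₁.scons hrefl) (hv₁.isRefl_refl hR hq hw hr)
  have hcontract : (fun i => Expr.scons (.refl (v 2)) (comp shift (comp shift v))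
      (liftR contract01 i)) =
      Expr.scons (.refl (v 2)) (Expr.scons (v 2) (comp shift (comp shift v))) := by
    funext i
    rcases i with _ | _ | i <;> rfl
  rw [interpForm_rename, hs] at hd
  rwa [← hcontract]

theorem J (hR : L.kind R = .refl B I s t r) (hs : p s.toArr = 1) (ht : p t.toArr = 0)
    (hr : w r.toArr = 0) (hK : SortWF Γ K) (hp : SortWF (K.rename Nat.succ :: K :: Γ) ⟨I, p⟩)
    (hq : SortWF (K :: Γ) ⟨I, fun g => contract01 (p g)⟩)
    (hw : SortWF (⟨I, fun g => contract01 (p g)⟩ :: K :: Γ) ⟨R, w⟩)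
    (hθ' : FormWF (⟨I, fun g => contract01 (p g)⟩ :: K :: Γ) (θ.rename (liftR contract01)))
    (hθ : FormWF (⟨I, p⟩ :: K.rename Nat.succ :: K :: Γ) θ)
    (hφ : FormWF (⟨I, p⟩ :: K.rename Nat.succ :: K :: Γ) φ)
    (h : L.Forces cl E N (⟨I, fun g => contract01 (p g)⟩ :: K :: Γ)
      (.and (.ofSort ⟨R, w⟩) (θ.rename (liftR contract01))) (φ.rename (liftR contract01))) :
    L.Forces cl E N (⟨I, p⟩ :: K.rename Nat.succ :: K :: Γ) θ φ :=
  have himp : L.Forces cl E N (⟨I, p⟩ :: K.rename Nat.succ :: K :: Γ) θ (.imp θ φ) :=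
    path_ind hR hs ht hr hK hp hq hw ⟨hθ, hφ⟩ (imp_intro ⟨hw, trivial⟩ hθ' h)
  (and_intro hθ hθ refl refl).trans (imp_elim hθ hθ hφ himp)

end Forces

end HSignature

end FOLIso

/-! ### Soundness -/

namespace FOLIso

open HoTT HoTT.Expr HoTT.Jdg HSignature

theorem Entails.forces {L : HSignature} {cl : Bool} {T : Theory L.toSignature} {E : List Expr}
    {N : L.Obj → Expr} (hT : ∀ σ ∈ T.axioms, L.Forces cl E N σ.ctx σ.hyp σ.concl)
    {σ : Sequent L.toSignature} (h : Entails L cl T σ) :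
    L.Forces cl E N σ.ctx σ.hyp σ.concl := by
  induction h with
  | ax h => exact hT _ h
  | iden _ => exact .refl
  | sub _ hr _ ih => exact ih.rename hr
  | cut _ _ ih₁ ih₂ => exact ih₁.trans ih₂
  | conWk _ _ ih => exact ih.rename (.succ _)
  | @conExch Γ Γ' K K' _ _ _ _ _ ih => exact ih.rename ((CtxMor.swap01 K K').renameTele Γ')
  | top _ => exact .top
  | bot h => exact .bot h.2.2
  | exTop h => exact .ex_top h.2.1.1 h.2.1.2
  | andIntro h₁ h₂ ih₁ ih₂ => exact .and_intro h₁.wf.2.2 h₂.wf.2.2 ih₁ ih₂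
  | andLeft h ih => exact ih.trans (.and_left h.wf.2.2.1 h.wf.2.2.2)
  | andRight h ih => exact ih.trans (.and_right h.wf.2.2.1 h.wf.2.2.2)
  | orElim h₁ h₂ ih₁ ih₂ => exact .or_elim h₁.wf.2.1 h₂.wf.2.1 h₁.wf.2.2 ih₁ ih₂
  | orLeft h ih => exact (Forces.or_left h.wf.2.1.2).trans ih
  | orRight h ih => exact (Forces.or_right h.wf.2.1.1).trans ih
  | impIntro h ih => exact .imp_intro h.wf.2.1.1 h.wf.2.1.2 ih
  | impElim h ih => exact .imp_elim h.wf.2.1 h.wf.2.2.1 h.wf.2.2.2 ih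
  | allIntro _ h ih => exact .all_intro h.wf.1.2 ih
  | allElim h ih => exact .all_elim h.wf.2.2.1 h.wf.2.2.2 ih
  | exElim hθ h ih => exact .ex_elim h.wf.1.2 h.wf.2.1 hθ ih
  | exIntro h ih => exact .ex_intro h.wf.2.1.1 h.wf.2.1.2 ih
  | frob h => exact .frobenius h.2.1.1 h.2.1.2.1 h.2.1.2.2
  | dist h => exact .distrib h.2.1.1 h.2.1.2.1 h.2.1.2.2
  | lem hcl h => exact .lem hcl h.2.2.1
  | rho _ hR _ _ hr h => exact .exists_refl hR h.2.2.1 h.2.2.2.1 hr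
  | tauRho hR hE _ _ hr he h₁ h₂ h =>
    exact (Forces.and_left h.2.1.1 h.2.1.2).trans
      (.transp_of_refl hR hE h.2.1.1.1 h.2.2.1 hr he (h₁.trans h₂.symm))
  | J _ hR hs ht hr hσ h ih =>
    exact .J hR hs ht hr hσ.1.1.1.2 hσ.1.2 h.wf.1.2 h.wf.2.1.1.1 h.wf.2.1.2 hσ.2.1 hσ.2.2 ih

namespace HSignature

variable {L : HSignature} {cl : Bool} {Γ₀ E : List Expr} {M B : Expr} {v s : ℕ → Expr}
  {Γ : Ctx L.toSignature} {σ : Sequent L.toSignature}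

/-- The context of type theory that interprets `Γ`. -/
noncomputable def interpCtx (L : HSignature) (Γ₀ : List Expr) (M : Expr) :
    Ctx L.toSignature → List Expr
  | [] => Γ₀
  | K :: Γ => L.interpSortExpr (fun A => (L.proj M A).wkN Γ.length) var K :: interpCtx L Γ₀ M Γ

theorem valWF_var (hM : L.IsStructure cl Γ₀ M) (hΓ : CtxWF Γ) :
    L.ValWF cl (L.interpCtx Γ₀ M Γ) (fun A => (L.proj M A).wkN Γ.length) var Γ := by
  induction Γ with
  | nil =>
    exact ⟨by simpa [wkN_zero, interpCtx] using hM.interpWF,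
      fun h => absurd h.lt_length (Nat.not_lt_zero _)⟩
  | cons K Γ ih =>
    have hv := ih hΓ.1
    simpa [interpCtx, ← wkN_succ] using hv.lift (hv.sort_form hΓ.2)

theorem substWF_shift_interpCtx (hM : L.IsStructure cl Γ₀ M) (hΓ : CtxWF Γ) :
    SubstWF cl (L.interpCtx Γ₀ M Γ) (fun i => var (i + Γ.length)) Γ₀ := by
  induction Γ with
  | nil => exact .id hM.ctx_ok
  | cons K Γ ih =>
    have hK := (valWF_var hM hΓ.1).sort_form hΓ.2
    exact (ih hΓ.1).comp (.shift hK)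

theorem inh_piCtx (hB : Der cl (L.interpCtx Γ₀ M Γ) (ty B)) :
    Inh cl Γ₀ (L.piCtx M Γ B) ↔ Inh cl (L.interpCtx Γ₀ M Γ) B := by
  induction Γ generalizing B with
  | nil => rfl
  | cons K Γ ih => exact (ih (.piForm hB.head_form hB)).trans ⟨.app_var_zero hB, .lam⟩

/-- The substitution that extends `s` by the first `n` terms of `v`. -/
def extSubst (s : ℕ → Expr) : ℕ → (ℕ → Expr) → ℕ → Expr
  | 0, _ => s
  | n + 1, v => scons (v 0) (extSubst s n (comp shift v))

theorem wkN_subst_extSubst (e : Expr) (s : ℕ → Expr) (n : ℕ) (v : ℕ → Expr) :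
    (e.wkN n).subst (extSubst s n v) = e.subst s := by
  induction n generalizing v with
  | zero => rw [wkN_zero, extSubst]
  | succ n ih => rw [extSubst, wkN_add_one_scons, ih]

theorem extSubst_of_lt (s : ℕ → Expr) {n i : ℕ} (v : ℕ → Expr) (h : i < n) :
    extSubst s n v i = v i := by
  induction n generalizing v i with
  | zero => omega
  | succ n ih =>
    cases i with
    | zero => rfl
    | succ i => exact ih (comp shift v) (by omega)

theorem substWF_extSubst (hΓ : CtxWF Γ) (hs : SubstWF cl E s Γ₀)
    (hv : L.ValWF cl E (fun A => (L.proj M A).subst s) v Γ) :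
    SubstWF cl E (extSubst s Γ.length v) (L.interpCtx Γ₀ M Γ) := by
  induction Γ generalizing v with
  | nil => exact hs
  | cons K Γ ih =>
    refine (ih hΓ.1 hv.tail).scons ?_
    rw [subst_interpSortExpr]
    simp only [wkN_subst_extSubst, comp_var_left]
    rw [interpSortExpr_congr hΓ.2 fun i hi => extSubst_of_lt s _ hi]
    exact hv.head

theorem satisfies_iff_forces (hM : L.IsStructure cl Γ₀ M) (hσ : σ.WF) :
    L.Satisfies cl Γ₀ M σ ↔ L.Forces cl Γ₀ (L.proj M) σ.ctx σ.hyp σ.concl := by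
  have hvar := valWF_var hM hσ.1
  have hφ := hvar.form hσ.2.1
  have hψ := hvar.form hσ.2.2
  have hs₀ := substWF_shift_interpCtx hM hσ.1
  refine (inh_piCtx (.arrowForm hφ hψ)).trans
    ⟨fun h E s v hs hv hφ' => ?_, fun h => .arrow_intro hφ fun hs' hφ' => ?_⟩
  · have h := h.substWF (substWF_extSubst hσ.1 hs hv)
    simp only [subst_arrow, subst_interpForm, wkN_subst_extSubst, comp_var_left] at h
    rw [interpForm_congr hσ.2.1 fun i hi => extSubst_of_lt s v hi,
      interpForm_congr hσ.2.2 fun i hi => extSubst_of_lt s v hi] at h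
    exact h.arrow_elim (hv.form hσ.2.1) (hv.form hσ.2.2) hφ'
  · simp only [wkN_eq_subst] at hvar hφ' ⊢
    exact h.stable hs₀ hvar hs' hφ'

end HSignature

end FOLIso

theorem theorem4 (L : FOLIso.HSignature) (cl : Bool) (T : FOLIso.Theory L.toSignature)
    (σ : FOLIso.Sequent L.toSignature) (hσ : FOLIso.Entails L cl T σ) :
    L.SemConsequence cl T σ := fun _ _ hM hT =>
  (FOLIso.HSignature.satisfies_iff_forces hM hσ.wf).2 <| hσ.forces fun σ' h =>
    (FOLIso.HSignature.satisfies_iff_forces hM (T.wf σ' h)).1 (hT σ' h)
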